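/- **Setting.** Let $\ell,h,k\ge 1$ be integers, $\mathcal X$ a set, $n\in\mathbb N$, and $F\colon\mathcal X^n\times[0,1]^\ell\to\mathbb R$; write $F_D=F(D,\cdot)$. Databases $D,D'\in\mathcal X^n$ are neighbours, $D\sim D'$, if they differ in exactly one entry. The sensitivity is $S(F)=\sup_{y\in[0,1]^\ell}\sup_{D\sim D'}|F_D(y)-F_{D'}(y)|$, assumed finite. $\mathrm{Lap}(\lambda)$ is the law with density $e^{-|x|/\lambda}/(2\lambda)$, and $\mathrm{Lap}(0)=\delta_0$. Let $b_{\nu,k}(y)=\binom k\nu y^\nu(1-y)^{k-\nu}$, $(B_kf)(y)=\sum_{\nu=0}^k f(\nu/k)\,b_{\nu,k}(y)$ and $b^{(h)}_{\nu,k}=\sum_{i=1}^h\binom hi(-1)^{i-1}B_k^{\,i-1}b_{\nu,k}$. For a privacy budget $\varepsilon>0$, the *Bernstein mechanism* of order $h$ and cover size $k$ releases $\widetilde F_D(\nu/k)=F_D(\nu/k)+Z_\nu$ for all $\nu\in\{0,\dots,k\}^\ell$, with $Z_\nu$ i.i.d. $\mathrm{Lap}(S(F)(k+1)^\ell/\varepsilon)$;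 a query $y\in[0,1]^\ell$ is answered by $\mathcal A(y)=\sum_{\nu\in\{0,\dots,k\}^\ell}\widetilde F_D(\nu/k)\prod_{i=1}^\ell b^{(h)}_{\nu_i,k}(y_i)$. It is *$\varepsilon$-differentially private* if for all $D\sim D'$ and all measurable sets $A$ of released values, the probability of $A$ under $D$ is at most $e^\varepsilon$ times its probability under $D'$. It is *$(\alpha,\beta)$-accurate* if for every $D$, with probability at least $1-\beta$, $\sup_{y\in[0,1]^\ell}|\mathcal A(y)-F_D(y)|\le\alpha$. A function $f\colon[0,1]^\ell\to\mathbb R$ is *$(m,T)$-smooth* if it is $C^m$ on $[0,1]^\ell$ and its partial derivatives of orders $1,\dots,m$ are bounded by $T$ in absolute value; *$(\gamma,L)$-Hölder* if $|f(x)-f(y)|\le L\|x-y\|_\infty^\gamma$ for all $x,y$; *linear* if $f(y)=\sum_i a_iy_i+c$. Put $x=\frac{S(F)}{\varepsilon}\log(1/\beta)$. **Theorem.** 1. *(Privacy.)* For all $\ell,h,k,n,\mathcal X,\varepsilon>0$ and all $F$ with $S(F)<\infty$, the Bernstein mechanism is $\varepsilon$-differentially private. 2. *(Accuracy, smooth case.)*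 For all $\ell,h\ge1$ and $T>0$ there is a choice of cover size $k=k(S(F),\varepsilon,\beta)\ge 1$ (the choice depends otherwise only on $\ell,h,T$) such that for all $\beta_0<1$ and $M$ there is a constant $C$, depending only on $\ell,h,T,\beta_0,M$, with: for all $n,\mathcal X$ and $F$ with $0<S(F)<\infty$ and every $F_D$ $(2h,T)$-smooth, all $\varepsilon>0$ and $0<\beta\le\beta_0$ with $x\le M$, the mechanism of order $h$ is $(\alpha,\beta)$-accurate with $\alpha=C\,x^{h/(\ell+h)}$. 3. *(Accuracy, Hölder case.)* For all $\ell\ge1$, $0<\gamma\le1$ and $L>0$ there is $k=k(S(F),\varepsilon,\beta)\ge1$ (depending otherwise only on $\ell,\gamma,L$) such that for all $h\ge1$, $\beta_0<1$ and $M$ there is a constant $C$, depending only on $\ell,h,\gamma,L,\beta_0,M$, with: for all $n,\mathcal X$ and $F$ with $0<S(F)<\infty$ and every $F_D$ $(\gamma,L)$-Hölder, all $\varepsilon>0$ and $0<\beta\le\beta_0$ with $x\le M$, the mechanism of order $h$ is $(\alpha,\beta)$-accurate with $\alpha=C\,x^{\gamma/(2\ell+\gamma)}$. 4. *(Accuracy,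 linear case.)* For all $\ell,h\ge1$ there is a constant $k\ge1$ such that for every $\beta_0<1$ there is a constant $C$, depending only on $\ell,h,\beta_0$, with: for all $n,\mathcal X$ and $F$ with $S(F)<\infty$ and every $F_D$ linear, all $\varepsilon>0$ and $0<\beta\le\beta_0$, the mechanism of order $h$ is $(\alpha,\beta)$-accurate with $\alpha=C\,x$. 5. *(Running time.)* There are, for each $\ell$ a program for sanitization with input $(k,S(F),\varepsilon)$ and oracle access to $F_D$, and for each $\ell,h$ a program for evaluation with input $k$, $y$ and the released values only, on a real random access machine with unit-cost arithmetic, oracle calls and Laplace samples, which implement the Bernstein mechanism of order $h$ for all $k\ge 1$, and whose running times, for the cover sizes $k$ of 2, 3 and 4, are polynomial in $n$ and $1/\varepsilon$ when $1/S(F)\le\mathrm{poly}(n)$. That is: for every polynomial $q$ and all $\beta_0<1$, $\varepsilon_0$ there is a polynomial $P$ (depending besides only on $\ell,h$ and on $T$, resp. on $\gamma,L$) such that the time for sanitization and the time for each evaluation are at most $P(n,1/\varepsilon)$ whenever $0<S(F)<\infty$, $1/S(F)\le q(n)$, $0<\varepsilon\le\varepsilon_0$ and $0<\beta\le\beta_0$,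 for every database and every outcome of the random samples. -/

import Mathlib

open MeasureTheory

universe u

noncomputable section

/-! ### Databases, sensitivity, differential privacy -/

/-- The query space `[0,1]^ℓ`, as a subset of `ℝ^ℓ`.  Target functions are functions on all of `ℝ^ℓ`
of which only the values on the cube are ever used. -/
def cube (ℓ : ℕ) : Set (Fin ℓ → ℝ) := Set.Icc 0 1

/-- The two databases differ in exactly one entry. -/
def Neighbours {n : ℕ} {X : Type u} (D D' : Fin n → X) : Prop :=
  ∃ i, D i ≠ D' i ∧ ∀ j, j ≠ i → D j = D' j

/-- The sensitivity `S(F) = sup_{y ∈ [0,1]^ℓ} sup_{D ∼ D'} |F(D,y) - F(D',y)|`, possibly infinite. -/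
def sensitivity {n ℓ : ℕ} {X : Type u} (F : (Fin n → X) → (Fin ℓ → ℝ) → ℝ) : ENNReal :=
  ⨆ y ∈ cube ℓ, ⨆ (D : Fin n → X) (D' : Fin n → X) (_ : Neighbours D D'),
    ENNReal.ofReal |F D y - F D' y|

/-- `ε`-differential privacy of a mechanism, given by the law of its response on each database. -/
def DifferentiallyPrivate {n : ℕ} {X : Type u} {R : Type*} [MeasurableSpace R]
    (ε : ℝ) (M : (Fin n → X) → Measure R) : Prop :=
  ∀ D D' : Fin n → X, Neighbours D D' → ∀ A : Set R, MeasurableSet A →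
    M D A ≤ ENNReal.ofReal (Real.exp ε) * M D' A

/-- The Laplace distribution `Lap(lam)`, with density `exp(-|x|/lam) / (2 lam)`;
`Lap(0)` is the point mass at `0`. -/
def laplaceMeasure (lam : ℝ) : Measure ℝ :=
  if lam = 0 then Measure.dirac 0
  else volume.withDensity fun x => ENNReal.ofReal (Real.exp (-|x| / lam) / (2 * lam))

/-! ### Regularity classes -/

/-- `f` is `C^m` on the cube and its partial derivatives of order `1, …, m` are bounded there
by `T`.  (The function itself need not be bounded by `T`.) -/
def IsSmooth {ℓ : ℕ} (m : ℕ) (T : ℝ) (f : (Fin ℓ → ℝ) → ℝ) : Prop :=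
  ContDiffOn ℝ m f (cube ℓ) ∧
    ∀ j : ℕ, 1 ≤ j → j ≤ m → ∀ σ : Fin j → Fin ℓ, ∀ y ∈ cube ℓ,
      |iteratedFDerivWithin ℝ j f (cube ℓ) y (fun i => Pi.single (σ i) 1)| ≤ T

/-- `(γ, L)`-Hölder continuity on the cube; the norm on `Fin ℓ → ℝ` is the sup norm. -/
def IsHolder {ℓ : ℕ} (γ L : ℝ) (f : (Fin ℓ → ℝ) → ℝ) : Prop :=
  ∀ x ∈ cube ℓ, ∀ y ∈ cube ℓ, |f x - f y| ≤ L * ‖x - y‖ ^ γ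

/-- `f` is linear on the cube, in the sense `f(y) = ∑ aᵢ yᵢ + c`. -/
def IsLinearOnCube {ℓ : ℕ} (f : (Fin ℓ → ℝ) → ℝ) : Prop :=
  ∃ (a : Fin ℓ → ℝ) (c : ℝ), ∀ y ∈ cube ℓ, f y = ∑ i, a i * y i + c

/-! ### Iterated Bernstein polynomials -/

/-- The Bernstein operator `(B_k f)(y) = ∑_ν f(ν/k) b_{ν,k}(y)`. -/
def bernsteinOp (k : ℕ) (f : ℝ → ℝ) : ℝ → ℝ := fun y =>
  ∑ ν ∈ Finset.range (k + 1), f ((ν : ℝ) / k) * (bernsteinPolynomial ℝ k ν).eval y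

/-- The iterated basis `b^{(h)}_{ν,k} = ∑_{i=1}^h (h choose i) (-1)^{i-1} B_k^{i-1}(b_{ν,k})`. -/
def iterBasis (h k ν : ℕ) (y : ℝ) : ℝ :=
  ∑ i ∈ Finset.Icc 1 h, (h.choose i : ℝ) * (-1) ^ (i - 1) *
    ((bernsteinOp k)^[i - 1] fun t => (bernsteinPolynomial ℝ k ν).eval t) y

/-! ### The Bernstein mechanism -/

/-- Index set of the lattice cover `{0, 1/k, …, 1}^ℓ`. -/
abbrev LatticeIdx (ℓ k : ℕ) : Type := Fin ℓ → Fin (k + 1)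

/-- The lattice point `(ν₁/k, …, ν_ℓ/k)`. -/
def latticePoint {ℓ k : ℕ} (ν : LatticeIdx ℓ k) : Fin ℓ → ℝ := fun i => ((ν i : ℕ) : ℝ) / k

/-- Law of the family `(f(p) + Z_p)_p`, where `p` runs through the lattice cover and the `Z_p` are
independent with law `Lap(lam)`. -/
def noisyValues {ℓ : ℕ} (k : ℕ) (lam : ℝ) (f : (Fin ℓ → ℝ) → ℝ) :
    Measure (LatticeIdx ℓ k → ℝ) :=
  Measure.pi fun ν => (laplaceMeasure lam).map fun z => f (latticePoint ν) + z

/-- The perturbation scale `s (k+1)^ℓ / ε`. -/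
def noiseScale (ℓ k : ℕ) (s ε : ℝ) : ℝ := s * ((k : ℝ) + 1) ^ ℓ / ε

/-- The Bernstein mechanism (sanitization): its output on the database `D` is the family of the
values of `F_D` on the lattice cover, perturbed at scale `S(F) (k+1)^ℓ / ε`. -/
def bernsteinMechanism {n ℓ : ℕ} {X : Type u} (F : (Fin n → X) → (Fin ℓ → ℝ) → ℝ)
    (k : ℕ) (ε : ℝ) (D : Fin n → X) : Measure (LatticeIdx ℓ k → ℝ) :=
  noisyValues k (noiseScale ℓ k (sensitivity F).toReal ε) (F D)

/-- Evaluation: the iterated Bernstein polynomial of order `h` with the coefficients `w`, at `y`. -/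
def bernsteinEval {ℓ k : ℕ} (h : ℕ) (w : LatticeIdx ℓ k → ℝ) (y : Fin ℓ → ℝ) : ℝ :=
  ∑ ν : LatticeIdx ℓ k, w ν * ∏ i, iterBasis h k (ν i) (y i)

/-- `(α, β)`-accuracy of the Bernstein mechanism of order `h` and cover size `k`: for every
database, with probability at least `1 - β`, the released function is within `α` of `F_D`
simultaneously at all points of the cube. -/
def IsAccurate {n ℓ : ℕ} {X : Type u} (F : (Fin n → X) → (Fin ℓ → ℝ) → ℝ)
    (h k : ℕ) (ε α β : ℝ) : Prop :=
  ∀ D : Fin n → X, ENNReal.ofReal (1 - β) ≤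
    bernsteinMechanism F k ε D {w | ∀ y ∈ cube ℓ, |bernsteinEval h w y - F D y| ≤ α}

/-- The quantity `(S(F)/ε) log(1/β)`. -/
def errorScale (s ε β : ℝ) : ℝ := s / ε * Real.log (1 / β)

/-- With the cover size `k(S(F), ε, β)`, the Bernstein mechanism of order `h` is
`(O((S(F)/ε) log(1/β))^p, β)`-accurate for all `F` of positive finite sensitivity all of whose
functions `F_D` belong to `cls`.  The hidden constant is uniform in everything as long as
`β` stays away from `1` and `(S(F)/ε) log(1/β)` stays bounded. -/
def HasErrorRate {ℓ : ℕ} (cls : ((Fin ℓ → ℝ) → ℝ) → Prop) (h : ℕ) (k : ℝ → ℝ → ℝ → ℕ)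
    (p : ℝ) : Prop :=
  ∀ β₀ M : ℝ, β₀ < 1 → ∃ C : ℝ, 0 < C ∧
    ∀ (n : ℕ) (X : Type u) (F : (Fin n → X) → (Fin ℓ → ℝ) → ℝ),
      (∀ D, cls (F D)) → sensitivity F ≠ ⊤ → 0 < (sensitivity F).toReal →
      ∀ ε β : ℝ, 0 < ε → 0 < β → β ≤ β₀ →
        errorScale (sensitivity F).toReal ε β ≤ M →
        IsAccurate F h (k (sensitivity F).toReal ε β) ε
          (C * errorScale (sensitivity F).toReal ε β ^ p) β

/-! ### Running time: a real RAM with oracle access and Laplace sampling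

A machine has finitely many named registers for natural numbers (those named in the program) and
finitely many named arrays of real numbers, addressed through the registers.  Every elementary
operation costs one unit of time. -/

/-- Programs.  A cell is a pair `(a, r)`: it denotes the entry of the array `a` whose index is the
current content of the register `r`. -/
inductive Prog : Type
  | setNat (r c : ℕ)
  | addNat (r s t : ℕ)
  | subNat (r s t : ℕ)
  | setReal (x : ℕ × ℕ) (c : ℤ)
  | castNat (x : ℕ × ℕ) (r : ℕ)
  | addReal (x y z : ℕ × ℕ)
  | subReal (x y z : ℕ × ℕ)
  | mulReal (x y z : ℕ × ℕ)
  | divReal (x y z : ℕ × ℕ)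
  | query (x : ℕ × ℕ) (a : ℕ)
  | draw (x y : ℕ × ℕ)
  | seq (p q : Prog)
  | ifLe (r s : ℕ) (p q : Prog)
  | loop (r : ℕ) (p : Prog)

/-- Configurations: registers, arrays, number of random draws so far, elapsed time. -/
structure Config where
  nat : ℕ → ℕ
  arr : ℕ → ℕ → ℝ
  drawn : ℕ
  time : ℕ

/-- What a program can access besides its memory: an oracle, which is given (the beginning of) an
array, and an infinite sequence of standard Laplace samples. -/
structure Env where
  oracle : (ℕ → ℝ) → ℝ
  tape : ℕ → ℝ

namespace Config

/-- One unit of time passes. -/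
def tick (c : Config) : Config := { c with time := c.time + 1 }

/-- The content of a cell. -/
def get (c : Config) (x : ℕ × ℕ) : ℝ := c.arr x.1 (c.nat x.2)

/-- Write to a register, in one unit of time. -/
def putNat (c : Config) (r v : ℕ) : Config :=
  { c with nat := Function.update c.nat r v, time := c.time + 1 }

/-- Write to a cell, in one unit of time. -/
def put (c : Config) (x : ℕ × ℕ) (v : ℝ) : Config :=
  { c with
    arr := Function.update c.arr x.1 (Function.update (c.arr x.1) (c.nat x.2) v)
    time := c.time + 1 }

end Config

/-- Execution.  `draw x y` stores in the cell `x` a fresh sample of `Lap(v)`, `v` the content of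
the cell `y`, obtained as `v` times a standard Laplace sample.  `loop r p` reads the register `r`
once and then executes `p` that many times, with an overhead of one time unit per iteration. -/
def exec (e : Env) : Prog → Config → Config
  | .setNat r v, c => c.putNat r v
  | .addNat r s t, c => c.putNat r (c.nat s + c.nat t)
  | .subNat r s t, c => c.putNat r (c.nat s - c.nat t)
  | .setReal x v, c => c.put x (v : ℝ)
  | .castNat x r, c => c.put x (c.nat r : ℝ)
  | .addReal x y z, c => c.put x (c.get y + c.get z)
  | .subReal x y z, c => c.put x (c.get y - c.get z)
  | .mulReal x y z, c => c.put x (c.get y * c.get z)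
  | .divReal x y z, c => c.put x (c.get y / c.get z)
  | .query x a, c => c.put x (e.oracle (c.arr a))
  | .draw x y, c => { c.put x (c.get y * e.tape c.drawn) with drawn := c.drawn + 1 }
  | .seq p q, c => exec e q (exec e p c)
  | .ifLe r s p q, c => if c.nat r ≤ c.nat s then exec e p c.tick else exec e q c.tick
  | .loop r p, c => (fun d : Config => exec e p d.tick)^[c.nat r] c.tick

/-- Start of sanitization: `k` in register `0`; `s` and `ε` in array `0`; all else zero. -/
def sanitizeStart (k : ℕ) (s ε : ℝ) : Config where
  nat := Function.update 0 0 k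
  arr := Function.update 0 0 (Function.update (Function.update 0 0 s) 1 ε)
  drawn := 0
  time := 0

/-- Sanitization with oracle access to `f`. -/
def sanitizeRun {ℓ : ℕ} (p : Prog) (k : ℕ) (s ε : ℝ) (f : (Fin ℓ → ℝ) → ℝ) (ω : ℕ → ℝ) : Config :=
  exec { oracle := fun a => f fun i => a i, tape := ω } p (sanitizeStart k s ε)

/-- The family of reals indexed by the lattice that is stored in array `1`, the entry of index `ν`
being at the address `∑ᵢ νᵢ (k+1)^i`. -/
def readOutput {ℓ : ℕ} (k : ℕ) (c : Config) : LatticeIdx ℓ k → ℝ :=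
  fun ν => c.arr 1 (finFunctionFinEquiv ν : ℕ)

/-- Start of an evaluation: `k` in register `0`, the query point `y` in array `0`, the released
values `w` in array `1` (laid out as in the output of sanitization); all else zero. -/
def evaluateStart {ℓ k : ℕ} (w : LatticeIdx ℓ k → ℝ) (y : Fin ℓ → ℝ) : Config where
  nat := Function.update 0 0 k
  arr := Function.update
    (Function.update 0 0 fun j => if hj : j < ℓ then y ⟨j, hj⟩ else 0)
    1 fun j => if hj : j < (k + 1) ^ ℓ then w (finFunctionFinEquiv.symm ⟨j, hj⟩) else 0
  drawn := 0
  time := 0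

/-- Evaluation: there is no access to the database and no randomness. -/
def evaluateRun {ℓ k : ℕ} (p : Prog) (w : LatticeIdx ℓ k → ℝ) (y : Fin ℓ → ℝ) : Config :=
  exec { oracle := fun _ => 0, tape := fun _ => 0 } p (evaluateStart w y)

/-- The programs `san` and `ev` implement the Bernstein mechanism of order `h` in dimension `ℓ`:
from independent standard Laplace samples, `san` produces perturbed values with the law prescribed
by the mechanism, and `ev` computes the value of the iterated Bernstein polynomial. -/
def ImplementsBernstein (ℓ h : ℕ) (san ev : Prog) : Prop :=
  ∀ k : ℕ, 0 < k →
    (∀ (f : (Fin ℓ → ℝ) → ℝ) (s ε : ℝ), 0 ≤ s → 0 < ε →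
      (Measure.infinitePi fun _ : ℕ => laplaceMeasure 1).map
        (fun ω => (readOutput k (sanitizeRun san k s ε f ω) : LatticeIdx ℓ k → ℝ)) =
      noisyValues k (noiseScale ℓ k s ε) f) ∧
    (∀ w : LatticeIdx ℓ k → ℝ, ∀ y ∈ cube ℓ,
      (evaluateRun ev w y).arr 2 0 = bernsteinEval h w y)

/-- With the cover size `k(S(F), ε, β)`: if `1/S(F) ≤ poly(n)`, then the running times of
sanitization and of each evaluation are at most polynomial in `n` and `1/ε`, for every outcome of
the random draws; here `ε` stays bounded and `β` stays away from `1`. -/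
def RunsInPolyTime (ℓ : ℕ) (san ev : Prog) (k : ℝ → ℝ → ℝ → ℕ) : Prop :=
  ∀ (β₀ ε₀ : ℝ) (q : Polynomial ℝ), β₀ < 1 → ∃ P : MvPolynomial (Fin 2) ℝ,
    ∀ (n : ℕ) (X : Type u) (F : (Fin n → X) → (Fin ℓ → ℝ) → ℝ),
      sensitivity F ≠ ⊤ → 0 < (sensitivity F).toReal →
      1 / (sensitivity F).toReal ≤ q.eval (n : ℝ) →
      ∀ ε β : ℝ, 0 < ε → ε ≤ ε₀ → 0 < β → β ≤ β₀ →
        (∀ (D : Fin n → X) (ω : ℕ → ℝ),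
          ((sanitizeRun san (k (sensitivity F).toReal ε β)
            (sensitivity F).toReal ε (F D) ω).time : ℝ) ≤
              MvPolynomial.eval ![(n : ℝ), 1 / ε] P) ∧
        (∀ w : LatticeIdx ℓ (k (sensitivity F).toReal ε β) → ℝ, ∀ y ∈ cube ℓ,
          ((evaluateRun ev w y).time : ℝ) ≤ MvPolynomial.eval ![(n : ℝ), 1 / ε] P)

end

noncomputable section

/-! ### The Laplace distribution -/

/-! Privacy is a comparison of densities: shifting one Laplace variable of scale `lam` by at most
`S` costs a factor `exp (S / lam)`, and the `(k+1)^ℓ` independent coordinates together cost `exp ε`.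

Accuracy separates, by linearity of `bernsteinEval`, into the error on exact values and the
evaluation of pure noise. For the first, `iterEnd_mul_bernsteinEnd` identifies the univariate error
with `(1 - B)^h f`, where `B` is the Bernstein operator. On a function with `2h` bounded derivatives
this is `O(k^(-h))`: `1 - B` maps a chain of derivatives to a chain that is two steps shorter and
smaller by a factor of order `1/k` (`abs_sub_bernsteinDeriv_le`, `HasPowerRate.succ`). On a Hölder
function one factor gives `k^(-γ/2)` and the others are merely bounded; affine functions are
annihilated. `abs_bernsteinEval_sub_le` passes to several variables.

The noise has to be bounded on the whole cube by a multiple of `log (1/β)` that does not depend on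
`k`; a union bound over the lattice would lose a factor `log k`. Summation by parts in each
coordinate, from a base point `a` near `(k+1)x`, writes the Bernstein polynomial of the noise as a
combination of box sums. Each box sum is allowed the size `∏ (|a-b| + √(1 + distEnds a))`. This is
generous enough for the failure probabilities of all boxes to form a series bounded uniformly in `k`
(`exists_measureReal_boxSum_le`), and small enough for the weighted sum of the differences of the
basis to be at most `8` (`exists_sum_abs_bernsteinDiff_le`): these differences are governed by the
variance of the binomial law. Passing to the iterated basis costs `2^h` per coordinate.

With `x` the error scale, the total error is of order `k^(-r) + (k+1)^ℓ x`; the choice `k =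
⌈x^(-p)⌉` with `p r = 1 - p ℓ` balances it (`hasErrorRate_coverSize`). Since `p ≤ 1`, `k` is at most
affine in `1/S`. Explicit programs whose loops have length `k` or `k+1` then run in time polynomial
in `k`. -/

theorem lintegral_exp_mul_laplaceMeasure_one {s : ℝ} (hs : |s| < 1) :
    ∫⁻ x, ENNReal.ofReal (Real.exp (s * x)) ∂laplaceMeasure 1 =
      ENNReal.ofReal (1 / (1 - s ^ 2)) := by
  obtain ⟨h1, h2⟩ := abs_lt.1 hs
  have hmeas : Measurable fun x : ℝ => ENNReal.ofReal (Real.exp (-|x| / 1) / (2 * 1)) := by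
    fun_prop
  rw [laplaceMeasure, if_neg one_ne_zero,
    lintegral_withDensity_eq_lintegral_mul _ hmeas (by fun_prop),
    ← lintegral_add_compl _ (measurableSet_Iic (a := (0 : ℝ))), Set.compl_Iic]
  have hL : ∫⁻ x in Set.Iic (0 : ℝ), ((fun x : ℝ => ENNReal.ofReal
      (Real.exp (-|x| / 1) / (2 * 1))) * fun x => ENNReal.ofReal (Real.exp (s * x))) x =
      ENNReal.ofReal (1 / (1 + s) / 2) := by
    have h0 : (0 : ℝ) < 1 + s := by linarith
    rw [setLIntegral_congr_fun (g := fun x => ENNReal.ofReal (Real.exp ((1 + s) * x) / 2))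
      measurableSet_Iic, ← ofReal_integral_eq_lintegral_ofReal
        ((integrableOn_exp_mul_Iic h0 0).div_const 2), integral_div, integral_exp_mul_Iic h0]
    · simp
    · exact Filter.Eventually.of_forall fun x => by positivity
    · intro x hx
      simp only [Pi.mul_apply]
      rw [← ENNReal.ofReal_mul (by positivity), abs_of_nonpos hx, div_mul_eq_mul_div,
        ← Real.exp_add]
      congr 2 <;> ring_nf
  have hR : ∫⁻ x in Set.Ioi (0 : ℝ), ((fun x : ℝ => ENNReal.ofReal
      (Real.exp (-|x| / 1) / (2 * 1))) * fun x => ENNReal.ofReal (Real.exp (s * x))) x =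
      ENNReal.ofReal (1 / (1 - s) / 2) := by
    have h0 : s - 1 < 0 := by linarith
    rw [setLIntegral_congr_fun (g := fun x => ENNReal.ofReal (Real.exp ((s - 1) * x) / 2))
      measurableSet_Ioi, ← ofReal_integral_eq_lintegral_ofReal
        ((integrableOn_exp_mul_Ioi h0 0).div_const 2), integral_div, integral_exp_mul_Ioi h0]
    · congr 2
      rw [← neg_sub 1 s, mul_zero, Real.exp_zero, neg_div_neg_eq]
    · exact Filter.Eventually.of_forall fun x => by positivity
    · intro x hx
      simp only [Pi.mul_apply]
      rw [← ENNReal.ofReal_mul (by positivity), abs_of_pos hx, div_mul_eq_mul_div,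
        ← Real.exp_add]
      congr 2 <;> ring_nf
  have h3 : (0 : ℝ) < 1 + s := by linarith
  have h4 : (0 : ℝ) < 1 - s := by linarith
  have h5 : (1 : ℝ) - s ^ 2 ≠ 0 := by nlinarith
  rw [hL, hR, ← ENNReal.ofReal_add (by positivity) (by positivity)]
  congr 1
  field_simp
  ring

instance isProbabilityMeasure_laplaceMeasure_one : IsProbabilityMeasure (laplaceMeasure 1) := by
  constructor
  have := lintegral_exp_mul_laplaceMeasure_one (s := 0) (by simp)
  simpa using this

theorem laplaceMeasure_eq_map {lam : ℝ} (h : 0 ≤ lam) :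
    laplaceMeasure lam = (laplaceMeasure 1).map fun x => lam * x := by
  rcases h.eq_or_lt with rfl | h
  -- At scale `0` the image is a Dirac mass weighted by the total mass of the standard law, which is
  -- `1`.
  · simp [laplaceMeasure, Measure.map_const]
    have := measure_univ (μ := laplaceMeasure 1)
    simp [laplaceMeasure] at this
    simp [this]
  · have hm : ∀ lam : ℝ,
        Measurable fun x : ℝ => ENNReal.ofReal (Real.exp (-|x| / lam) / (2 * lam)) := fun lam => by
      fun_prop
    ext A hA
    rw [Measure.map_apply (by fun_prop) hA, laplaceMeasure, laplaceMeasure, if_neg h.ne',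
      if_neg one_ne_zero, withDensity_apply _ hA,
      withDensity_apply _ (measurable_const_mul lam hA),
      ← lintegral_indicator hA, ← lintegral_indicator (measurable_const_mul lam hA)]
    -- The Jacobian `lam` of the dilation cancels the factor `1 / lam` of the density.
    have hv : (volume : Measure ℝ) =
        ENNReal.ofReal lam • Measure.map (fun x => lam * x) volume := by
      have := Real.smul_map_volume_mul_left h.ne'
      rw [abs_of_pos h] at this
      exact this.symm
    conv_lhs => rw [hv]
    rw [lintegral_smul_measure, lintegral_map ((hm lam).indicator hA) (by fun_prop),
      smul_eq_mul,
      ← lintegral_const_mul' _ _ ENNReal.ofReal_ne_top]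
    refine lintegral_congr fun x => ?_
    by_cases hx : lam * x ∈ A
    · rw [Set.indicator_of_mem hx, Set.indicator_of_mem (show x ∈ _ from hx),
        ← ENNReal.ofReal_mul h.le, abs_mul, abs_of_pos h]
      congr 1
      rw [show -(lam * |x|) / lam = -|x| / 1 by field_simp]
      field_simp
    · rw [Set.indicator_of_notMem hx, Set.indicator_of_notMem (show x ∉ _ from hx), mul_zero]

theorem isProbabilityMeasure_laplaceMeasure {lam : ℝ} (h : 0 ≤ lam) :
    IsProbabilityMeasure (laplaceMeasure lam) := by
  rw [laplaceMeasure_eq_map h]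
  exact Measure.isProbabilityMeasure_map (by fun_prop)

/-- The mechanism adds scaled standard Laplace noise. -/
theorem noisyValues_eq_map {ℓ : ℕ} (k : ℕ) {lam : ℝ} (h : 0 ≤ lam) (f : (Fin ℓ → ℝ) → ℝ) :
    noisyValues k lam f = (Measure.pi fun _ : LatticeIdx ℓ k => laplaceMeasure 1).map
      fun z ν => f (latticePoint ν) + lam * z ν := by
  have hmap : ∀ c : ℝ, (laplaceMeasure lam).map (fun z => c + z) =
      (laplaceMeasure 1).map fun z => c + lam * z := fun c => by
    rw [laplaceMeasure_eq_map h, Measure.map_map (by fun_prop) (by fun_prop)]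
    rfl
  have : ∀ c : ℝ, IsProbabilityMeasure ((laplaceMeasure 1).map fun z => c + lam * z) := fun c =>
    Measure.isProbabilityMeasure_map (by fun_prop)
  rw [noisyValues, Measure.pi_map_pi (f := fun ν z => f (latticePoint ν) + lam * z)
    fun ν => by fun_prop]
  simp_rw [hmap]

/-- Distinct positions of an infinite sequence of independent samples carry an independent family.
This links the random tape of a machine to the law of the mechanism. -/
theorem noisyValues_eq_map_infinitePi {ℓ : ℕ} (k : ℕ) {lam : ℝ} (h : 0 ≤ lam)
    (f : (Fin ℓ → ℝ) → ℝ) (e : LatticeIdx ℓ k → ℕ) (he : Function.Injective e) :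
    (Measure.infinitePi fun _ : ℕ => laplaceMeasure 1).map
      (fun ω ν => f (latticePoint ν) + lam * ω (e ν)) = noisyValues k lam f := by
  rw [noisyValues_eq_map k h, ← Measure.infinitePi_eq_pi,
    ← Measure.map_infinitePi_infinitePi_of_inj (P := fun _ : ℕ => laplaceMeasure 1) he,
    Measure.map_map (by fun_prop) (by fun_prop)]
  rfl

/-! ### Privacy -/

/-- The two densities have ratio `exp ((|x - b| - |x - a|) / lam)`, which the triangle inequality
bounds. -/
theorem laplaceMeasure_map_add_le {lam : ℝ} (h : 0 < lam) (a b : ℝ) :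
    (laplaceMeasure lam).map (fun z => a + z) ≤
      ENNReal.ofReal (Real.exp (|a - b| / lam)) • (laplaceMeasure lam).map fun z => b + z := by
  have hm : Measurable fun x : ℝ => ENNReal.ofReal (Real.exp (-|x| / lam) / (2 * lam)) := by
    fun_prop
  have key : ∀ (c : ℝ) {A : Set ℝ}, MeasurableSet A →
      (laplaceMeasure lam).map (fun z => c + z) A =
        ∫⁻ x in A, ENNReal.ofReal (Real.exp (-|x - c| / lam) / (2 * lam)) := by
    intro c A hA
    have hA' : MeasurableSet ((fun z => c + z) ⁻¹' A) := measurable_const_add c hA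
    rw [Measure.map_apply (by fun_prop) hA, laplaceMeasure, if_neg h.ne',
      withDensity_apply _ hA', ← lintegral_indicator hA, ← lintegral_indicator hA',
      ← lintegral_add_left_eq_self (μ := volume) (A.indicator _) c]
    refine lintegral_congr fun x => ?_
    by_cases hx : c + x ∈ A
    · rw [Set.indicator_of_mem hx, Set.indicator_of_mem (show x ∈ _ from hx)]
      simp
    · rw [Set.indicator_of_notMem hx, Set.indicator_of_notMem (show x ∉ _ from hx)]
  refine Measure.le_iff.2 fun A hA => ?_
  rw [Measure.smul_apply, smul_eq_mul, key a hA, key b hA,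
    ← lintegral_const_mul _ (by fun_prop)]
  refine lintegral_mono fun x => ?_
  rw [← ENNReal.ofReal_mul (by positivity)]
  refine ENNReal.ofReal_le_ofReal ?_
  rw [mul_div_assoc', ← Real.exp_add, ← add_div]
  have := abs_sub_abs_le_abs_sub (x - b) (x - a)
  rw [show x - b - (x - a) = a - b by ring] at this
  gcongr
  linarith

/-- An inequality of measures on boxes does not extend to measurable sets by a π-λ argument. It does
at the level of outer measures, because `OuterMeasure.pi` is the largest one bounded by the products
on boxes. -/
theorem Measure.pi_le_smul_pi {ι : Type*} [Fintype ι] {α : ι → Type*}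
    [∀ i, MeasurableSpace (α i)] (μ ν : ∀ i, Measure (α i)) [∀ i, IsFiniteMeasure (ν i)]
    (c : ι → NNReal) (h : ∀ i, μ i ≤ c i • ν i) :
    Measure.pi μ ≤ (∏ i, c i) • Measure.pi ν := by
  have hsmul : Measure.pi (fun i => c i • ν i) = (∏ i, c i) • Measure.pi ν := by
    refine Measure.pi_eq fun s hs => ?_
    rw [Measure.smul_apply, Measure.pi_pi, ENNReal.smul_def, smul_eq_mul, ENNReal.ofNNReal_finsetProd,
      ← Finset.prod_mul_distrib]
    rfl
  rw [← hsmul]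
  refine Measure.le_iff.2 fun A hA => ?_
  rw [Measure.pi_def, Measure.pi_def, toMeasure_apply _ _ hA, toMeasure_apply _ _ hA]
  refine (OuterMeasure.le_pi.2 fun s _ => (OuterMeasure.pi_pi_le _ _).trans ?_ :
    OuterMeasure.pi (fun i => (μ i).toOuterMeasure) ≤
      OuterMeasure.pi fun i => (c i • ν i).toOuterMeasure) A
  exact Finset.prod_le_prod' fun i _ => h i (s i)

theorem latticePoint_mem_cube {ℓ k : ℕ} (ν : LatticeIdx ℓ k) : latticePoint ν ∈ cube ℓ := by
  refine ⟨fun i => by simp only [latticePoint, Pi.zero_apply]; positivity, fun i => ?_⟩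
  exact div_le_one_of_le₀ (Nat.cast_le.2 (Nat.lt_succ_iff.1 (ν i).2)) (by positivity)

theorem abs_sub_le_sensitivity {n ℓ : ℕ} {X : Type u} {F : (Fin n → X) → (Fin ℓ → ℝ) → ℝ}
    (hF : sensitivity F ≠ ⊤) {D D' : Fin n → X} (h : Neighbours D D') {y : Fin ℓ → ℝ}
    (hy : y ∈ cube ℓ) : |F D y - F D' y| ≤ (sensitivity F).toReal := by
  refine (ENNReal.ofReal_le_iff_le_toReal hF).1 ?_
  exact le_iSup₂_of_le y hy (le_iSup₂_of_le D D' (le_iSup_of_le h le_rfl))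

theorem noiseScale_nonneg (ℓ k : ℕ) {s ε : ℝ} (hs : 0 ≤ s) (hε : 0 < ε) :
    0 ≤ noiseScale ℓ k s ε := by
  unfold noiseScale
  positivity

theorem differentiallyPrivate_bernsteinMechanism {ℓ n : ℕ} (k : ℕ) {X : Type u}
    (F : (Fin n → X) → (Fin ℓ → ℝ) → ℝ) {ε : ℝ} (hε : 0 < ε)
    (hF : sensitivity F ≠ ⊤) : DifferentiallyPrivate ε (bernsteinMechanism F k ε) := by
  intro D D' hD A _
  have hdiff : ∀ ν : LatticeIdx ℓ k,
      |F D (latticePoint ν) - F D' (latticePoint ν)| ≤ (sensitivity F).toReal := fun ν =>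
    abs_sub_le_sensitivity hF hD (latticePoint_mem_cube ν)
  rcases (ENNReal.toReal_nonneg (a := sensitivity F)).eq_or_lt with h0 | h0
  -- For zero sensitivity there is no noise and no density, but neighbouring databases give the same
  -- values on the lattice.
  · have heq : bernsteinMechanism F k ε D = bernsteinMechanism F k ε D' := by
      have : ∀ ν : LatticeIdx ℓ k, F D (latticePoint ν) = F D' (latticePoint ν) := fun ν => by
        have := hdiff ν
        rw [← h0, abs_nonpos_iff, sub_eq_zero] at this
        exact this
      simp only [bernsteinMechanism, noisyValues, this]
    rw [heq]
    exact le_mul_of_one_le_left' (by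
      rw [← ENNReal.ofReal_one]; exact ENNReal.ofReal_le_ofReal (Real.one_le_exp hε.le))
  · have hs : 0 < noiseScale ℓ k (sensitivity F).toReal ε := by unfold noiseScale; positivity
    have := isProbabilityMeasure_laplaceMeasure hs.le
    set lam := noiseScale ℓ k (sensitivity F).toReal ε with hlam
    have hfin : ∀ c : ℝ, IsProbabilityMeasure ((laplaceMeasure lam).map fun z => c + z) :=
      fun c => Measure.isProbabilityMeasure_map (by fun_prop)
    have h1 := Measure.pi_le_smul_pi
      (fun ν : LatticeIdx ℓ k => (laplaceMeasure lam).map fun z => F D (latticePoint ν) + z)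
      (fun ν : LatticeIdx ℓ k => (laplaceMeasure lam).map fun z => F D' (latticePoint ν) + z)
      (fun _ => (Real.exp ((sensitivity F).toReal / lam)).toNNReal) (fun ν => by
        refine (laplaceMeasure_map_add_le hs _ (F D' (latticePoint ν))).trans ?_
        refine Measure.le_iff.2 fun B _ => ?_
        refine mul_le_mul_left (ENNReal.ofReal_le_ofReal ?_) _
        gcongr
        exact hdiff ν) A
    refine h1.trans (le_of_eq ?_)
    rw [Measure.smul_apply, ENNReal.smul_def, smul_eq_mul]
    refine congrArg₂ _ ?_ rfl
    -- There are `(k+1)^ℓ` equal factors `exp (S / lam)`; the noise scale is the one for which the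
    -- exponents add up to `ε`.
    rw [Finset.prod_const, Finset.card_univ, Fintype.card_pi, Finset.prod_const, Finset.card_univ,
      Fintype.card_fin, Fintype.card_fin, ← Real.toNNReal_pow (by positivity), ← Real.exp_nat_mul]
    rw [ENNReal.ofReal]
    congr 3
    rw [hlam, noiseScale]
    push_cast
    field_simp

/-! ### Tails of linear combinations of Laplace variables -/

theorem integrable_exp_mul_laplaceMeasure_one {s : ℝ} (hs : |s| < 1) :
    Integrable (fun x => Real.exp (s * x)) (laplaceMeasure 1) := by
  refine ⟨by fun_prop, ?_⟩
  rw [hasFiniteIntegral_iff_ofReal (Filter.Eventually.of_forall fun x => (Real.exp_pos _).le),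
    lintegral_exp_mul_laplaceMeasure_one hs]
  exact ENNReal.ofReal_lt_top

/-- Away from the poles `±1`, `1 / (1 - s^2) ≤ 1 + 2 s^2 ≤ exp (2 s^2)`. -/
theorem integral_exp_mul_laplaceMeasure_one_le {s : ℝ} (hs : |s| ≤ 1 / 2) :
    ∫ x, Real.exp (s * x) ∂laplaceMeasure 1 ≤ Real.exp (2 * s ^ 2) := by
  have h2 : s ^ 2 ≤ 1 / 4 := by
    rw [← sq_abs]; nlinarith [abs_nonneg s]
  rw [integral_eq_lintegral_of_nonneg_ae (Filter.Eventually.of_forall fun x => (Real.exp_pos _).le)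
    (by fun_prop), lintegral_exp_mul_laplaceMeasure_one (by linarith),
    ENNReal.toReal_ofReal (div_nonneg zero_le_one (by linarith))]
  refine le_trans ?_ (Real.add_one_le_exp _)
  rw [div_le_iff₀ (by linarith)]
  nlinarith [sq_nonneg s]

/-- Chernoff's bound at the parameter `1 / (2 √V)`, `V = ∑ c i ^ 2`. As `|c i| ≤ 1 ≤ V`, every `s *
c i` stays in the range of the quadratic estimate, the moment generating function is at most `exp (2
s^2 V) = exp (1/2)`, and the exponent is `-v/2`. -/
theorem measureReal_laplace_sum_ge_le {ι : Type*} [Fintype ι] (c : ι → ℝ) (hc : ∀ i, |c i| ≤ 1)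
    (hV : 1 ≤ ∑ i, c i ^ 2) (v : ℝ) :
    (Measure.pi fun _ : ι => laplaceMeasure 1).real
      {z | v * √(∑ i, c i ^ 2) ≤ ∑ i, z i * c i} ≤ Real.exp (1 / 2) * Real.exp (-v / 2) := by
  set V := ∑ i, c i ^ 2 with hVdef
  have hsV : 1 ≤ √V := Real.one_le_sqrt.2 hV
  have hV0 : 0 < V := by linarith
  set s := 1 / (2 * √V) with hs
  have hs0 : 0 ≤ s := by positivity
  have hs1 : s ≤ 1 / 2 := by
    rw [hs]
    exact one_div_le_one_div_of_le (by norm_num) (by linarith)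
  have hsc : ∀ i, |s * c i| ≤ 1 / 2 := fun i => by
    rw [abs_mul, abs_of_nonneg hs0]
    nlinarith [hc i, abs_nonneg (c i)]
  have hexp : ∀ z : ι → ℝ, Real.exp (s * ∑ i, z i * c i) = ∏ i, Real.exp (s * c i * z i) :=
    fun z => by
      rw [← Real.exp_sum, Finset.mul_sum]
      exact congrArg _ (Finset.sum_congr rfl fun i _ => by ring)
  have hint : Integrable (fun z : ι → ℝ => Real.exp (s * ∑ i, z i * c i))
      (Measure.pi fun _ : ι => laplaceMeasure 1) := by
    simp_rw [hexp]
    exact Integrable.fintype_prod (f := fun i x => Real.exp (s * c i * x)) fun i =>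
      integrable_exp_mul_laplaceMeasure_one ((hsc i).trans_lt (by norm_num))
  refine (ProbabilityTheory.measure_ge_le_exp_mul_mgf _ hs0 hint).trans ?_
  rw [ProbabilityTheory.mgf]
  simp_rw [hexp]
  rw [integral_fintype_prod_eq_prod (fun i x => Real.exp (s * c i * x)), mul_comm]
  refine mul_le_mul ?_ (le_of_eq ?_) (by positivity) (by positivity)
  · refine (Finset.prod_le_prod (fun i _ => integral_nonneg fun x => (Real.exp_pos _).le)
      fun i _ => integral_exp_mul_laplaceMeasure_one_le (hsc i)).trans (le_of_eq ?_)
    rw [← Real.exp_sum]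
    congr 1
    simp_rw [mul_pow, ← mul_assoc]
    rw [← Finset.mul_sum, ← hVdef, hs, div_pow, mul_pow, Real.sq_sqrt hV0.le]
    field_simp
  · congr 1
    rw [hs]
    field_simp

theorem measureReal_abs_laplace_sum_ge_le {ι : Type*} [Fintype ι] (c : ι → ℝ)
    (hc : ∀ i, |c i| ≤ 1) (hV : 1 ≤ ∑ i, c i ^ 2) (v : ℝ) :
    (Measure.pi fun _ : ι => laplaceMeasure 1).real
      {z | v * √(∑ i, c i ^ 2) ≤ |∑ i, z i * c i|} ≤
        2 * Real.exp (1 / 2) * Real.exp (-v / 2) := by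
  have h1 := measureReal_laplace_sum_ge_le c hc hV v
  have h2 := measureReal_laplace_sum_ge_le (fun i => -c i) (by simpa using hc) (by simpa using hV) v
  have : {z : ι → ℝ | v * √(∑ i, c i ^ 2) ≤ |∑ i, z i * c i|} ⊆
      {z | v * √(∑ i, c i ^ 2) ≤ ∑ i, z i * c i} ∪
        {z | v * √(∑ i, (-c i) ^ 2) ≤ ∑ i, z i * -c i} := by
    intro z hz
    simpa [le_abs] using hz
  refine (measureReal_mono this).trans ((measureReal_union_le _ _).trans ?_)
  linarith

/-! ### Sums of the noise over boxes -/

/-- The signed indicator function of the interval between `a` and `b`. -/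
def signedIndicator (a b ν : ℕ) : ℝ := (if ν < b then 1 else 0) - if ν < a then 1 else 0

/-- The signed sum of the noise `z` over the box spanned by two corners. -/
def boxSum {ℓ k : ℕ} (z : LatticeIdx ℓ k → ℝ) (p : Fin ℓ → Fin (k + 2) × Fin (k + 2)) : ℝ :=
  ∑ ν, z ν * ∏ i, signedIndicator (p i).1 (p i).2 (ν i)

/-- The distance of `a` from the end points of `[0, K]`. -/
def distEnds (K a : ℕ) : ℝ := min (a : ℝ) ((K : ℝ) - a)

/-- The size allowed, in one coordinate, for a noise sum between `a` and `b`. -/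
def boxWeight (K a b : ℕ) : ℝ := if a = b then 0 else |(a : ℝ) - b| + √(1 + distEnds K a)

theorem distEnds_nonneg {K a : ℕ} (h : a ≤ K) : 0 ≤ distEnds K a :=
  le_min (Nat.cast_nonneg _) (sub_nonneg.2 (Nat.cast_le.2 h))

theorem boxWeight_nonneg (K a b : ℕ) : 0 ≤ boxWeight K a b := by
  unfold boxWeight
  split_ifs <;> positivity

theorem abs_signedIndicator_le (a b ν : ℕ) : |signedIndicator a b ν| ≤ 1 := by
  unfold signedIndicator
  split_ifs <;> norm_num

theorem sum_signedIndicator_sq {k a b : ℕ} (ha : a ≤ k + 1) (hb : b ≤ k + 1) :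
    ∑ ν : Fin (k + 1), signedIndicator a b ν ^ 2 = |(a : ℝ) - b| := by
  rw [Fin.sum_univ_eq_sum_range (fun ν => signedIndicator a b ν ^ 2)]
  wlog h : a ≤ b generalizing a b
  · rw [abs_sub_comm, ← this hb ha (by omega)]
    refine Finset.sum_congr rfl fun ν _ => ?_
    unfold signedIndicator
    ring
  have : ∀ ν ∈ Finset.range (k + 1), signedIndicator a b ν ^ 2 =
      (if ν < b then 1 else 0) - if ν < a then 1 else 0 := fun ν _ => by
    unfold signedIndicator
    split_ifs <;> first | omega | norm_num
  rw [Finset.sum_congr rfl this, Finset.sum_sub_distrib, Finset.sum_ite, Finset.sum_ite,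
    abs_sub_comm, abs_of_nonneg (by simpa using h)]
  have hf : ∀ c ≤ k + 1, (Finset.range (k + 1)).filter (· < c) = Finset.range c := fun c hc => by
    ext; simp; omega
  simp [hf a ha, hf b hb]

/-- With `d = |a - b|` and `w = √(1 + distEnds K a)`, `((d + w) / √d)^2 ≥ d + w`, and `(d + w)^6 ≥
d^2 w^4`. The power `12` is what yields inverse squares, hence summability, in both `a - b` and
`distEnds K a`. -/
theorem boxWeight_pow_ge {K a b : ℕ} (ha : a ≤ K) (hab : a ≠ b) :
    ((a : ℝ) - b) ^ 2 * (1 + distEnds K a) ^ 2 ≤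
      (boxWeight K a b / √|(a : ℝ) - b|) ^ 12 := by
  have hd : 1 ≤ |(a : ℝ) - b| := by
    have : (1 : ℤ) ≤ |(a : ℤ) - b| := Int.one_le_abs (sub_ne_zero.2 (by exact_mod_cast hab))
    exact_mod_cast this
  have ht := distEnds_nonneg ha
  have hw0 := Real.sqrt_nonneg (1 + distEnds K a)
  have hw : √(1 + distEnds K a) ^ 2 = 1 + distEnds K a := Real.sq_sqrt (by linarith)
  rw [boxWeight, if_neg hab, ← sq_abs ((a : ℝ) - b)]
  set d := |(a : ℝ) - b|
  set w := √(1 + distEnds K a)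
  have h1 : d + w ≤ ((d + w) / √d) ^ 2 := by
    rw [div_pow, Real.sq_sqrt (by linarith), le_div_iff₀ (by linarith)]
    nlinarith
  calc d ^ 2 * (1 + distEnds K a) ^ 2 = d ^ 2 * w ^ 4 := by rw [← hw]; ring
    _ ≤ (d + w) ^ 2 * (d + w) ^ 4 := by gcongr <;> linarith
    _ = (d + w) ^ 6 := by ring
    _ ≤ (((d + w) / √d) ^ 2) ^ 6 := by gcongr
    _ = _ := by ring

theorem sum_fin_inj_le_tsum {n : ℕ} (φ : Fin n → ℤ) (hφ : Function.Injective φ) :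
    ∑ b, 1 / (φ b : ℝ) ^ 2 ≤ ∑' m : ℤ, 1 / (m : ℝ) ^ 2 := by
  have hs : Summable fun m : ℤ => 1 / (m : ℝ) ^ 2 := Real.summable_one_div_int_pow.2 one_lt_two
  have := hs.sum_le_tsum (Finset.univ.map ⟨φ, hφ⟩) fun m _ => by positivity
  simpa using this

/-- Both the sum over `b` for fixed `a` and the sum over `a` are compared with `∑ 1/m^2` over the
integers, the latter once for each end of the interval. The diagonal `a = b` contributes nothing
because `1 / 0 = 0`. -/
theorem sum_inv_sq_le (k : ℕ) :
    ∑ p : Fin (k + 2) × Fin (k + 2),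
      1 / ((((p.1 : ℕ) : ℝ) - (p.2 : ℕ)) ^ 2 * (1 + distEnds (k + 1) p.1) ^ 2) ≤
        2 * (∑' m : ℤ, 1 / (m : ℝ) ^ 2) ^ 2 := by
  set Q := ∑' m : ℤ, 1 / (m : ℝ) ^ 2
  have hinj : ∀ (c : ℤ), Function.Injective fun b : Fin (k + 2) => c - ((b : ℕ) : ℤ) :=
    fun c b b' h => by simp only at h; ext; omega
  have hinj' : Function.Injective fun b : Fin (k + 2) => 1 + ((b : ℕ) : ℤ) :=
    fun b b' h => by simp only at h; ext; omega
  have h1 : ∀ a : Fin (k + 2), ∑ b : Fin (k + 2), 1 / (((a : ℕ) : ℝ) - (b : ℕ)) ^ 2 ≤ Q :=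
    fun a => by
      have := sum_fin_inj_le_tsum _ (hinj (a : ℕ))
      push_cast at this
      exact this
  have h2 : ∑ a : Fin (k + 2), 1 / (1 + distEnds (k + 1) a) ^ 2 ≤ 2 * Q := by
    have h3 := sum_fin_inj_le_tsum _ hinj'
    have h4 := sum_fin_inj_le_tsum _ (hinj (k + 2))
    refine le_trans ?_ ((add_le_add h3 h4).trans (two_mul Q).symm.le)
    refine (Finset.sum_le_sum fun a _ => ?_).trans Finset.sum_add_distrib.le
    have ha : ((a : ℕ) : ℝ) ≤ k + 1 := by exact_mod_cast Nat.lt_succ_iff.1 a.2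
    unfold distEnds
    push_cast
    rcases min_choice ((a : ℕ) : ℝ) ((k : ℝ) + 1 - (a : ℕ)) with h | h <;> rw [h]
    · exact le_add_of_nonneg_right (by positivity)
    · refine le_add_of_nonneg_of_le (by positivity) (le_of_eq ?_)
      ring
  have hQ : 0 ≤ Q := tsum_nonneg fun m => by positivity
  rw [Fintype.sum_prod_type]
  calc _ = ∑ a : Fin (k + 2), (1 / (1 + distEnds (k + 1) a) ^ 2) *
        ∑ b : Fin (k + 2), 1 / (((a : ℕ) : ℝ) - (b : ℕ)) ^ 2 := by
        refine Finset.sum_congr rfl fun a _ => ?_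
        rw [Finset.mul_sum]
        refine Finset.sum_congr rfl fun b _ => ?_
        rw [one_div_mul_one_div_rev]
    _ ≤ ∑ a : Fin (k + 2), (1 / (1 + distEnds (k + 1) a) ^ 2) * Q := by
        gcongr with a
        exact h1 a
    _ ≤ (2 * Q) * Q := by
        rw [← Finset.sum_mul]
        gcongr
    _ = _ := by ring

theorem exp_neg_div_four_le {R : ℝ} (hR : 0 < R) :
    Real.exp (-(R / 4)) ≤ (Nat.factorial 12 : ℝ) * 4 ^ 12 * (1 / R ^ 12) := by
  have := Real.pow_div_factorial_le_exp (R / 4) (by positivity) 12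
  rw [Real.exp_neg, inv_le_comm₀ (Real.exp_pos _) (by positivity)]
  refine le_trans (le_of_eq ?_) this
  field_simp

/-- The squared coefficients of a box sum add up to `∏ d i`, the number of its points, so the
threshold is `u R` in units of `√(∏ d i)`, with `R` the product of the ratios `boxWeight / √(d i)`.
The tail `exp (-u R / 2)` is shared between decay in `u` and decay in `R`; the latter pays for the
union over all boxes. -/
theorem measureReal_boxSum_gt_le {ℓ k : ℕ} (p : Fin ℓ → Fin (k + 2) × Fin (k + 2)) {u : ℝ}
    (hu : 1 ≤ u) :
    (Measure.pi fun _ : LatticeIdx ℓ k => laplaceMeasure 1).real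
      {z | u * ∏ i, boxWeight (k + 1) (p i).1 (p i).2 < |boxSum z p|} ≤
    2 * Real.exp (1 / 2) * Nat.factorial 12 * 4 ^ 12 * Real.exp (-u / 4) *
      ∏ i, 1 / (((((p i).1 : ℕ) : ℝ) - ((p i).2 : ℕ)) ^ 2 *
        (1 + distEnds (k + 1) (p i).1) ^ 2) := by
  by_cases h : ∃ i, (p i).1 = (p i).2
  · obtain ⟨i, hi⟩ := h
    have h1 : ∏ i, boxWeight (k + 1) (p i).1 (p i).2 = 0 :=
      Finset.prod_eq_zero (Finset.mem_univ i) (by simp [boxWeight, hi])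
    have h2 : ∀ z : LatticeIdx ℓ k → ℝ, boxSum z p = 0 := fun z =>
      Finset.sum_eq_zero fun ν _ => by
        rw [Finset.prod_eq_zero (Finset.mem_univ i) (by simp [signedIndicator, hi]), mul_zero]
    -- A degenerate box has weight and sum zero; the inequality defining the event is strict, so the
    -- event is empty.
    simp only [h1, h2, mul_zero, abs_zero, lt_irrefl, Set.ofPred_false, measureReal_empty]
    have : ∀ i, (0 : ℝ) ≤ 1 / (((((p i).1 : ℕ) : ℝ) - ((p i).2 : ℕ)) ^ 2 *
        (1 + distEnds (k + 1) (p i).1) ^ 2) := fun i => by positivity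
    have := Finset.prod_nonneg fun i (_ : i ∈ Finset.univ) => this i
    positivity
  push Not at h
  have hle : ∀ q : Fin (k + 2), (q : ℕ) ≤ k + 1 := fun q => Nat.lt_succ_iff.1 q.2
  have hne : ∀ i, ((p i).1 : ℕ) ≠ (p i).2 := fun i h' => h i (Fin.ext h')
  set d : Fin ℓ → ℝ := fun i => |(((p i).1 : ℕ) : ℝ) - ((p i).2 : ℕ)| with hd
  have hd1 : ∀ i, 1 ≤ d i := fun i => by
    have : (1 : ℤ) ≤ |(((p i).1 : ℕ) : ℤ) - ((p i).2 : ℕ)| :=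
      Int.one_le_abs (sub_ne_zero.2 (by exact_mod_cast hne i))
    show (1 : ℝ) ≤ |(((p i).1 : ℕ) : ℝ) - ((p i).2 : ℕ)|
    exact_mod_cast this
  have hV : ∑ ν : LatticeIdx ℓ k, (∏ i, signedIndicator (p i).1 (p i).2 (ν i)) ^ 2 =
      ∏ i, d i := by
    simp_rw [← Finset.prod_pow]
    rw [← Fintype.prod_sum fun i (m : Fin (k + 1)) => signedIndicator (p i).1 (p i).2 m ^ 2]
    exact Finset.prod_congr rfl fun i _ => sum_signedIndicator_sq (hle _) (hle _)
  have hD1 : 1 ≤ ∏ i, d i := by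
    have := Finset.prod_le_prod (s := Finset.univ) (f := fun _ : Fin ℓ => (1 : ℝ)) (g := d)
      (fun _ _ => zero_le_one) fun i _ => hd1 i
    simpa using this
  have hsq : √(∏ i, d i) = ∏ i, √(d i) :=
    Real.sqrt_prod _ fun i _ => zero_le_one.trans (hd1 i)
  set R := ∏ i, (boxWeight (k + 1) (p i).1 (p i).2 / √(d i)) with hR
  have hρ : ∀ i, 1 ≤ boxWeight (k + 1) (p i).1 (p i).2 / √(d i) := fun i => by
    have h0 : 0 < √(d i) := Real.sqrt_pos.2 (by linarith [hd1 i])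
    rw [one_le_div h0, boxWeight, if_neg (hne i)]
    have : √(d i) ≤ d i := by
      rw [Real.sqrt_le_left (by linarith [hd1 i])]
      nlinarith [hd1 i]
    have := Real.sqrt_nonneg (1 + distEnds (k + 1) (p i).1)
    linarith
  have hR1 : 1 ≤ R := by
    have := Finset.prod_le_prod (s := Finset.univ) (f := fun _ : Fin ℓ => (1 : ℝ))
      (fun _ _ => zero_le_one) fun i _ => hρ i
    rwa [Finset.prod_const_one] at this
  have hW : u * ∏ i, boxWeight (k + 1) (p i).1 (p i).2 = (u * R) * √(∏ i, d i) := by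
    rw [hsq, mul_assoc, hR, ← Finset.prod_mul_distrib]
    congr 1
    refine Finset.prod_congr rfl fun i _ => ?_
    rw [div_mul_cancel₀ _ (Real.sqrt_pos.2 (by linarith [hd1 i])).ne']
  have htail := measureReal_abs_laplace_sum_ge_le
    (fun ν : LatticeIdx ℓ k => ∏ i, signedIndicator (p i).1 (p i).2 (ν i))
    (fun ν => by
      rw [Finset.abs_prod]
      exact Finset.prod_le_one (fun i _ => abs_nonneg _) fun i _ => abs_signedIndicator_le _ _ _)
    (by rw [hV]; exact hD1) (u * R)
  rw [hV, ← hW] at htail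
  refine (measureReal_mono (h₂ := measure_ne_top _ _) fun z hz => ?_).trans (htail.trans ?_)
  · rw [Set.mem_ofPred_eq] at hz ⊢
    exact hz.le
  -- Since `u, R ≥ 1`, `u R` dominates both `u` and `R`, hence their mean.
  have hexp : Real.exp (-(u * R) / 2) ≤ Real.exp (-u / 4) * Real.exp (-(R / 4)) := by
    rw [← Real.exp_add, Real.exp_le_exp]
    nlinarith
  have hR12 : ∏ i, (((((p i).1 : ℕ) : ℝ) - ((p i).2 : ℕ)) ^ 2 *
        (1 + distEnds (k + 1) (p i).1) ^ 2) ≤ R ^ 12 := by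
    rw [hR, ← Finset.prod_pow]
    exact Finset.prod_le_prod (fun i _ => by positivity) fun i _ =>
      boxWeight_pow_ge (hle _) (hne i)
  have hpos : 0 < ∏ i, (((((p i).1 : ℕ) : ℝ) - ((p i).2 : ℕ)) ^ 2 *
        (1 + distEnds (k + 1) (p i).1) ^ 2) := Finset.prod_pos fun i _ => by
    have h1 := distEnds_nonneg (hle (p i).1)
    have h2 : (((p i).1 : ℕ) : ℝ) - ((p i).2 : ℕ) ≠ 0 :=
      sub_ne_zero.2 (by exact_mod_cast hne i)
    positivity
  have hprod : ∏ i, 1 / (((((p i).1 : ℕ) : ℝ) - ((p i).2 : ℕ)) ^ 2 *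
        (1 + distEnds (k + 1) (p i).1) ^ 2) = 1 / ∏ i, (((((p i).1 : ℕ) : ℝ) - ((p i).2 : ℕ)) ^ 2 *
        (1 + distEnds (k + 1) (p i).1) ^ 2) := by
    rw [Finset.prod_div_distrib, Finset.prod_const_one]
  rw [hprod]
  calc 2 * Real.exp (1 / 2) * Real.exp (-(u * R) / 2)
      ≤ 2 * Real.exp (1 / 2) * (Real.exp (-u / 4) *
        ((Nat.factorial 12 : ℝ) * 4 ^ 12 * (1 / R ^ 12))) := by
        gcongr
        refine hexp.trans ?_
        gcongr
        exact exp_neg_div_four_le (by linarith)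
    _ ≤ 2 * Real.exp (1 / 2) * (Real.exp (-u / 4) *
        ((Nat.factorial 12 : ℝ) * 4 ^ 12 * (1 / ∏ i, (((((p i).1 : ℕ) : ℝ) - ((p i).2 : ℕ)) ^ 2 *
        (1 + distEnds (k + 1) (p i).1) ^ 2)))) := by gcongr
    _ = _ := by ring

/-- With high probability, all box sums of the noise are controlled at once, with a bound
independent of the size of the lattice. -/
theorem exists_measureReal_boxSum_le (ℓ : ℕ) : ∃ C : ℝ, 0 < C ∧ ∀ (k : ℕ) (u : ℝ), 1 ≤ u →
    (Measure.pi fun _ : LatticeIdx ℓ k => laplaceMeasure 1).real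
      {z | ∃ p : Fin ℓ → Fin (k + 2) × Fin (k + 2),
        u * ∏ i, boxWeight (k + 1) (p i).1 (p i).2 < |boxSum z p|} ≤ C * Real.exp (-u / 4) := by
  set Q := ∑' m : ℤ, 1 / (m : ℝ) ^ 2 with hQ
  have hQ0 : 0 ≤ Q := tsum_nonneg fun m => by positivity
  refine ⟨2 * Real.exp (1 / 2) * Nat.factorial 12 * 4 ^ 12 * (2 * Q ^ 2 + 1) ^ ℓ, by positivity,
    fun k u hu => ?_⟩
  rw [Set.ofPred_exists]
  refine (measureReal_iUnion_fintype_le _).trans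
    ((Finset.sum_le_sum fun p _ => measureReal_boxSum_gt_le p hu).trans ?_)
  rw [← Finset.mul_sum, ← Fintype.prod_sum fun (i : Fin ℓ) (q : Fin (k + 2) × Fin (k + 2)) =>
    1 / ((((q.1 : ℕ) : ℝ) - (q.2 : ℕ)) ^ 2 * (1 + distEnds (k + 1) q.1) ^ 2), Finset.prod_const,
    Finset.card_univ, Fintype.card_fin]
  have h1 := sum_inv_sq_le k
  have h0 : 0 ≤ ∑ p : Fin (k + 2) × Fin (k + 2),
      1 / ((((p.1 : ℕ) : ℝ) - (p.2 : ℕ)) ^ 2 * (1 + distEnds (k + 1) p.1) ^ 2) :=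
    Finset.sum_nonneg fun p _ => by positivity
  calc _ ≤ 2 * Real.exp (1 / 2) * Nat.factorial 12 * 4 ^ 12 * Real.exp (-u / 4) *
        (2 * Q ^ 2 + 1) ^ ℓ := by
        gcongr
        linarith
    _ = _ := by ring

/-! ### The Bernstein basis -/

/-- The Bernstein basis polynomial, as a function. -/
def bernsteinBasis (k ν : ℕ) (x : ℝ) : ℝ := (bernsteinPolynomial ℝ k ν).eval x

theorem bernsteinBasis_eq (k ν : ℕ) (x : ℝ) :
    bernsteinBasis k ν x = k.choose ν * x ^ ν * (1 - x) ^ (k - ν) := by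
  simp [bernsteinBasis, bernsteinPolynomial]

theorem bernsteinBasis_nonneg (k ν : ℕ) {x : ℝ} (hx : x ∈ Set.Icc (0 : ℝ) 1) :
    0 ≤ bernsteinBasis k ν x := by
  rw [bernsteinBasis_eq]
  have := hx.1
  have := sub_nonneg.2 hx.2
  positivity

theorem bernsteinBasis_eq_zero {k ν : ℕ} (h : k < ν) (x : ℝ) : bernsteinBasis k ν x = 0 := by
  simp [bernsteinBasis, bernsteinPolynomial.eq_zero_of_lt ℝ h]

theorem sum_bernsteinBasis (k : ℕ) (x : ℝ) :
    ∑ ν ∈ Finset.range (k + 1), bernsteinBasis k ν x = 1 := by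
  have := congrArg (Polynomial.eval x) (bernsteinPolynomial.sum ℝ k)
  simpa [bernsteinBasis, Polynomial.eval_finsetSum] using this

theorem sum_mul_bernsteinBasis (k : ℕ) (x : ℝ) :
    ∑ ν ∈ Finset.range (k + 1), (ν : ℝ) * bernsteinBasis k ν x = k * x := by
  have := congrArg (Polynomial.eval x) (bernsteinPolynomial.sum_smul ℝ k)
  simpa [bernsteinBasis, Polynomial.eval_finsetSum] using this

theorem sum_sq_mul_bernsteinBasis (k : ℕ) (x : ℝ) :
    ∑ ν ∈ Finset.range (k + 1), ((ν : ℝ) - k * x) ^ 2 * bernsteinBasis k ν x =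
      k * x * (1 - x) := by
  have := congrArg (Polynomial.eval x) (bernsteinPolynomial.variance ℝ k)
  simp only [Polynomial.eval_finsetSum, Polynomial.eval_mul, Polynomial.eval_pow,
    Polynomial.eval_sub, Polynomial.eval_X, Polynomial.eval_natCast,
    Polynomial.eval_one, nsmul_eq_mul] at this
  rw [← this]
  refine Finset.sum_congr rfl fun ν _ => ?_
  rw [bernsteinBasis]
  ring

theorem mul_bernsteinBasis (k j : ℕ) (x : ℝ) :
    ((k : ℝ) + 1) * x * bernsteinBasis k j x = (j + 1) * bernsteinBasis (k + 1) (j + 1) x := by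
  rw [bernsteinBasis_eq, bernsteinBasis_eq, Nat.add_sub_add_right]
  have : (((k + 1) * k.choose j : ℕ) : ℝ) = ((k + 1).choose (j + 1) * (j + 1) : ℕ) :=
    congrArg _ (Nat.add_one_mul_choose_eq k j)
  push_cast at this
  linear_combination (x ^ (j + 1) * (1 - x) ^ (k - j)) * this

theorem one_sub_mul_bernsteinBasis {k j : ℕ} (hj : j ≤ k + 1) (x : ℝ) :
    ((k : ℝ) + 1) * (1 - x) * bernsteinBasis k j x =
      (k + 1 - j) * bernsteinBasis (k + 1) j x := by
  rcases hj.eq_or_lt with rfl | hj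
  · rw [bernsteinBasis_eq_zero (Nat.lt_succ_self k)]
    push_cast
    ring
  · have hj' : j ≤ k := Nat.lt_succ_iff.1 hj
    rw [bernsteinBasis_eq, bernsteinBasis_eq, Nat.succ_sub hj', pow_succ]
    have := Nat.choose_mul_succ_eq k j
    have : ((k.choose j : ℕ) : ℝ) * (k + 1) = ((k + 1).choose j : ℕ) * (k + 1 - j) := by
      have h2 : (((k.choose j) * (k + 1) : ℕ) : ℝ) = ((k + 1).choose j * (k + 1 - j) : ℕ) :=
        congrArg _ this
      rw [Nat.cast_mul, Nat.cast_mul, Nat.cast_sub hj.le] at h2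
      push_cast at h2
      exact h2
    linear_combination (x ^ j * (1 - x) ^ (k - j) * (1 - x)) * this

/-- The backward difference, in the index, of the Bernstein basis. -/
def bernsteinDiff (k j : ℕ) (x : ℝ) : ℝ :=
  (if j = 0 then 0 else bernsteinBasis k (j - 1) x) - bernsteinBasis k j x

/-- Combining the two ways of raising the degree expresses a difference in degree `k` through a
single, nonnegative basis function of degree `k + 1`. Weighted sums of absolute differences thereby
become moments of a binomial law. -/
theorem mul_bernsteinDiff {k j : ℕ} (hj : j ≤ k + 1) (x : ℝ) :
    ((k : ℝ) + 1) * x * (1 - x) * bernsteinDiff k j x =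
      (j - (k + 1) * x) * bernsteinBasis (k + 1) j x := by
  have h2 := one_sub_mul_bernsteinBasis hj x
  rw [bernsteinDiff]
  rcases j with _ | j
  · rw [if_pos rfl]
    push_cast at h2 ⊢
    linear_combination (-x) * h2
  · have h1 := mul_bernsteinBasis k j x
    rw [if_neg (Nat.succ_ne_zero j), Nat.add_sub_cancel]
    push_cast at h2 ⊢
    linear_combination (1 - x) * h1 - x * h2

theorem sum_range_bernsteinDiff (k m : ℕ) (x : ℝ) :
    ∑ j ∈ Finset.range (m + 1), bernsteinDiff k j x = -bernsteinBasis k m x := by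
  induction m with
  | zero => simp [bernsteinDiff]
  | succ m ih =>
    rw [Finset.sum_range_succ, ih, bernsteinDiff, if_neg (Nat.succ_ne_zero m), Nat.add_sub_cancel]
    ring

/-- Summation by parts. The base point `a` is free because the differences sum to zero; it will be
placed near `(k + 1) x`. -/
theorem sum_signedIndicator_mul_bernsteinDiff {k ν : ℕ} (hν : ν ≤ k) (a : ℕ) (x : ℝ) :
    ∑ j ∈ Finset.range (k + 2), signedIndicator a j ν * bernsteinDiff k j x =
      bernsteinBasis k ν x := by
  have htot : ∑ j ∈ Finset.range (k + 2), bernsteinDiff k j x = 0 := by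
    rw [sum_range_bernsteinDiff, bernsteinBasis_eq_zero (Nat.lt_succ_self k), neg_zero]
  have hsplit : ∀ j ∈ Finset.range (k + 2), signedIndicator a j ν * bernsteinDiff k j x =
      (1 - if ν < a then 1 else 0) * bernsteinDiff k j x -
        if j ∈ Finset.range (ν + 1) then bernsteinDiff k j x else 0 := fun j _ => by
    simp only [signedIndicator, Finset.mem_range, Nat.lt_succ_iff]
    split_ifs <;> first | omega | ring
  rw [Finset.sum_congr rfl hsplit, Finset.sum_sub_distrib, ← Finset.mul_sum, htot, mul_zero,
    zero_sub, Finset.sum_ite_mem, Finset.inter_eq_right.2, sum_range_bernsteinDiff, neg_neg]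
  exact Finset.range_subset_range.2 (by omega)

/-- As `a` is within `1/2` of `K x`, an index `j ≠ a` has `|j - K x| ≥ 1/2`, so `|a - j| ≤ 2 |j - K
x|`, while `distEnds N a` is at most about twice the variance `K x (1 - x)`. The right-hand side is
chosen so that its binomial mean is a multiple of the variance. -/
theorem mul_boxWeight_le {K : ℝ} {a j N : ℕ} {x : ℝ} (hN : (N : ℝ) = K)
    (hx : x ∈ Set.Icc (0 : ℝ) 1) (hK : 0 ≤ K) (ha : |(a : ℝ) - K * x| ≤ 1 / 2) :
    |(j : ℝ) - K * x| * boxWeight N a j ≤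
      6 * ((j : ℝ) - K * x) ^ 2 + 2 * (K * x * (1 - x)) := by
  have hσ : 0 ≤ K * x * (1 - x) := mul_nonneg (mul_nonneg hK hx.1) (sub_nonneg.2 hx.2)
  by_cases haj : a = j
  · rw [boxWeight, if_pos haj, mul_zero]
    positivity
  rw [boxWeight, if_neg haj]
  set δ := |(j : ℝ) - K * x| with hδ
  have hd1 : (1 : ℝ) ≤ |(a : ℝ) - j| := by
    have : (1 : ℤ) ≤ |(a : ℤ) - j| := Int.one_le_abs (sub_ne_zero.2 (by exact_mod_cast haj))
    exact_mod_cast this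
  have htri : |(a : ℝ) - j| ≤ |(a : ℝ) - K * x| + δ := by
    rw [hδ, abs_sub_comm (j : ℝ)]
    exact abs_sub_le _ _ _
  have hδ2 : 1 / 2 ≤ δ := by linarith
  rw [← sq_abs ((j : ℝ) - K * x), ← hδ]
  have ht : distEnds N a ≤ 2 * (K * x * (1 - x)) + 1 / 2 := by
    obtain ⟨h1, h2⟩ := abs_le.1 ha
    rw [distEnds, hN]
    rcases le_total x (1 / 2) with h | h
    · refine (min_le_left _ _).trans ?_
      nlinarith [mul_nonneg hK hx.1]
    · refine (min_le_right _ _).trans ?_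
      nlinarith [mul_nonneg hK (sub_nonneg.2 hx.2)]
  have hw0 := Real.sqrt_nonneg (1 + distEnds N a)
  set w := √(1 + distEnds N a) with hw
  have hw2 : w ^ 2 ≤ 2 * (K * x * (1 - x)) + 3 / 2 := by
    rcases le_total 0 (1 + distEnds N a) with h | h
    · rw [hw, Real.sq_sqrt h]; linarith
    · rw [hw, Real.sqrt_eq_zero_of_nonpos h]; linarith
  set σ := K * x * (1 - x)
  -- For `σ ≥ 1` this is the arithmetic-geometric mean inequality; for `σ ≤ 1`, `w ≤ 2` and `δ ≥
  -- 1/2` suffice.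
  have hdw : δ * w ≤ 4 * δ ^ 2 + 2 * σ := by
    rcases le_total 1 σ with h | h
    · nlinarith [sq_nonneg (δ - w)]
    · have : w ≤ 2 := by nlinarith
      nlinarith
  nlinarith

/-- The first differences of the Bernstein basis are summable against the box weights, uniformly
in the degree. -/
theorem exists_sum_abs_bernsteinDiff_le (k : ℕ) {x : ℝ} (hx : x ∈ Set.Icc (0 : ℝ) 1) :
    ∃ a : Fin (k + 2),
      ∑ j ∈ Finset.range (k + 2), |bernsteinDiff k j x| * boxWeight (k + 1) a j ≤ 8 := by
  rcases hx.1.eq_or_lt with rfl | hx0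
  -- The identity for the differences degenerates at `x = 0` and `x = 1`. With the base point at the
  -- corresponding end, a single index survives: the weight vanishes at `j = a`, and the difference
  -- vanishes at the remaining indices.
  · refine ⟨0, ?_⟩
    rw [Finset.sum_eq_single_of_mem 1 (by simp)]
    · have h1 : |bernsteinDiff k 1 0| ≤ 1 := by
        simp [bernsteinDiff, bernsteinBasis, bernsteinPolynomial.eval_at_0]
      have h2 : boxWeight (k + 1) 0 1 ≤ 2 := by
        have : distEnds (k + 1) 0 ≤ 0 := (min_le_left _ _).trans (by simp)
        have : √(1 + distEnds (k + 1) 0) ≤ 1 := Real.sqrt_le_one.2 (by linarith)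
        simp only [boxWeight, zero_ne_one, if_false]
        norm_num
        linarith
      have := boxWeight_nonneg (k + 1) 0 1
      simp only [Fin.val_zero]
      nlinarith [abs_nonneg (bernsteinDiff k 1 0)]
    · intro j _ hj
      rcases j with _ | _ | j
      · simp [boxWeight]
      · exact absurd rfl hj
      · simp [bernsteinDiff, bernsteinBasis, bernsteinPolynomial.eval_at_0]
  rcases hx.2.eq_or_lt with rfl | hx1
  · refine ⟨Fin.last (k + 1), ?_⟩
    rw [Finset.sum_eq_single_of_mem k (by simp)]
    · have h1 : |bernsteinDiff k k 1| ≤ 1 := by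
        rcases k with _ | k <;>
          simp [bernsteinDiff, bernsteinBasis, bernsteinPolynomial.eval_at_1]
      have h2 : boxWeight (k + 1) (k + 1) k ≤ 2 := by
        have : distEnds (k + 1) (k + 1) ≤ 0 := (min_le_right _ _).trans (by simp)
        have : √(1 + distEnds (k + 1) (k + 1)) ≤ 1 := Real.sqrt_le_one.2 (by linarith)
        rw [boxWeight, if_neg (Nat.succ_ne_self k)]
        push_cast
        rw [add_sub_cancel_left, abs_one]
        linarith
      have := boxWeight_nonneg (k + 1) (k + 1) k
      simp only [Fin.val_last]
      nlinarith [abs_nonneg (bernsteinDiff k k 1)]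
    · intro j hj hjk
      rcases eq_or_ne j (k + 1) with rfl | hj1
      · simp [boxWeight]
      · have hj0 : j = 0 ∨ j - 1 ≠ k := by omega
        rcases hj0 with rfl | hj0
        · simp [bernsteinDiff, bernsteinBasis, bernsteinPolynomial.eval_at_1, hjk]
        · simp [bernsteinDiff, bernsteinBasis, bernsteinPolynomial.eval_at_1, hjk, hj0]
  · have hK : (0 : ℝ) < (k : ℝ) + 1 := by positivity
    -- The base point is an integer nearest to `(k + 1) x`.
    set a := ⌊((k : ℝ) + 1) * x + 1 / 2⌋₊ with ha
    have hpos : 0 ≤ ((k : ℝ) + 1) * x + 1 / 2 := by positivity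
    have ha1 := Nat.floor_le hpos
    have ha2 := Nat.lt_floor_add_one (((k : ℝ) + 1) * x + 1 / 2)
    rw [← ha] at ha1 ha2
    have hak : a < k + 2 := by
      have : (a : ℝ) < ((k + 2 : ℕ) : ℝ) := by
        push_cast
        nlinarith
      exact_mod_cast this
    have habs : |(a : ℝ) - ((k : ℝ) + 1) * x| ≤ 1 / 2 := abs_le.2 ⟨by linarith, by linarith⟩
    refine ⟨⟨a, hak⟩, ?_⟩
    have hσ : 0 < ((k : ℝ) + 1) * x * (1 - x) := mul_pos (mul_pos hK hx0) (sub_pos.2 hx1)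
    refine le_of_mul_le_mul_left ?_ hσ
    rw [Finset.mul_sum]
    have hcast : ((k + 1 : ℕ) : ℝ) = (k : ℝ) + 1 := by push_cast; ring
    have hvar := sum_sq_mul_bernsteinBasis (k + 1) x
    rw [hcast] at hvar
    calc _ ≤ ∑ j ∈ Finset.range (k + 2), (6 * ((j : ℝ) - (k + 1) * x) ^ 2 +
          2 * ((k + 1) * x * (1 - x))) * bernsteinBasis (k + 1) j x := by
          refine Finset.sum_le_sum fun j hj => ?_
          have hjk : j ≤ k + 1 := Nat.lt_succ_iff.1 (Finset.mem_range.1 hj)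
          have hb := bernsteinBasis_nonneg (k + 1) j hx
          have h1 := mul_bernsteinDiff hjk x
          have h2 : ((k : ℝ) + 1) * x * (1 - x) * |bernsteinDiff k j x| =
              |(j : ℝ) - (k + 1) * x| * bernsteinBasis (k + 1) j x := by
            rw [← abs_of_pos hσ, ← abs_mul, h1, abs_mul, abs_of_nonneg hb]
          rw [← mul_assoc, h2, mul_right_comm]
          exact mul_le_mul_of_nonneg_right (mul_boxWeight_le hcast hx hK.le habs) hb
      _ = 6 * ∑ j ∈ Finset.range (k + 2), ((j : ℝ) - (k + 1) * x) ^ 2 *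
            bernsteinBasis (k + 1) j x + 2 * ((k + 1) * x * (1 - x)) *
            ∑ j ∈ Finset.range (k + 2), bernsteinBasis (k + 1) j x := by
          rw [Finset.mul_sum, Finset.mul_sum, ← Finset.sum_add_distrib]
          exact Finset.sum_congr rfl fun j _ => by ring
      _ ≤ _ := by
          -- The terms contribute `6` and `2` times the variance, whence the constant `8`.
          rw [hvar, sum_bernsteinBasis]
          linarith

/-- Control of the box sums of the noise controls the Bernstein polynomial of the noise, uniformly
on the cube. -/
theorem abs_sum_mul_prod_bernsteinBasis_le {ℓ k : ℕ} {z : LatticeIdx ℓ k → ℝ} {u : ℝ}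
    (hu : 0 ≤ u) (hz : ∀ p : Fin ℓ → Fin (k + 2) × Fin (k + 2),
      |boxSum z p| ≤ u * ∏ i, boxWeight (k + 1) (p i).1 (p i).2)
    {y : Fin ℓ → ℝ} (hy : y ∈ cube ℓ) :
    |∑ ν, z ν * ∏ i, bernsteinBasis k (ν i) (y i)| ≤ u * 8 ^ ℓ := by
  have hyi : ∀ i, y i ∈ Set.Icc (0 : ℝ) 1 := fun i => ⟨hy.1 i, hy.2 i⟩
  -- The base points depend on `y`; this is why the box sums are controlled with both corners
  -- arbitrary.
  choose a ha using fun i => exists_sum_abs_bernsteinDiff_le k (hyi i)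
  have hexp : ∀ ν : LatticeIdx ℓ k, ∏ i, bernsteinBasis k (ν i) (y i) =
      ∑ b : Fin ℓ → Fin (k + 2),
        (∏ i, signedIndicator (a i) (b i) (ν i)) * ∏ i, bernsteinDiff k (b i) (y i) := fun ν => by
    simp_rw [← Finset.prod_mul_distrib]
    rw [← Fintype.prod_sum fun i (j : Fin (k + 2)) =>
      signedIndicator (a i) j (ν i) * bernsteinDiff k j (y i)]
    refine Finset.prod_congr rfl fun i _ => ?_
    rw [← sum_signedIndicator_mul_bernsteinDiff (Nat.lt_succ_iff.1 (ν i).2) (a i) (y i),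
      Finset.sum_range]
  have hswap : ∑ ν, z ν * ∏ i, bernsteinBasis k (ν i) (y i) =
      ∑ b : Fin ℓ → Fin (k + 2), boxSum z (fun i => (a i, b i)) *
        ∏ i, bernsteinDiff k (b i) (y i) := by
    simp_rw [hexp, Finset.mul_sum, boxSum, Finset.sum_mul]
    rw [Finset.sum_comm]
    exact Finset.sum_congr rfl fun b _ => Finset.sum_congr rfl fun ν _ => by ring
  rw [hswap]
  calc _ ≤ ∑ b : Fin ℓ → Fin (k + 2),
        u * ∏ i, (|bernsteinDiff k (b i) (y i)| * boxWeight (k + 1) (a i) (b i)) := by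
        refine (Finset.abs_sum_le_sum_abs _ _).trans (Finset.sum_le_sum fun b _ => ?_)
        rw [abs_mul, Finset.abs_prod, Finset.prod_mul_distrib, mul_comm (∏ i, |_|), ← mul_assoc]
        exact mul_le_mul_of_nonneg_right (hz _) (Finset.prod_nonneg fun i _ => abs_nonneg _)
    _ = u * ∏ i, ∑ j : Fin (k + 2), |bernsteinDiff k j (y i)| * boxWeight (k + 1) (a i) j := by
        rw [← Finset.mul_sum, Fintype.prod_sum]
    _ ≤ u * ∏ _i : Fin ℓ, (8 : ℝ) := by
        refine mul_le_mul_of_nonneg_left (Finset.prod_le_prod (fun i _ =>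
          Finset.sum_nonneg fun j _ => mul_nonneg (abs_nonneg _) (boxWeight_nonneg _ _ _))
          fun i _ => ?_) hu
        have := ha i
        rwa [Finset.sum_range] at this
    _ = u * 8 ^ ℓ := by simp

/-! ### The Bernstein operator as a linear map -/

/-- The Bernstein operator as an endomorphism of the space of functions. -/
def bernsteinEnd (k : ℕ) : Module.End ℝ (ℝ → ℝ) where
  toFun := bernsteinOp k
  map_add' f g := by
    ext y
    simp [bernsteinOp, add_mul, Finset.sum_add_distrib]
  map_smul' c f := by
    ext y
    simp [bernsteinOp, Finset.mul_sum, mul_assoc]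

theorem bernsteinEnd_apply (k : ℕ) (f : ℝ → ℝ) (x : ℝ) :
    bernsteinEnd k f x = ∑ ν ∈ Finset.range (k + 1), f ((ν : ℝ) / k) * bernsteinBasis k ν x := rfl

theorem natCast_div_mem_Icc {ν k : ℕ} (h : ν ≤ k) : ((ν : ℝ) / k) ∈ Set.Icc (0 : ℝ) 1 :=
  ⟨by positivity, div_le_one_of_le₀ (Nat.cast_le.2 h) (by positivity)⟩

theorem abs_sum_mul_bernsteinBasis_le {k : ℕ} {c : ℕ → ℝ} {W : ℝ} (hc : ∀ ν ≤ k, |c ν| ≤ W)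
    {x : ℝ} (hx : x ∈ Set.Icc (0 : ℝ) 1) :
    |∑ ν ∈ Finset.range (k + 1), c ν * bernsteinBasis k ν x| ≤ W := by
  calc _ ≤ ∑ ν ∈ Finset.range (k + 1), W * bernsteinBasis k ν x := by
        refine (Finset.abs_sum_le_sum_abs _ _).trans (Finset.sum_le_sum fun ν hν => ?_)
        rw [abs_mul, abs_of_nonneg (bernsteinBasis_nonneg k ν hx)]
        exact mul_le_mul_of_nonneg_right (hc ν (Nat.lt_succ_iff.1 (Finset.mem_range.1 hν)))
          (bernsteinBasis_nonneg k ν hx)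
    _ = W := by rw [← Finset.mul_sum, sum_bernsteinBasis, mul_one]

theorem abs_bernsteinEnd_le (k : ℕ) {f : ℝ → ℝ} {W : ℝ} (hf : ∀ x ∈ Set.Icc (0 : ℝ) 1, |f x| ≤ W)
    {x : ℝ} (hx : x ∈ Set.Icc (0 : ℝ) 1) : |bernsteinEnd k f x| ≤ W :=
  abs_sum_mul_bernsteinBasis_le (fun _ hν => hf _ (natCast_div_mem_Icc hν)) hx

theorem abs_bernsteinEnd_pow_le (k i : ℕ) {f : ℝ → ℝ} {W : ℝ}
    (hf : ∀ x ∈ Set.Icc (0 : ℝ) 1, |f x| ≤ W) {x : ℝ} (hx : x ∈ Set.Icc (0 : ℝ) 1) :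
    |(bernsteinEnd k ^ i) f x| ≤ W := by
  induction i generalizing x with
  | zero => exact hf x hx
  | succ i ih =>
    rw [pow_succ']
    exact abs_bernsteinEnd_le k (fun x hx => ih hx) hx

theorem abs_one_sub_bernsteinEnd_pow_le (k i : ℕ) {f : ℝ → ℝ} {W : ℝ}
    (hf : ∀ x ∈ Set.Icc (0 : ℝ) 1, |f x| ≤ W) {x : ℝ} (hx : x ∈ Set.Icc (0 : ℝ) 1) :
    |((1 - bernsteinEnd k) ^ i) f x| ≤ 2 ^ i * W := by
  induction i generalizing x with
  | zero => simpa using hf x hx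
  | succ i ih =>
    rw [pow_succ']
    have h1 := abs_bernsteinEnd_le k (fun x hx => ih hx) hx
    have h2 := ih hx
    calc _ = |((1 - bernsteinEnd k) ^ i) f x -
          bernsteinEnd k (((1 - bernsteinEnd k) ^ i) f) x| := rfl
      _ ≤ _ := (abs_sub _ _).trans (by rw [pow_succ]; linarith)

/-- The operator that maps the Bernstein basis to the iterated Bernstein basis of order `h`. -/
def iterEnd (h k : ℕ) : Module.End ℝ (ℝ → ℝ) :=
  ∑ i ∈ Finset.Icc 1 h, ((h.choose i : ℝ) * (-1) ^ (i - 1)) • bernsteinEnd k ^ (i - 1)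

theorem iterEnd_apply (h k : ℕ) (f : ℝ → ℝ) (x : ℝ) :
    iterEnd h k f x = ∑ i ∈ Finset.Icc 1 h,
      (h.choose i : ℝ) * (-1) ^ (i - 1) * (bernsteinEnd k ^ (i - 1)) f x := by
  simp [iterEnd, LinearMap.sum_apply, Finset.sum_apply]

theorem iterEnd_bernsteinBasis (h k ν : ℕ) :
    iterEnd h k (bernsteinBasis k ν) = iterBasis h k ν := by
  ext x
  rw [iterEnd_apply, iterBasis]
  refine Finset.sum_congr rfl fun i _ => ?_
  rw [Module.End.pow_apply]
  rfl

/-- The binomial expansion of `1 - (1 - B)^h` with one factor `B` taken out; it explains the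
coefficients of the iterated basis. -/
theorem iterEnd_mul_bernsteinEnd (h k : ℕ) :
    iterEnd h k * bernsteinEnd k = 1 - (1 - bernsteinEnd k) ^ h := by
  have hIcc : Finset.Icc 1 h = Finset.Ico (0 + 1) (h + 1) := by ext; simp
  have hpow := (Commute.one_right (-bernsteinEnd k)).add_pow h
  rw [neg_add_eq_sub, Finset.sum_range_succ'] at hpow
  rw [hpow, iterEnd, hIcc, ← Finset.sum_Ico_add' _ 0 h 1, ← Finset.range_eq_Ico, Finset.sum_mul]
  simp only [pow_zero, one_pow, mul_one, Nat.choose_zero_right, Nat.cast_one, Nat.add_sub_cancel]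
  rw [sub_add_cancel_right, ← Finset.sum_neg_distrib]
  refine Finset.sum_congr rfl fun i _ => ?_
  rw [smul_mul_assoc, ← pow_succ, ← neg_one_smul ℝ (bernsteinEnd k), smul_pow, ← nsmul_eq_mul',
    ← Nat.cast_smul_eq_nsmul ℝ, smul_smul, ← neg_smul]
  congr 1
  ring

theorem abs_iterEnd_le (h k : ℕ) {f : ℝ → ℝ} {W : ℝ} (hW : 0 ≤ W)
    (hf : ∀ x ∈ Set.Icc (0 : ℝ) 1, |f x| ≤ W) {x : ℝ} (hx : x ∈ Set.Icc (0 : ℝ) 1) :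
    |iterEnd h k f x| ≤ 2 ^ h * W := by
  rw [iterEnd_apply]
  calc _ ≤ ∑ i ∈ Finset.Icc 1 h, (h.choose i : ℝ) * W := by
        refine (Finset.abs_sum_le_sum_abs _ _).trans (Finset.sum_le_sum fun i _ => ?_)
        rw [abs_mul, abs_mul, abs_pow, abs_neg, abs_one, one_pow, mul_one, Nat.abs_cast]
        exact mul_le_mul_of_nonneg_left (abs_bernsteinEnd_pow_le k _ hf hx) (by positivity)
    _ ≤ ∑ i ∈ Finset.range (h + 1), (h.choose i : ℝ) * W := by
        refine Finset.sum_le_sum_of_subset_of_nonneg (fun i hi => ?_) fun i _ _ => by positivity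
        rw [Finset.mem_Icc] at hi
        exact Finset.mem_range.2 (by omega)
    _ = 2 ^ h * W := by
        rw [← Finset.sum_mul]
        congr 1
        exact_mod_cast Nat.sum_range_choose h

theorem sum_mul_iterBasis (h k : ℕ) (c : ℕ → ℝ) (x : ℝ) :
    ∑ ν ∈ Finset.range (k + 1), c ν * iterBasis h k ν x =
      iterEnd h k (fun t => ∑ ν ∈ Finset.range (k + 1), c ν * bernsteinBasis k ν t) x := by
  have : (fun t => ∑ ν ∈ Finset.range (k + 1), c ν * bernsteinBasis k ν t) =
      ∑ ν ∈ Finset.range (k + 1), c ν • bernsteinBasis k ν := by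
    ext t
    simp [Finset.sum_apply]
  rw [this, map_sum, Finset.sum_apply]
  refine Finset.sum_congr rfl fun ν _ => ?_
  rw [map_smul, iterEnd_bernsteinBasis, Pi.smul_apply, smul_eq_mul]

theorem sum_eval_mul_iterBasis (h k : ℕ) (f : ℝ → ℝ) (x : ℝ) :
    ∑ ν ∈ Finset.range (k + 1), f ((ν : ℝ) / k) * iterBasis h k ν x =
      f x - ((1 - bernsteinEnd k) ^ h) f x := by
  rw [sum_mul_iterBasis]
  have := congrArg (fun A : Module.End ℝ (ℝ → ℝ) => A f x) (iterEnd_mul_bernsteinEnd h k)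
  exact this

/-- Duality: the signs of the iterated basis functions at the fixed point `x`, taken as
coefficients, turn the sup norm bound for `iterEnd` into a bound for the Lebesgue function. -/
theorem sum_abs_iterBasis_le (h k : ℕ) {x : ℝ} (hx : x ∈ Set.Icc (0 : ℝ) 1) :
    ∑ ν ∈ Finset.range (k + 1), |iterBasis h k ν x| ≤ 2 ^ h := by
  have h1 : ∑ ν ∈ Finset.range (k + 1), |iterBasis h k ν x| =
      ∑ ν ∈ Finset.range (k + 1), SignType.sign (iterBasis h k ν x) * iterBasis h k ν x :=
    Finset.sum_congr rfl fun ν _ => (sign_mul_self _).symm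
  rw [h1, sum_mul_iterBasis h k (fun ν => SignType.sign (iterBasis h k ν x)) x]
  refine (le_abs_self _).trans ((abs_iterEnd_le h k zero_le_one (fun t ht =>
    abs_sum_mul_bernsteinBasis_le (fun ν _ => ?_) ht) hx).trans (mul_one _).le)
  rcases SignType.sign (iterBasis h k ν x) with _ | _ | _ <;> simp

/-! ### Tensor products -/

theorem sum_latticeIdx_succ {ℓ k : ℕ} (g : LatticeIdx (ℓ + 1) k → ℝ) :
    ∑ ν, g ν = ∑ m : Fin (k + 1), ∑ ν : LatticeIdx ℓ k, g (Fin.cons m ν) := by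
  rw [← Fintype.sum_prod_type', ← (Fin.consEquiv fun _ => Fin (k + 1)).sum_comp]
  rfl

theorem cons_mem_cube {ℓ : ℕ} {t : ℝ} {y : Fin ℓ → ℝ} (ht : t ∈ Set.Icc (0 : ℝ) 1)
    (hy : y ∈ cube ℓ) : (Fin.cons t y : Fin (ℓ + 1) → ℝ) ∈ cube (ℓ + 1) :=
  ⟨fun i => Fin.cases ht.1 (fun i => hy.1 i) i, fun i => Fin.cases ht.2 (fun i => hy.2 i) i⟩

/-- Replacing the Bernstein basis by the iterated one in a single variable amounts to applying
`iterEnd` in that variable, at the cost of `2^h`. The first variable is frozen and absorbed into the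
coefficients, and the induction continues with `2^h * W`. -/
theorem abs_sum_mul_prod_iterBasis_le (h k : ℕ) {ℓ : ℕ} {z : LatticeIdx ℓ k → ℝ} {W : ℝ}
    (hW : 0 ≤ W) (hz : ∀ y ∈ cube ℓ, |∑ ν, z ν * ∏ i, bernsteinBasis k (ν i) (y i)| ≤ W)
    {y : Fin ℓ → ℝ} (hy : y ∈ cube ℓ) : |bernsteinEval h z y| ≤ (2 ^ h) ^ ℓ * W := by
  induction ℓ generalizing W with
  | zero => simpa [bernsteinEval] using hz y hy
  | succ ℓ ih =>
    have hy0 : y 0 ∈ Set.Icc (0 : ℝ) 1 := ⟨hy.1 0, hy.2 0⟩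
    have hyt : Fin.tail y ∈ cube ℓ := ⟨fun i => hy.1 i.succ, fun i => hy.2 i.succ⟩
    have heq : bernsteinEval h z y = bernsteinEval h (fun ν : LatticeIdx ℓ k =>
        ∑ m : Fin (k + 1), z (Fin.cons m ν) * iterBasis h k m (y 0)) (Fin.tail y) := by
      simp only [bernsteinEval]
      rw [sum_latticeIdx_succ, Finset.sum_comm]
      refine Finset.sum_congr rfl fun ν _ => ?_
      rw [Finset.sum_mul]
      refine Finset.sum_congr rfl fun m _ => ?_
      rw [Fin.prod_univ_succ]
      simp only [Fin.cons_zero, Fin.cons_succ, Fin.tail]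
      ring
    rw [heq, pow_succ, mul_assoc]
    refine ih (by positivity) (fun y' hy' => ?_) hyt
    have h1 : ∑ ν : LatticeIdx ℓ k, (∑ m : Fin (k + 1), z (Fin.cons m ν) *
        iterBasis h k m (y 0)) * ∏ i, bernsteinBasis k (ν i) (y' i) =
        ∑ m ∈ Finset.range (k + 1), (if hm : m < k + 1 then ∑ ν : LatticeIdx ℓ k,
          z (Fin.cons ⟨m, hm⟩ ν) * ∏ i, bernsteinBasis k (ν i) (y' i) else 0) *
            iterBasis h k m (y 0) := by
      rw [Finset.sum_range]
      simp_rw [Finset.sum_mul]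
      rw [Finset.sum_comm]
      refine Finset.sum_congr rfl fun m _ => ?_
      rw [dif_pos m.2, Finset.sum_mul]
      exact Finset.sum_congr rfl fun ν _ => by ring
    rw [h1, sum_mul_iterBasis]
    refine abs_iterEnd_le h k hW (fun t ht => ?_) hy0
    refine le_trans (le_of_eq (congrArg _ ?_)) (hz (Fin.cons t y') (cons_mem_cube ht hy'))
    rw [sum_latticeIdx_succ, Finset.sum_range]
    refine Finset.sum_congr rfl fun m _ => ?_
    rw [dif_pos m.2, Finset.sum_mul]
    refine Finset.sum_congr rfl fun ν _ => ?_
    rw [Fin.prod_univ_succ]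
    simp only [Fin.cons_zero, Fin.cons_succ]
    ring

/-- An error bound for the approximation of all the univariate sections of a function gives one for
the function itself. -/
theorem abs_bernsteinEval_sub_le (h k : ℕ) {ℓ : ℕ} {f : (Fin ℓ → ℝ) → ℝ} {δ : ℝ}
    (hδ : 0 ≤ δ) (hf : ∀ i, ∀ y ∈ cube ℓ,
      |((1 - bernsteinEnd k) ^ h) (fun t => f (Function.update y i t)) (y i)| ≤ δ)
    {y : Fin ℓ → ℝ} (hy : y ∈ cube ℓ) :
    |bernsteinEval h (fun ν : LatticeIdx ℓ k => f (latticePoint ν)) y - f y| ≤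
      ℓ * (2 ^ h) ^ ℓ * δ := by
  induction ℓ with
  | zero =>
    have : ∀ ν : LatticeIdx 0 k, latticePoint ν = y := fun ν => Subsingleton.elim _ _
    simp [bernsteinEval, this]
  | succ ℓ ih =>
    have hy0 : y 0 ∈ Set.Icc (0 : ℝ) 1 := ⟨hy.1 0, hy.2 0⟩
    have hyt : Fin.tail y ∈ cube ℓ := ⟨fun i => hy.1 i.succ, fun i => hy.2 i.succ⟩
    -- In `g` all variables but the first are approximated. The total error is that of `g` at the
    -- nodes, amplified by the Lebesgue constant `2^h`, plus the univariate error in the first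
    -- variable.
    set g : ℝ → ℝ := fun t => bernsteinEval h (fun ν : LatticeIdx ℓ k =>
      f (Fin.cons t (latticePoint ν))) (Fin.tail y) with hg
    have heq : bernsteinEval h (fun ν : LatticeIdx (ℓ + 1) k => f (latticePoint ν)) y =
        ∑ m ∈ Finset.range (k + 1), g ((m : ℝ) / k) * iterBasis h k m (y 0) := by
      simp only [bernsteinEval, hg]
      rw [sum_latticeIdx_succ, Finset.sum_range]
      refine Finset.sum_congr rfl fun m _ => ?_
      rw [Finset.sum_mul]
      refine Finset.sum_congr rfl fun ν _ => ?_
      have hp : latticePoint (Fin.cons m ν : LatticeIdx (ℓ + 1) k) =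
          Fin.cons (((m : ℕ) : ℝ) / k) (latticePoint ν) := by
        ext i
        refine Fin.cases ?_ (fun i => ?_) i <;> simp [latticePoint]
      rw [Fin.prod_univ_succ, hp]
      simp only [Fin.cons_zero, Fin.cons_succ, Fin.tail]
      ring
    have hup : ∀ t, Function.update y 0 t = Fin.cons t (Fin.tail y) := fun t => by
      conv_lhs => rw [← Fin.cons_self_tail y]
      rw [Fin.update_cons_zero]
    have hg' : ∀ t ∈ Set.Icc (0 : ℝ) 1,
        |g t - f (Function.update y 0 t)| ≤ ℓ * (2 ^ h) ^ ℓ * δ := fun t ht => by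
      rw [hup]
      refine ih (f := fun y' => f (Fin.cons t y')) (fun i y' hy' => ?_) hyt
      have := hf i.succ (Fin.cons t y') (cons_mem_cube ht hy')
      simpa only [← Fin.cons_update, Fin.cons_succ] using this
    have h0 := hf 0 y hy
    have hs := sum_eval_mul_iterBasis h k (fun t => f (Function.update y 0 t)) (y 0)
    rw [Function.update_eq_self] at hs
    have hsplit : bernsteinEval h (fun ν : LatticeIdx (ℓ + 1) k => f (latticePoint ν)) y - f y =
        ∑ m ∈ Finset.range (k + 1), (g ((m : ℝ) / k) -
          f (Function.update y 0 ((m : ℝ) / k))) * iterBasis h k m (y 0) -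
        ((1 - bernsteinEnd k) ^ h) (fun t => f (Function.update y 0 t)) (y 0) := by
      simp_rw [sub_mul]
      rw [Finset.sum_sub_distrib, hs, heq]
      ring
    have hsum : |∑ m ∈ Finset.range (k + 1), (g ((m : ℝ) / k) -
          f (Function.update y 0 ((m : ℝ) / k))) * iterBasis h k m (y 0)| ≤
        ℓ * (2 ^ h) ^ ℓ * δ * 2 ^ h := by
      calc _ ≤ ∑ m ∈ Finset.range (k + 1), ℓ * (2 ^ h) ^ ℓ * δ * |iterBasis h k m (y 0)| := by
            refine (Finset.abs_sum_le_sum_abs _ _).trans (Finset.sum_le_sum fun m hm => ?_)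
            rw [abs_mul]
            exact mul_le_mul_of_nonneg_right (hg' _ (natCast_div_mem_Icc
              (Nat.lt_succ_iff.1 (Finset.mem_range.1 hm)))) (abs_nonneg _)
        _ ≤ _ := by
            rw [← Finset.mul_sum]
            gcongr
            exact sum_abs_iterBasis_le h k hy0
    rw [hsplit]
    have hone : (1 : ℝ) ≤ (2 ^ h) ^ (ℓ + 1) := one_le_pow₀ (one_le_pow₀ one_le_two)
    calc _ ≤ ℓ * (2 ^ h) ^ ℓ * δ * 2 ^ h + δ := (abs_sub _ _).trans (add_le_add hsum h0)
      _ ≤ ℓ * (2 ^ h) ^ (ℓ + 1) * δ + (2 ^ h) ^ (ℓ + 1) * δ :=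
        add_le_add (le_of_eq (by ring)) (le_mul_of_one_le_left hδ hone)
      _ = _ := by push_cast; ring

/-! ### Smooth functions on the unit interval -/

/-- `G 1, …, G m` are the successive derivatives of `G 0` on the interval `[0, b]`. -/
def IsDerivChain (m : ℕ) (b : ℝ) (G : ℕ → ℝ → ℝ) : Prop :=
  ∀ j < m, ∀ x ∈ Set.Icc 0 b, HasDerivWithinAt (G j) (G (j + 1) x) (Set.Icc 0 b) x

/-- The mean value inequality is applied to `f'` and then to `f` minus its tangent; the factor `1/2`
lost is immaterial. -/
theorem abs_taylor_two_le {f f' f'' : ℝ → ℝ} {b T : ℝ}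
    (hf : ∀ x ∈ Set.Icc 0 b, HasDerivWithinAt f (f' x) (Set.Icc 0 b) x)
    (hf' : ∀ x ∈ Set.Icc 0 b, HasDerivWithinAt f' (f'' x) (Set.Icc 0 b) x)
    (hT : ∀ x ∈ Set.Icc 0 b, |f'' x| ≤ T) {x z : ℝ} (hx : x ∈ Set.Icc 0 b)
    (hz : z ∈ Set.Icc 0 b) : |f z - f x - f' x * (z - x)| ≤ T * (z - x) ^ 2 := by
  have hsub : Set.uIcc x z ⊆ Set.Icc 0 b := Set.uIcc_subset_Icc hx hz
  have hT0 : 0 ≤ T := (abs_nonneg _).trans (hT x hx)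
  have h1 := Convex.norm_image_sub_le_of_norm_hasDerivWithin_le
    (f := fun t => f t - f' x * t) (f' := fun t => f' t - f' x) (s := Set.uIcc x z)
    (C := T * |z - x|) (fun t ht => by
      have := ((hf t (hsub ht)).mono hsub).sub
        ((hasDerivWithinAt_id t (Set.uIcc x z)).const_mul (f' x))
      rw [mul_one] at this
      exact this)
    (fun t ht => by
      have := Convex.norm_image_sub_le_of_norm_hasDerivWithin_le hf' hT (convex_Icc 0 b) hx
        (hsub ht)
      refine this.trans ?_
      exact mul_le_mul_of_nonneg_left (Set.abs_sub_left_of_mem_uIcc ht) hT0)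
    (convex_uIcc x z) Set.left_mem_uIcc Set.right_mem_uIcc
  rw [Real.norm_eq_abs, Real.norm_eq_abs, mul_assoc, ← sq, sq_abs] at h1
  rwa [show f z - f x - f' x * (z - x) = f z - f' x * z - (f x - f' x * x) by ring]

theorem IsDerivChain.abs_sub_le {m : ℕ} {b T : ℝ} {G : ℕ → ℝ → ℝ} (hG : IsDerivChain m b G)
    {j : ℕ} (hj : j < m) (hT : ∀ x ∈ Set.Icc 0 b, |G (j + 1) x| ≤ T) {x z : ℝ}
    (hx : x ∈ Set.Icc 0 b) (hz : z ∈ Set.Icc 0 b) : |G j z - G j x| ≤ T * |z - x| :=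
  Convex.norm_image_sub_le_of_norm_hasDerivWithin_le (hG j hj) hT (convex_Icc 0 b) hx hz

theorem IsDerivChain.fwdDiff {m : ℕ} {b h : ℝ} {G : ℕ → ℝ → ℝ} (hG : IsDerivChain m b G)
    (hh : 0 ≤ h) : IsDerivChain m (b - h) fun j => fwdDiff h (G j) := by
  intro j hj x hx
  have hsub : Set.Icc 0 (b - h) ⊆ Set.Icc 0 b := Set.Icc_subset_Icc_right (by linarith)
  have hmaps : Set.MapsTo (fun t => t + h) (Set.Icc 0 (b - h)) (Set.Icc 0 b) := fun t ht =>
    ⟨by linarith [ht.1], by linarith [ht.2]⟩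
  have h1 := (hG j hj (x + h) (hmaps hx)).scomp x ((hasDerivWithinAt_id x _).add_const h) hmaps
  simp only [one_smul] at h1
  exact h1.sub ((hG j hj x (hsub hx)).mono hsub)

/-- The induction differences the whole chain at once: `fwdDiff h (G i)` is a chain on the shorter
interval `[0, b - h]`, with top member bounded by `T h`. One Taylor step then replaces `fwdDiff h (G
j)` by `h G (j + 1)`. -/
theorem abs_fwdDiff_iterate_sub_le {h : ℝ} (hh : 0 ≤ h) (j : ℕ) {b T : ℝ} {G : ℕ → ℝ → ℝ}
    (hG : IsDerivChain (j + 1) b G) (hT : ∀ x ∈ Set.Icc 0 b, |G (j + 1) x| ≤ T) {p : ℝ}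
    (hp : 0 ≤ p) (hpb : p + j * h ≤ b) :
    |(fwdDiff h)^[j] (G 0) p - h ^ j * G j p| ≤ j * h ^ (j + 1) * T := by
  induction j generalizing b T G with
  | zero => simp
  | succ j ih =>
    push_cast at hpb
    have hsub : Set.Icc 0 (b - h) ⊆ Set.Icc 0 b := Set.Icc_subset_Icc_right (by linarith)
    have hjh : 0 ≤ j * h := by positivity
    have hmem : p ∈ Set.Icc 0 b := ⟨hp, by linarith⟩
    have hmem' : p + h ∈ Set.Icc 0 b := ⟨by linarith, by linarith⟩
    have h1 := ih (G := fun i => fwdDiff h (G i)) (T := T * h)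
      ((fun i hi => hG.fwdDiff hh i (by omega)) : IsDerivChain (j + 1) (b - h) _)
      (fun x hx => by
        have := hG.abs_sub_le (j := j + 1) (by omega) hT (hsub hx)
          (show x + h ∈ Set.Icc 0 b from ⟨by linarith [hx.1], by linarith [hx.2]⟩)
        rwa [add_sub_cancel_left, abs_of_nonneg hh] at this) (by linarith)
    have h2 := abs_taylor_two_le (hG j (by omega)) (hG (j + 1) (by omega)) hT hmem hmem'
    rw [add_sub_cancel_left] at h2
    rw [Function.iterate_succ_apply]
    have h3 : |h ^ j * (fwdDiff h (G j) p - G (j + 1) p * h)| ≤ h ^ j * (T * h ^ 2) := by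
      rw [abs_mul, abs_of_nonneg (pow_nonneg hh j)]
      exact mul_le_mul_of_nonneg_left h2 (pow_nonneg hh j)
    calc _ = |((fwdDiff h)^[j] (fwdDiff h (G 0)) p - h ^ j * fwdDiff h (G j) p) +
          h ^ j * (fwdDiff h (G j) p - G (j + 1) p * h)| := by
          congr 1
          ring
      _ ≤ j * h ^ (j + 1) * (T * h) + h ^ j * (T * h ^ 2) :=
          (abs_add_le _ _).trans (add_le_add h1 h3)
      _ = _ := by push_cast; ring

theorem fwdDiff_iterate_comp_natCast_div (f : ℝ → ℝ) {k : ℕ} (j ν : ℕ) :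
    (fwdDiff 1)^[j] (fun n : ℕ => f ((n : ℝ) / k)) ν =
      (fwdDiff (1 / (k : ℝ)))^[j] f ((ν : ℝ) / k) := by
  induction j generalizing f with
  | zero => rfl
  | succ j ih =>
    rw [Function.iterate_succ_apply, Function.iterate_succ_apply, ← ih]
    have : fwdDiff 1 (fun n : ℕ => f ((n : ℝ) / k)) =
        fun n : ℕ => fwdDiff (1 / (k : ℝ)) f ((n : ℝ) / k) := by
      ext n
      simp only [fwdDiff]
      push_cast
      rw [add_div]
    rw [this]

/-! ### Derivatives of Bernstein polynomials -/

theorem hasDerivAt_bernsteinBasis (n ν : ℕ) (x : ℝ) :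
    HasDerivAt (bernsteinBasis (n + 1) ν) ((n + 1) * bernsteinDiff n ν x) x := by
  refine ((bernsteinPolynomial ℝ (n + 1) ν).hasDerivAt x).congr_deriv ?_
  rcases ν with _ | ν
  · rw [bernsteinPolynomial.derivative_zero]
    simp [bernsteinDiff, bernsteinBasis]
    ring
  · rw [bernsteinPolynomial.derivative_succ]
    simp [bernsteinDiff, bernsteinBasis]

theorem sum_mul_bernsteinDiff (c : ℕ → ℝ) (n : ℕ) (x : ℝ) :
    ∑ ν ∈ Finset.range (n + 2), c ν * bernsteinDiff n ν x =
      ∑ ν ∈ Finset.range (n + 1), fwdDiff 1 c ν * bernsteinBasis n ν x := by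
  have h1 : ∑ ν ∈ Finset.range (n + 2), c ν * (if ν = 0 then 0 else bernsteinBasis n (ν - 1) x) =
      ∑ ν ∈ Finset.range (n + 1), c (ν + 1) * bernsteinBasis n ν x := by
    rw [Finset.sum_range_succ']
    simp
  have h2 : ∑ ν ∈ Finset.range (n + 2), c ν * bernsteinBasis n ν x =
      ∑ ν ∈ Finset.range (n + 1), c ν * bernsteinBasis n ν x := by
    rw [Finset.sum_range_succ, bernsteinBasis_eq_zero (Nat.lt_succ_self n), mul_zero, add_zero]
  simp only [bernsteinDiff, mul_sub, fwdDiff, sub_mul]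
  rw [Finset.sum_sub_distrib, h1, h2, Finset.sum_sub_distrib]

theorem hasDerivAt_sum_mul_bernsteinBasis (c : ℕ → ℝ) (n : ℕ) (x : ℝ) :
    HasDerivAt (fun t => ∑ ν ∈ Finset.range (n + 1), c ν * bernsteinBasis n ν t)
      (n * ∑ ν ∈ Finset.range (n - 1 + 1), fwdDiff 1 c ν * bernsteinBasis (n - 1) ν x) x := by
  rcases n with _ | n
  · have : ∀ t, bernsteinBasis 0 0 t = 1 := fun t => by simp [bernsteinBasis_eq]
    simp [this, hasDerivAt_const]
  · refine (HasDerivAt.fun_sum fun ν (_ : ν ∈ Finset.range (n + 2)) =>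
      (hasDerivAt_bernsteinBasis n ν x).const_mul (c ν)).congr_deriv ?_
    rw [Nat.add_sub_cancel, ← sum_mul_bernsteinDiff, Finset.mul_sum]
    refine Finset.sum_congr rfl fun ν _ => ?_
    push_cast
    ring

/-- The `j`-th derivative of the Bernstein polynomial with coefficients `c`. -/
def bernsteinDeriv (k : ℕ) (c : ℕ → ℝ) (j : ℕ) (x : ℝ) : ℝ :=
  k.descFactorial j * ∑ ν ∈ Finset.range (k - j + 1),
    (fwdDiff 1)^[j] c ν * bernsteinBasis (k - j) ν x

theorem hasDerivAt_bernsteinDeriv (k : ℕ) (c : ℕ → ℝ) (j : ℕ) (x : ℝ) :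
    HasDerivAt (bernsteinDeriv k c j) (bernsteinDeriv k c (j + 1) x) x := by
  refine ((hasDerivAt_sum_mul_bernsteinBasis ((fwdDiff 1)^[j] c) (k - j) x).const_mul
    (k.descFactorial j : ℝ)).congr_deriv ?_
  rw [bernsteinDeriv, Nat.descFactorial_succ, Nat.sub_sub, Function.iterate_succ_apply']
  push_cast
  ring

/-- The estimate `1 - k.descFactorial j / k^j ≤ j^2 / k` with denominators cleared, valid also for
`k < j`, where the falling factorial is zero. -/
theorem pow_sub_descFactorial_le (k j : ℕ) :
    (k : ℝ) ^ (j + 1) - k * k.descFactorial j ≤ j ^ 2 * k ^ j := by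
  induction j with
  | zero => simp
  | succ j ih =>
    rcases le_or_gt j k with hjk | hjk
    · rw [Nat.descFactorial_succ]
      push_cast [Nat.cast_sub hjk]
      have h1 : ((k.descFactorial j : ℕ) : ℝ) ≤ (k : ℝ) ^ j := by
        exact_mod_cast Nat.descFactorial_le_pow k j
      have hk : (0 : ℝ) ≤ k := Nat.cast_nonneg k
      have hj : (0 : ℝ) ≤ j := Nat.cast_nonneg j
      have h2 := mul_le_mul_of_nonneg_right ih hk
      have h3 := mul_le_mul_of_nonneg_left h1 (mul_nonneg hj hk)
      have h4 : 0 ≤ (j : ℝ) * k ^ j * k := by positivity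
      have h5 : 0 ≤ (k : ℝ) ^ j * k := by positivity
      rw [pow_succ (k : ℝ) (j + 1), pow_succ (k : ℝ) j] at *
      nlinarith
    · rw [Nat.descFactorial_of_lt (by omega : k < j + 1)]
      have h1 : (k : ℝ) ≤ ((j + 1 : ℕ) : ℝ) := by exact_mod_cast (by omega : k ≤ j + 1)
      have h2 : (1 : ℝ) ≤ ((j + 1 : ℕ) : ℝ) := by exact_mod_cast (by omega : 1 ≤ j + 1)
      have h3 : 0 ≤ (k : ℝ) ^ (j + 1) := by positivity
      rw [Nat.cast_zero, mul_zero, sub_zero, pow_succ, mul_comm]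
      exact mul_le_mul_of_nonneg_right (by nlinarith) h3

/-- Simultaneous approximation by Bernstein polynomials, at the rate `1 / k`. -/
theorem abs_sub_bernsteinDeriv_le {k j : ℕ} (hk : 0 < k) {T : ℝ} {G : ℕ → ℝ → ℝ}
    (hG : IsDerivChain (j + 2) 1 G)
    (hT : ∀ i, 1 ≤ i → i ≤ j + 2 → ∀ x ∈ Set.Icc (0 : ℝ) 1, |G i x| ≤ T)
    {x : ℝ} (hx : x ∈ Set.Icc (0 : ℝ) 1) :
    |G j x - bernsteinDeriv k (fun ν => G 0 ((ν : ℝ) / k)) j x| ≤ 2 * ((j : ℝ) + 1) ^ 2 * T / k := by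
  have hk0 : (0 : ℝ) < k := Nat.cast_pos.2 hk
  have hj0 : (0 : ℝ) ≤ j := Nat.cast_nonneg j
  have hT0 : 0 ≤ T := (abs_nonneg _).trans (hT 1 le_rfl (by omega) x hx)
  rcases lt_or_ge k j with hkj | hjk
  -- The derivative of the polynomial vanishes here, and `|G j x| ≤ T` is enough because `k ≤ j`.
  · have hkj' : (k : ℝ) ≤ j := Nat.cast_le.2 hkj.le
    rw [bernsteinDeriv, Nat.descFactorial_of_lt hkj, Nat.cast_zero, zero_mul, sub_zero,
      le_div_iff₀ hk0]
    have := hT j (by omega) (by omega) x hx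
    nlinarith [mul_le_mul this hkj' hk0.le hT0, mul_nonneg hT0 hj0, mul_nonneg (mul_nonneg hT0 hj0) hj0]
  set n := k - j with hn
  have hnk : (n : ℝ) = k - j := by rw [hn, Nat.cast_sub hjk]
  set c : ℕ → ℝ := fun ν => G 0 ((ν : ℝ) / k) with hc
  set ρ : ℝ := k.descFactorial j / (k : ℝ) ^ j with hρ
  have hkj : (0 : ℝ) < (k : ℝ) ^ j := pow_pos hk0 j
  have hρ0 : 0 ≤ ρ := by positivity
  have hρ1 : ρ ≤ 1 := by
    rw [hρ, div_le_one hkj]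
    exact_mod_cast Nat.descFactorial_le_pow k j
  have hρ2 : 1 - ρ ≤ (j : ℝ) ^ 2 / k := by
    rw [le_div_iff₀ hk0, hρ, sub_mul, one_mul, div_mul_eq_mul_div, sub_le_iff_le_add,
      ← sub_le_iff_le_add', le_div_iff₀ hkj]
    have := pow_sub_descFactorial_le k j
    rw [pow_succ] at this
    linarith
  have hle : ∀ ν ≤ n, ν ≤ k := fun ν hν => by omega
  -- The comparison passes from the derivative to `ρ * S`, then to `S`, then to `G j x`; each of the
  -- three steps costs `O(T / k)`.
  set S := ∑ ν ∈ Finset.range (n + 1), G j ((ν : ℝ) / k) * bernsteinBasis n ν x with hS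
  -- finite differences against derivatives
  have hA : |bernsteinDeriv k c j x - ρ * S| ≤ j * T / k := by
    have h1 : bernsteinDeriv k c j x - ρ * S = ρ * ∑ ν ∈ Finset.range (n + 1),
        ((k : ℝ) ^ j * (fwdDiff 1)^[j] c ν - G j ((ν : ℝ) / k)) * bernsteinBasis n ν x := by
      simp only [sub_mul]
      rw [Finset.sum_sub_distrib, mul_sub, ← hS, bernsteinDeriv, ← hn]
      simp only [mul_assoc]
      rw [← Finset.mul_sum, ← mul_assoc, hρ, div_mul_cancel₀ _ hkj.ne']
    rw [h1, abs_mul, abs_of_nonneg hρ0]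
    refine (mul_le_of_le_one_left (abs_nonneg _) hρ1).trans
      (abs_sum_mul_bernsteinBasis_le (fun ν hν => ?_) hx)
    have hνk : (ν : ℝ) + j ≤ k := by
      rw [hn] at hν
      exact_mod_cast (by omega : ν + j ≤ k)
    have h2 := abs_fwdDiff_iterate_sub_le (h := 1 / (k : ℝ)) (by positivity) j (b := 1) (T := T)
      (G := G) (fun i hi => hG i (by omega)) (hT (j + 1) (by omega) (by omega))
      (p := (ν : ℝ) / k) (by positivity)
      (by rw [mul_one_div, ← add_div, div_le_one hk0]; exact hνk)
    rw [hc, fwdDiff_iterate_comp_natCast_div]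
    have h3 := mul_le_mul_of_nonneg_left h2 hkj.le
    rw [← abs_of_pos hkj, ← abs_mul, abs_of_pos hkj, mul_sub, ← mul_assoc, ← mul_pow,
      mul_one_div_cancel hk0.ne', one_pow, one_mul] at h3
    refine h3.trans (le_of_eq ?_)
    rw [pow_succ, one_div, inv_pow]
    field_simp
  -- the leading factor
  have hB : |S - ρ * S| ≤ j ^ 2 * T / k := by
    rcases Nat.eq_zero_or_pos j with rfl | hj
    · simp [hρ]
    · have : |S| ≤ T := abs_sum_mul_bernsteinBasis_le (fun ν hν =>
        hT j hj (by omega) _ (natCast_div_mem_Icc (hle ν hν))) hx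
      rw [show S - ρ * S = (1 - ρ) * S by ring, abs_mul, abs_of_nonneg (sub_nonneg.2 hρ1),
        mul_div_right_comm]
      exact mul_le_mul hρ2 this (abs_nonneg _) (by positivity)
  -- the expectation
  have hmean : ∑ ν ∈ Finset.range (n + 1), ((ν : ℝ) / k - x) * bernsteinBasis n ν x =
      -(j * x) / k := by
    simp only [sub_mul, div_mul_eq_mul_div]
    rw [Finset.sum_sub_distrib, ← Finset.sum_div, sum_mul_bernsteinBasis, ← Finset.mul_sum,
      sum_bernsteinBasis, hnk]
    field_simp
    ring
  have hvar : ∑ ν ∈ Finset.range (n + 1), ((ν : ℝ) / k - x) ^ 2 * bernsteinBasis n ν x =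
      (n * x * (1 - x) + (j * x) ^ 2) / k ^ 2 := by
    have hs : ∀ ν ∈ Finset.range (n + 1), ((ν : ℝ) / k - x) ^ 2 * bernsteinBasis n ν x =
        ((ν - n * x) ^ 2 * bernsteinBasis n ν x - 2 * (j * x) * (ν * bernsteinBasis n ν x) +
          (2 * (j * x) * n * x + (j * x) ^ 2) * bernsteinBasis n ν x) / k ^ 2 := fun ν _ => by
      have hkn : (k : ℝ) = n + j := by linarith
      rw [div_sub' hk0.ne', div_pow, div_mul_eq_mul_div]
      congr 1
      rw [hkn]
      ring
    rw [Finset.sum_congr rfl hs, ← Finset.sum_div, Finset.sum_add_distrib, Finset.sum_sub_distrib,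
      sum_sq_mul_bernsteinBasis, ← Finset.mul_sum, ← Finset.mul_sum, sum_mul_bernsteinBasis,
      sum_bernsteinBasis]
    congr 1
    ring
  have hC : |S - G j x| ≤ (j + 1 + j ^ 2) * T / k := by
    -- Nodes of mesh `1/k` are averaged with weights of degree `n = k - j`, so their mean is `n x /
    -- k`: the linear Taylor term leaves a bias, paid for by the bound on `G (j + 1)`.
    have h1 : S - G j x = ∑ ν ∈ Finset.range (n + 1), (G j ((ν : ℝ) / k) - G j x -
        G (j + 1) x * ((ν : ℝ) / k - x)) * bernsteinBasis n ν x + G (j + 1) x * (-(j * x) / k) := by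
      have h0 : G j x = ∑ ν ∈ Finset.range (n + 1), G j x * bernsteinBasis n ν x := by
        rw [← Finset.mul_sum, sum_bernsteinBasis, mul_one]
      rw [← hmean, Finset.mul_sum, ← Finset.sum_add_distrib, hS]
      conv_lhs => rw [h0]
      rw [← Finset.sum_sub_distrib]
      exact Finset.sum_congr rfl fun ν _ => by ring
    have h2 : |∑ ν ∈ Finset.range (n + 1), (G j ((ν : ℝ) / k) - G j x -
        G (j + 1) x * ((ν : ℝ) / k - x)) * bernsteinBasis n ν x| ≤ T * ((1 + j ^ 2) / k) := by
      calc _ ≤ ∑ ν ∈ Finset.range (n + 1), T * (((ν : ℝ) / k - x) ^ 2 * bernsteinBasis n ν x) := by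
            refine (Finset.abs_sum_le_sum_abs _ _).trans (Finset.sum_le_sum fun ν hν => ?_)
            have hνn := Nat.lt_succ_iff.1 (Finset.mem_range.1 hν)
            rw [abs_mul, abs_of_nonneg (bernsteinBasis_nonneg n ν hx), ← mul_assoc]
            refine mul_le_mul_of_nonneg_right ?_ (bernsteinBasis_nonneg n ν hx)
            exact abs_taylor_two_le (hG j (by omega)) (hG (j + 1) (by omega))
              (hT (j + 2) (by omega) le_rfl) hx (natCast_div_mem_Icc (hle ν hνn))
        _ ≤ _ := by
            rw [← Finset.mul_sum, hvar]
            refine mul_le_mul_of_nonneg_left ?_ hT0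
            rw [div_le_div_iff₀ (by positivity) hk0]
            have hk1 : (1 : ℝ) ≤ k := Nat.one_le_cast.2 hk
            have hxx : x * (1 - x) ≤ 1 := by nlinarith [hx.1, hx.2, sq_nonneg x]
            have hxx0 : 0 ≤ x * (1 - x) := mul_nonneg hx.1 (sub_nonneg.2 hx.2)
            have h3 : n * x * (1 - x) ≤ k := by nlinarith
            have h4 : (j * x) ^ 2 ≤ (j : ℝ) ^ 2 * k := by
              rw [mul_pow]
              have : x ^ 2 ≤ 1 := pow_le_one₀ hx.1 hx.2
              nlinarith [sq_nonneg (j : ℝ)]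
            nlinarith
    have h3 : |G (j + 1) x * (-(j * x) / k)| ≤ T * (j / k) := by
      rw [abs_mul, neg_div, abs_neg, abs_div, abs_of_pos hk0,
        abs_of_nonneg (mul_nonneg hj0 hx.1)]
      exact mul_le_mul (hT _ (by omega) (by omega) x hx) (by gcongr; exact mul_le_of_le_one_right hj0 hx.2)
        (by have := hx.1; positivity) hT0
    rw [h1]
    refine (abs_add_le _ _).trans ((add_le_add h2 h3).trans (le_of_eq ?_))
    ring
  have hsum : G j x - bernsteinDeriv k c j x =
      -(S - G j x) + (S - ρ * S) - (bernsteinDeriv k c j x - ρ * S) := by ring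
  rw [hsum]
  have h1 := abs_sub (-(S - G j x) + (S - ρ * S)) (bernsteinDeriv k c j x - ρ * S)
  have h2 := abs_add_le (-(S - G j x)) (S - ρ * S)
  rw [abs_neg] at h2
  refine (h1.trans (add_le_add (h2.trans (add_le_add hC hB)) hA)).trans ?_
  rw [← add_div, ← add_div]
  refine div_le_div_of_nonneg_right ?_ hk0.le
  nlinarith [mul_nonneg hj0 hT0]

/-- The `h`-th power of the error operator of Bernstein approximation is of order `k ^ (-h)` on
functions whose derivatives up to the order `2 h` are bounded. -/
def HasPowerRate (h : ℕ) (C : ℝ) (i₀ : ℕ) : Prop :=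
  ∀ (k : ℕ) (T : ℝ) (G : ℕ → ℝ → ℝ), 0 < k → 0 ≤ T → IsDerivChain (2 * h) 1 G →
    (∀ i, i₀ ≤ i → i ≤ 2 * h → ∀ x ∈ Set.Icc (0 : ℝ) 1, |G i x| ≤ T) →
    ∀ x ∈ Set.Icc (0 : ℝ) 1, |((1 - bernsteinEnd k) ^ h) (G 0) x| ≤ C * T / k ^ h

/-- The rate of order `h` is applied to `G 0 - B (G 0)`, whose derivatives up to order `2h` are `O(T
/ k)` by simultaneous approximation. That estimate uses bounds on derivatives of order at least `1`
only, so the size of `G 0` itself does not enter. -/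
theorem HasPowerRate.succ {h : ℕ} {C : ℝ} (H : HasPowerRate h C 0) :
    HasPowerRate (h + 1) (C * (2 * (2 * h + 1) ^ 2)) 1 := by
  intro k T G hk hT0 hG hT x hx
  have hk0 : (0 : ℝ) < k := Nat.cast_pos.2 hk
  have h1 := H k (2 * (2 * h + 1) ^ 2 * T / k)
    (fun j x => G j x - bernsteinDeriv k (fun ν => G 0 ((ν : ℝ) / k)) j x) hk (by positivity)
    (fun j hj x hx => (hG j (by omega) x hx).sub
      (hasDerivAt_bernsteinDeriv k _ j x).hasDerivWithinAt)
    (fun j _ hj x hx => (abs_sub_bernsteinDeriv_le hk (fun i hi => hG i (by omega))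
      (fun i h1i hi => hT i h1i (by omega)) hx).trans (by
        have : (j : ℝ) ≤ 2 * h := by exact_mod_cast hj
        gcongr)) x hx
  have h2 : (fun x => G 0 x - bernsteinDeriv k (fun ν => G 0 ((ν : ℝ) / k)) 0 x) =
      (1 - bernsteinEnd k) (G 0) := by
    ext x
    simp [bernsteinDeriv, bernsteinEnd_apply]
  rw [h2] at h1
  rw [pow_succ]
  refine h1.trans (le_of_eq ?_)
  rw [pow_succ]
  field_simp
  ring

theorem exists_hasPowerRate_zero (h : ℕ) : ∃ C : ℝ, 0 ≤ C ∧ HasPowerRate h C 0 := by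
  induction h with
  | zero =>
    exact ⟨1, zero_le_one, fun k T G _ _ _ hT x hx => by simpa using hT 0 le_rfl le_rfl x hx⟩
  | succ h ih =>
    obtain ⟨C, hC, H⟩ := ih
    exact ⟨C * (2 * (2 * h + 1) ^ 2), by positivity, fun k T G hk hT0 hG hT =>
      H.succ k T G hk hT0 hG fun i _ => hT i (Nat.zero_le i)⟩

theorem exists_hasPowerRate_one {h : ℕ} (hh : 0 < h) : ∃ C : ℝ, 0 ≤ C ∧ HasPowerRate h C 1 := by
  obtain ⟨h, rfl⟩ := Nat.exists_eq_succ_of_ne_zero hh.ne'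
  obtain ⟨C, hC, H⟩ := exists_hasPowerRate_zero h
  exact ⟨_, by positivity, H.succ⟩

/-! ### Univariate sections -/

theorem uniqueDiffOn_cube (ℓ : ℕ) : UniqueDiffOn ℝ (cube ℓ) := by
  have : cube ℓ = Set.univ.pi fun _ => Set.Icc (0 : ℝ) 1 := by
    rw [cube, ← Set.pi_univ_Icc]
    rfl
  rw [this]
  exact UniqueDiffOn.univ_pi fun _ => uniqueDiffOn_Icc one_pos

theorem update_mem_cube {ℓ : ℕ} {y : Fin ℓ → ℝ} (hy : y ∈ cube ℓ) (i : Fin ℓ) {t : ℝ}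
    (ht : t ∈ Set.Icc (0 : ℝ) 1) : Function.update y i t ∈ cube ℓ := by
  refine ⟨fun j => ?_, fun j => ?_⟩ <;> rcases eq_or_ne j i with rfl | hj
  · simpa using ht.1
  · simpa [hj] using hy.1 j
  · simpa using ht.2
  · simpa [hj] using hy.2 j

/-- Chain rule along a line parallel to the `i`-th axis: the new direction `Pi.single i 1` becomes
the first argument of the next iterated derivative. -/
theorem IsSmooth.isDerivChain {ℓ m : ℕ} {T : ℝ} {f : (Fin ℓ → ℝ) → ℝ} (hf : IsSmooth m T f)
    {y : Fin ℓ → ℝ} (hy : y ∈ cube ℓ) (i : Fin ℓ) :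
    IsDerivChain m 1 fun j t =>
      iteratedFDerivWithin ℝ j f (cube ℓ) (Function.update y i t) fun _ => Pi.single i 1 := by
  intro j hj t ht
  have h1 := (hf.1.differentiableOn_iteratedFDerivWithin (m := j) (by exact_mod_cast hj)
    (uniqueDiffOn_cube ℓ) _ (update_mem_cube hy i ht)).hasFDerivWithinAt
  have h2 := h1.comp_hasDerivWithinAt t (hasDerivAt_update y i t).hasDerivWithinAt
    (s := Set.Icc 0 1) fun s hs => update_mem_cube hy i hs
  have h3 := (ContinuousMultilinearMap.apply ℝ (fun _ : Fin j => Fin ℓ → ℝ) ℝ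
    fun _ => Pi.single i 1).hasFDerivAt.comp_hasDerivWithinAt t h2
  refine h3.congr_deriv ?_
  beta_reduce
  rw [iteratedFDerivWithin_succ_apply_left]
  rfl

theorem exists_abs_bernsteinEval_sub_le_of_isSmooth (ℓ : ℕ) {h : ℕ} (hh : 0 < h) {T : ℝ}
    (hT : 0 ≤ T) : ∃ C : ℝ, 0 ≤ C ∧ ∀ (k : ℕ), 0 < k → ∀ f : (Fin ℓ → ℝ) → ℝ,
      IsSmooth (2 * h) T f → ∀ y ∈ cube ℓ,
        |bernsteinEval h (fun ν : LatticeIdx ℓ k => f (latticePoint ν)) y - f y| ≤ C / k ^ h := by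
  obtain ⟨C, hC, H⟩ := exists_hasPowerRate_one hh
  refine ⟨ℓ * (2 ^ h) ^ ℓ * (C * T), by positivity, fun k hk f hf y hy => ?_⟩
  rw [mul_div_assoc]
  refine abs_bernsteinEval_sub_le h k (by positivity) (fun i y hy => ?_) hy
  have := H k T _ hk hT (hf.isDerivChain hy i)
    (fun j hj1 hj t ht => hf.2 j hj1 hj (fun _ => i) _ (update_mem_cube hy i ht)) (y i)
    ⟨hy.1 i, hy.2 i⟩
  simpa using this

/-- A quadratic majorant at scale `δ`: it reduces the Hölder modulus to the variance. -/
theorem rpow_abs_le {d δ γ : ℝ} (hδ : 0 < δ) (hγ : 0 < γ) (hγ1 : γ ≤ 1) :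
    |d| ^ γ ≤ δ ^ γ * (1 + d ^ 2 / δ ^ 2) := by
  have h0 : 0 ≤ |d| / δ := by positivity
  have h1 : |d| ^ γ = δ ^ γ * (|d| / δ) ^ γ := by
    rw [← Real.mul_rpow hδ.le h0, mul_div_cancel₀ _ hδ.ne']
  rw [h1, ← sq_abs d, ← div_pow]
  refine mul_le_mul_of_nonneg_left ?_ (by positivity)
  rcases le_total (|d| / δ) 1 with h | h
  · exact (Real.rpow_le_one h0 h hγ.le).trans (le_add_of_nonneg_right (sq_nonneg _))
  · have := Real.rpow_le_rpow_of_exponent_le h hγ1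
    rw [Real.rpow_one] at this
    nlinarith

theorem abs_bernsteinEnd_sub_le_of_holder {k : ℕ} (hk : 0 < k) {γ L : ℝ} (hγ : 0 < γ)
    (hγ1 : γ ≤ 1) (hL : 0 ≤ L) {g : ℝ → ℝ}
    (hg : ∀ x ∈ Set.Icc (0 : ℝ) 1, ∀ z ∈ Set.Icc (0 : ℝ) 1, |g x - g z| ≤ L * |x - z| ^ γ)
    {x : ℝ} (hx : x ∈ Set.Icc (0 : ℝ) 1) :
    |(1 - bernsteinEnd k) g x| ≤ 2 * L * (k : ℝ) ^ (-(γ / 2)) := by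
  have hk0 : (0 : ℝ) < k := Nat.cast_pos.2 hk
  -- The order of the standard deviation of the nodes around `x`.
  set δ : ℝ := (k : ℝ) ^ (-(1 / 2 : ℝ)) with hδ
  have hδ0 : 0 < δ := Real.rpow_pos_of_pos hk0 _
  have hδ2 : δ ^ 2 = 1 / k := by
    rw [hδ, ← Real.rpow_natCast, ← Real.rpow_mul hk0.le]
    norm_num
    rw [Real.rpow_neg_one]
  have hδγ : δ ^ γ = (k : ℝ) ^ (-(γ / 2)) := by
    rw [hδ, ← Real.rpow_mul hk0.le]
    congr 1
    ring
  have h1 : (1 - bernsteinEnd k) g x = ∑ ν ∈ Finset.range (k + 1),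
      (g x - g ((ν : ℝ) / k)) * bernsteinBasis k ν x := by
    simp only [sub_mul]
    rw [Finset.sum_sub_distrib, ← Finset.mul_sum, sum_bernsteinBasis, mul_one,
      ← bernsteinEnd_apply]
    rfl
  have hvar : ∑ ν ∈ Finset.range (k + 1), (x - (ν : ℝ) / k) ^ 2 * bernsteinBasis k ν x =
      x * (1 - x) / k := by
    have hs : ∀ ν ∈ Finset.range (k + 1), (x - (ν : ℝ) / k) ^ 2 * bernsteinBasis k ν x =
        (ν - k * x) ^ 2 * bernsteinBasis k ν x / k ^ 2 := fun ν _ => by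
      field_simp
      ring
    rw [Finset.sum_congr rfl hs, ← Finset.sum_div, sum_sq_mul_bernsteinBasis]
    field_simp
  rw [h1]
  calc _ ≤ ∑ ν ∈ Finset.range (k + 1), (L * δ ^ γ * bernsteinBasis k ν x +
        L * δ ^ γ * k * ((x - (ν : ℝ) / k) ^ 2 * bernsteinBasis k ν x)) := by
        refine (Finset.abs_sum_le_sum_abs _ _).trans (Finset.sum_le_sum fun ν hν => ?_)
        have hνk := Nat.lt_succ_iff.1 (Finset.mem_range.1 hν)
        have hb := bernsteinBasis_nonneg k ν hx
        rw [abs_mul, abs_of_nonneg hb]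
        have h2 := (hg x hx _ (natCast_div_mem_Icc hνk)).trans
          (mul_le_mul_of_nonneg_left (rpow_abs_le hδ0 hγ hγ1) hL)
        refine (mul_le_mul_of_nonneg_right h2 hb).trans (le_of_eq ?_)
        rw [hδ2]
        field_simp
    _ = L * δ ^ γ * (1 + x * (1 - x)) := by
        rw [Finset.sum_add_distrib, ← Finset.mul_sum, ← Finset.mul_sum, hvar, sum_bernsteinBasis]
        field_simp
    _ ≤ L * δ ^ γ * 2 := by
        refine mul_le_mul_of_nonneg_left ?_ (by positivity)
        nlinarith [hx.1, hx.2, sq_nonneg x]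
    _ = _ := by rw [hδγ]; ring

/-- One factor `1 - B` uses the regularity and every other one costs a factor `2`. The order `h`
therefore affects the constant but not the rate. -/
theorem abs_bernsteinEval_sub_le_of_isHolder {ℓ h k : ℕ} (hh : 0 < h) (hk : 0 < k) {γ L : ℝ}
    (hγ : 0 < γ) (hγ1 : γ ≤ 1) (hL : 0 ≤ L) {f : (Fin ℓ → ℝ) → ℝ} (hf : IsHolder γ L f)
    {y : Fin ℓ → ℝ} (hy : y ∈ cube ℓ) :
    |bernsteinEval h (fun ν : LatticeIdx ℓ k => f (latticePoint ν)) y - f y| ≤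
      ℓ * (2 ^ h) ^ ℓ * 2 ^ h * L * (k : ℝ) ^ (-(γ / 2)) := by
  obtain ⟨h, rfl⟩ := Nat.exists_eq_succ_of_ne_zero hh.ne'
  refine (abs_bernsteinEval_sub_le (h + 1) k (δ := 2 ^ h * (2 * L * (k : ℝ) ^ (-(γ / 2))))
    (by positivity) (fun i y hy => ?_) hy).trans (le_of_eq ?_)
  · rw [pow_succ]
    refine abs_one_sub_bernsteinEnd_pow_le k h (fun x hx =>
      abs_bernsteinEnd_sub_le_of_holder hk hγ hγ1 hL (fun x hx z hz => ?_) hx) ⟨hy.1 i, hy.2 i⟩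
    refine (hf _ (update_mem_cube hy i hx) _ (update_mem_cube hy i hz)).trans
      (mul_le_mul_of_nonneg_left (Real.rpow_le_rpow (norm_nonneg _) ?_ hγ.le) hL)
    refine (pi_norm_le_iff_of_nonneg (abs_nonneg _)).2 fun j => ?_
    rcases eq_or_ne j i with rfl | hj
    · simp
    · simp [hj]
  · simp only [Nat.succ_eq_add_one, pow_succ]
    ring

/-- Sections of `f` are affine and `1 - B` kills affine functions on the interval, by the mean of
the binomial law; the multivariate error bound then holds with `δ = 0`. -/
theorem bernsteinEval_of_isLinearOnCube {ℓ h k : ℕ} (hh : 0 < h) (hk : 0 < k)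
    {f : (Fin ℓ → ℝ) → ℝ} (hf : IsLinearOnCube f) {y : Fin ℓ → ℝ} (hy : y ∈ cube ℓ) :
    bernsteinEval h (fun ν : LatticeIdx ℓ k => f (latticePoint ν)) y = f y := by
  obtain ⟨h, rfl⟩ := Nat.exists_eq_succ_of_ne_zero hh.ne'
  obtain ⟨a, c, hf⟩ := hf
  have hk0 : (0 : ℝ) < k := Nat.cast_pos.2 hk
  have := abs_bernsteinEval_sub_le (h + 1) k (f := f) le_rfl (fun i y hy => ?_) hy
  · rwa [mul_zero, abs_nonpos_iff, sub_eq_zero] at this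
  · rw [pow_succ]
    refine (abs_one_sub_bernsteinEnd_pow_le k h (W := 0) (fun x hx => ?_)
      ⟨hy.1 i, hy.2 i⟩).trans (by simp)
    have hg : ∀ t ∈ Set.Icc (0 : ℝ) 1, f (Function.update y i t) =
        a i * t + (f y - a i * y i) := fun t ht => by
      have h1 : ∑ j, a j * Function.update y i t j - ∑ j, a j * y j = a i * (t - y i) := by
        rw [← Finset.sum_sub_distrib, Finset.sum_eq_single i]
        · rw [Function.update_self]
          ring
        · intro j _ hj
          rw [Function.update_of_ne hj, sub_self]
        · simp
      rw [hf _ (update_mem_cube hy i ht), hf y hy]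
      linarith
    have h1 : (1 - bernsteinEnd k) (fun t => f (Function.update y i t)) x =
        ∑ ν ∈ Finset.range (k + 1), (a i * x * bernsteinBasis k ν x -
          a i / k * (ν * bernsteinBasis k ν x)) := by
      have h2 : (1 - bernsteinEnd k) (fun t => f (Function.update y i t)) x =
          f (Function.update y i x) * ∑ ν ∈ Finset.range (k + 1), bernsteinBasis k ν x -
            ∑ ν ∈ Finset.range (k + 1), f (Function.update y i ((ν : ℝ) / k)) *
              bernsteinBasis k ν x := by
        rw [sum_bernsteinBasis, mul_one]
        rfl
      rw [h2, Finset.mul_sum, ← Finset.sum_sub_distrib]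
      refine Finset.sum_congr rfl fun ν hν => ?_
      rw [hg x hx, hg _ (natCast_div_mem_Icc (Nat.lt_succ_iff.1 (Finset.mem_range.1 hν)))]
      ring
    rw [h1, Finset.sum_sub_distrib, ← Finset.mul_sum, ← Finset.mul_sum, sum_bernsteinBasis,
      sum_mul_bernsteinBasis, abs_nonpos_iff]
    field_simp
    ring

/-! ### Accuracy of the mechanism -/

/-- The evaluation of pure noise is bounded on the cube with high probability, uniformly in the
cover size. -/
theorem exists_noise_bound (ℓ h : ℕ) {β₀ : ℝ} (hβ₀ : 0 < β₀) (hβ₀1 : β₀ < 1) :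
    ∃ C : ℝ, 0 < C ∧ ∀ (k : ℕ) (β : ℝ), 0 < β → β ≤ β₀ → ENNReal.ofReal (1 - β) ≤
      (Measure.pi fun _ : LatticeIdx ℓ k => laplaceMeasure 1)
        {z | ∀ y ∈ cube ℓ, |bernsteinEval h z y| ≤ C * Real.log (1 / β)} := by
  obtain ⟨C₁, hC₁, H⟩ := exists_measureReal_boxSum_le ℓ
  set l₀ := Real.log (1 / β₀) with hl₀
  have hl₀0 : 0 < l₀ := Real.log_pos (by rw [lt_div_iff₀ hβ₀]; linarith)
  -- The term `1 / l₀` gives `c l ≥ 1`; the other one gives `C₁ exp (-c l / 4) ≤ exp (-l) = β`. Both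
  -- rely on `l ≥ l₀ > 0`, that is, on `β` staying away from `1`.
  set c : ℝ := 4 * (1 + |Real.log C₁| / l₀) + 1 / l₀ with hc
  have hc0 : 0 < c := by positivity
  refine ⟨(2 ^ h) ^ ℓ * (c * 8 ^ ℓ), by positivity, fun k β hβ hββ₀ => ?_⟩
  set l := Real.log (1 / β) with hl
  have hll : l₀ ≤ l := Real.log_le_log (by positivity) (one_div_le_one_div_of_le hβ hββ₀)
  have hu : 1 ≤ c * l := by
    have h1 : 1 / l₀ ≤ c := by
      rw [hc]; exact le_add_of_nonneg_left (by positivity)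
    calc (1 : ℝ) = 1 / l₀ * l₀ := by field_simp
      _ ≤ c * l := mul_le_mul h1 hll hl₀0.le hc0.le
  have hbad : C₁ * Real.exp (-(c * l) / 4) ≤ β := by
    have hβe : β = Real.exp (-l) := by
      rw [hl, one_div, Real.log_inv, neg_neg, Real.exp_log hβ]
    rw [hβe]
    nth_rewrite 1 [← Real.exp_log hC₁]
    rw [← Real.exp_add, Real.exp_le_exp]
    have h1 : |Real.log C₁| ≤ |Real.log C₁| / l₀ * l := by
      rw [div_mul_eq_mul_div, le_div_iff₀ hl₀0]
      exact mul_le_mul_of_nonneg_left hll (abs_nonneg _)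
    have h2 : 4 * (1 + |Real.log C₁| / l₀) * l ≤ c * l := by
      refine mul_le_mul_of_nonneg_right ?_ (hl₀0.le.trans hll)
      rw [hc]; exact le_add_of_nonneg_right (by positivity)
    have := le_abs_self (Real.log C₁)
    nlinarith
  set bad := {z : LatticeIdx ℓ k → ℝ | ∃ p : Fin ℓ → Fin (k + 2) × Fin (k + 2),
    c * l * ∏ i, boxWeight (k + 1) (p i).1 (p i).2 < |boxSum z p|}
  have hbad' := (H k (c * l) hu).trans hbad
  have hsub : badᶜ ⊆ {z | ∀ y ∈ cube ℓ,
      |bernsteinEval h z y| ≤ (2 ^ h) ^ ℓ * (c * 8 ^ ℓ) * l} := by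
    intro z hz y hy
    have hz' : ∀ p : Fin ℓ → Fin (k + 2) × Fin (k + 2),
        |boxSum z p| ≤ c * l * ∏ i, boxWeight (k + 1) (p i).1 (p i).2 := fun p =>
      not_lt.1 fun h => hz ⟨p, h⟩
    have h1 := abs_sum_mul_prod_iterBasis_le h k (W := c * l * 8 ^ ℓ) (by positivity)
      (fun y hy => abs_sum_mul_prod_bernsteinBasis_le (by linarith) hz' hy) hy
    refine h1.trans (le_of_eq ?_)
    ring
  refine le_trans ?_ (measure_mono hsub)
  -- Subadditivity gives this direction without measurability of the bad event.
  have h1 : (1 : ENNReal) ≤ (Measure.pi fun _ : LatticeIdx ℓ k => laplaceMeasure 1) badᶜ +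
      ENNReal.ofReal β := by
    calc (1 : ENNReal) = (Measure.pi fun _ : LatticeIdx ℓ k => laplaceMeasure 1)
          (badᶜ ∪ bad) := by rw [Set.compl_union_self, measure_univ]
      _ ≤ _ := (measure_union_le _ _).trans (by
        gcongr
        rw [← ofReal_measureReal]
        exact ENNReal.ofReal_le_ofReal hbad')
  rw [ENNReal.ofReal_sub _ hβ.le, ENNReal.ofReal_one]
  exact tsub_le_iff_right.2 h1

theorem bernsteinEval_add_mul {ℓ k : ℕ} (h : ℕ) (v z : LatticeIdx ℓ k → ℝ) (lam : ℝ)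
    (y : Fin ℓ → ℝ) : bernsteinEval h (fun ν => v ν + lam * z ν) y =
      bernsteinEval h v y + lam * bernsteinEval h z y := by
  simp only [bernsteinEval, add_mul, Finset.sum_add_distrib, Finset.mul_sum, mul_assoc]

/-- Accuracy of the mechanism, in terms of the error of the noiseless approximation. -/
theorem exists_isAccurate (ℓ h : ℕ) {β₀ : ℝ} (hβ₀1 : β₀ < 1) :
    ∃ C : ℝ, 0 < C ∧ ∀ (k n : ℕ) (X : Type u) (F : (Fin n → X) → (Fin ℓ → ℝ) → ℝ)
      (ε β A α : ℝ), 0 < ε → 0 < β → β ≤ β₀ →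
      (∀ D, ∀ y ∈ cube ℓ,
        |bernsteinEval h (fun ν : LatticeIdx ℓ k => F D (latticePoint ν)) y - F D y| ≤ A) →
      A + C * (((k : ℝ) + 1) ^ ℓ * errorScale (sensitivity F).toReal ε β) ≤ α →
      IsAccurate F h k ε α β := by
  -- The maximum with `1/2` provides a positive bound even if `β₀ ≤ 0`.
  obtain ⟨C, hC, H⟩ := exists_noise_bound ℓ h (β₀ := max β₀ (1 / 2)) (by positivity)
    (max_lt hβ₀1 (by norm_num))
  refine ⟨C, hC, fun k n X F ε β A α hε hβ hββ₀ hA hα D => ?_⟩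
  have hlam := noiseScale_nonneg ℓ k (ENNReal.toReal_nonneg (a := sensitivity F)) hε
  rw [bernsteinMechanism, noisyValues_eq_map k hlam]
  refine (H k β hβ (hββ₀.trans (le_max_left _ _))).trans
    -- A lower bound for the image measure needs no measurability of the event of accuracy.
    ((measure_mono fun z hz => ?_).trans (Measure.le_map_apply (measurable_pi_lambda _ fun ν =>
      ((measurable_pi_apply ν).const_mul _).const_add _).aemeasurable _))
  intro y hy
  rw [bernsteinEval_add_mul]
  have h1 := hA D y hy
  have h2 := mul_le_mul_of_nonneg_left (hz y hy) hlam
  have h3 : noiseScale ℓ k (sensitivity F).toReal ε * (C * Real.log (1 / β)) =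
      C * (((k : ℝ) + 1) ^ ℓ * errorScale (sensitivity F).toReal ε β) := by
    rw [noiseScale, errorScale]
    ring
  rw [add_sub_right_comm]
  refine (abs_add_le _ _).trans (le_trans (add_le_add h1 ?_) hα)
  rw [abs_mul, abs_of_nonneg hlam, ← h3]
  exact h2

theorem errorScale_pos {s ε β : ℝ} (hs : 0 < s) (hε : 0 < ε) (hβ : 0 < β) (hβ1 : β < 1) :
    0 < errorScale s ε β :=
  mul_pos (div_pos hs hε) (Real.log_pos (by rw [lt_div_iff₀ hβ]; linarith))

/-- The cover size `⌈x ^ (-p)⌉`, where `x` is the error scale. -/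
def coverSize (p s ε β : ℝ) : ℕ := max 1 ⌈errorScale s ε β ^ (-p)⌉₊

theorem coverSize_pos (p s ε β : ℝ) : 0 < coverSize p s ε β :=
  lt_of_lt_of_le one_pos (le_max_left _ _)

theorem rpow_le_coverSize (p s ε β : ℝ) : errorScale s ε β ^ (-p) ≤ coverSize p s ε β :=
  (Nat.le_ceil _).trans (Nat.cast_le.2 (le_max_right _ _))

theorem coverSize_le {p s ε β : ℝ} (hx : 0 < errorScale s ε β) :
    (coverSize p s ε β : ℝ) ≤ errorScale s ε β ^ (-p) + 1 := by
  have h0 := Real.rpow_nonneg hx.le (-p)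
  rw [coverSize, Nat.cast_max, Nat.cast_one]
  exact max_le (by linarith) (Nat.ceil_lt_add_one h0).le

/-- Here the bound `x ≤ M` enters: `1 ≤ x^(-p) M^p` absorbs the rounding in the cover size and the
extra `+ 1` into a multiple of `x^(-p)`. -/
theorem coverSize_add_one_pow_mul_le {p s ε β M : ℝ} (hp : 0 < p) (ℓ : ℕ)
    (hx : 0 < errorScale s ε β) (hM : errorScale s ε β ≤ M) :
    ((coverSize p s ε β : ℝ) + 1) ^ ℓ * errorScale s ε β ≤
      (1 + 2 * M ^ p) ^ ℓ * errorScale s ε β ^ (1 - p * ℓ) := by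
  have h1 := coverSize_le (p := p) hx
  set x := errorScale s ε β
  have h2 : (coverSize p s ε β : ℝ) + 1 ≤ x ^ (-p) * (1 + 2 * M ^ p) := by
    have h3 : 1 ≤ x ^ (-p) * M ^ p := by
      calc (1 : ℝ) = x ^ (-p) * x ^ p := by rw [← Real.rpow_add hx]; simp
        _ ≤ _ := mul_le_mul_of_nonneg_left (Real.rpow_le_rpow hx.le hM hp.le)
          (Real.rpow_nonneg hx.le _)
    linarith
  have h4 : (x ^ (-p)) ^ ℓ * x = x ^ (1 - p * ℓ) := by
    rw [← Real.rpow_natCast, ← Real.rpow_mul hx.le]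
    nth_rewrite 2 [← Real.rpow_one x]
    rw [← Real.rpow_add hx]
    congr 1
    ring
  calc _ ≤ (x ^ (-p) * (1 + 2 * M ^ p)) ^ ℓ * x := by gcongr
    _ = _ := by rw [mul_pow, ← h4]; ring

/-- The rate obtained by balancing the approximation error with the noise. -/
theorem hasErrorRate_coverSize {ℓ h : ℕ} {cls : ((Fin ℓ → ℝ) → ℝ) → Prop} {p r B : ℝ}
    (hp : 0 < p) (hr : 0 ≤ r) (hB : 0 ≤ B) (hpr : p * r = 1 - p * ℓ)
    (happ : ∀ k : ℕ, 0 < k → ∀ f, cls f → ∀ y ∈ cube ℓ,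
      |bernsteinEval h (fun ν : LatticeIdx ℓ k => f (latticePoint ν)) y - f y| ≤
        B * (k : ℝ) ^ (-r)) :
    HasErrorRate.{u} cls h (coverSize p) (p * r) := by
  intro β₀ M hβ₀
  obtain ⟨C, hC, H⟩ := exists_isAccurate.{u} ℓ h hβ₀
  refine ⟨B + C * (1 + 2 * (max M 1) ^ p) ^ ℓ, by positivity,
    fun n X F hcls _ hs ε β hε hβ hββ₀ hM => ?_⟩
  have hx := errorScale_pos hs hε hβ (hββ₀.trans_lt hβ₀)
  refine H _ n X F ε β _ _ hε hβ hββ₀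
    (fun D y hy => happ _ (coverSize_pos p _ ε β) _ (hcls D) y hy) ?_
  have h1 := coverSize_add_one_pow_mul_le hp ℓ hx (hM.trans (le_max_left M 1))
  have h2 : (coverSize p (sensitivity F).toReal ε β : ℝ) ^ (-r) ≤
      errorScale (sensitivity F).toReal ε β ^ (p * r) := by
    have h3 := Real.rpow_le_rpow_of_nonpos (Real.rpow_pos_of_pos hx (-p))
      (rpow_le_coverSize p (sensitivity F).toReal ε β) (neg_nonpos.2 hr)
    rwa [← Real.rpow_mul hx.le, neg_mul_neg] at h3
  rw [← hpr] at h1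
  rw [add_mul, mul_assoc]
  gcongr

/-- The exponent `p = 1 / (ℓ + h)` solves `p h = 1 - p ℓ`. -/
theorem hasErrorRate_isSmooth {ℓ h : ℕ} (hh : 0 < h) {T : ℝ} (hT : 0 < T) :
    HasErrorRate.{u} (ℓ := ℓ) (IsSmooth (2 * h) T) h (coverSize (1 / ((ℓ : ℝ) + h)))
      ((h : ℝ) / ((ℓ : ℝ) + h)) := by
  obtain ⟨B, hB, H⟩ := exists_abs_bernsteinEval_sub_le_of_isSmooth ℓ hh hT.le
  have hh0 : (0 : ℝ) < h := Nat.cast_pos.2 hh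
  have hlh : (0 : ℝ) < (ℓ : ℝ) + h := by positivity
  have := hasErrorRate_coverSize.{u} (ℓ := ℓ) (h := h) (cls := IsSmooth (2 * h) T)
    (p := 1 / ((ℓ : ℝ) + h)) (r := h) (B := B) (by positivity) hh0.le hB (by field_simp; ring)
    fun k hk f hf y hy => (H k hk f hf y hy).trans (le_of_eq (by
      rw [Real.rpow_neg (Nat.cast_nonneg k), Real.rpow_natCast, div_eq_mul_inv]))
  rwa [one_div_mul_eq_div] at this

/-- Balancing with `r = γ / 2` gives `p = 2 / (2 ℓ + γ)`, independent of `h`. -/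
theorem hasErrorRate_isHolder {ℓ h : ℕ} (hh : 0 < h) {γ L : ℝ} (hγ : 0 < γ) (hγ1 : γ ≤ 1)
    (hL : 0 < L) :
    HasErrorRate.{u} (ℓ := ℓ) (IsHolder γ L) h (coverSize (2 / (2 * (ℓ : ℝ) + γ)))
      (γ / (2 * (ℓ : ℝ) + γ)) := by
  have hlh : (0 : ℝ) < 2 * (ℓ : ℝ) + γ := by positivity
  have := hasErrorRate_coverSize.{u} (ℓ := ℓ) (h := h) (cls := IsHolder γ L)
    (p := 2 / (2 * (ℓ : ℝ) + γ)) (r := γ / 2) (B := ℓ * (2 ^ h) ^ ℓ * 2 ^ h * L)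
    (by positivity) (by positivity) (by positivity) (by field_simp; ring)
    fun k hk f hf y hy => abs_bernsteinEval_sub_le_of_isHolder hh hk hγ hγ1 hL.le hf hy
  rwa [show 2 / (2 * (ℓ : ℝ) + γ) * (γ / 2) = γ / (2 * (ℓ : ℝ) + γ) by field_simp] at this

theorem exists_isAccurate_of_isLinearOnCube {ℓ h : ℕ} (hh : 0 < h) {β₀ : ℝ} (hβ₀ : β₀ < 1) :
    ∃ C : ℝ, 0 < C ∧ ∀ (n : ℕ) (X : Type u) (F : (Fin n → X) → (Fin ℓ → ℝ) → ℝ),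
      (∀ D, IsLinearOnCube (F D)) → ∀ ε β : ℝ, 0 < ε → 0 < β → β ≤ β₀ →
        IsAccurate F h 1 ε (C * errorScale (sensitivity F).toReal ε β) β := by
  obtain ⟨C, hC, H⟩ := exists_isAccurate.{u} ℓ h hβ₀
  refine ⟨C * 2 ^ ℓ, by positivity, fun n X F hF ε β hε hβ hββ₀ => ?_⟩
  refine H 1 n X F ε β 0 _ hε hβ hββ₀ (fun D y hy => ?_) (le_of_eq ?_)
  · rw [bernsteinEval_of_isLinearOnCube hh one_pos (hF D) hy, sub_self, abs_zero]
  · push_cast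
    ring

/-! ### Polynomial running time -/

theorem runsInPolyTime_of_le {ℓ : ℕ} {san ev : Prog} {A : ℝ} {d : ℕ} (hA : 0 ≤ A)
    (hsan : ∀ (k : ℕ) (s ε : ℝ) (f : (Fin ℓ → ℝ) → ℝ) (ω : ℕ → ℝ),
      ((sanitizeRun san k s ε f ω).time : ℝ) ≤ A * ((k : ℝ) + 2) ^ d)
    (hev : ∀ (k : ℕ) (w : LatticeIdx ℓ k → ℝ) (y : Fin ℓ → ℝ),
      ((evaluateRun ev w y).time : ℝ) ≤ A * ((k : ℝ) + 2) ^ d)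
    {k : ℝ → ℝ → ℝ → ℕ}
    (hk : ∀ β₀ ε₀ : ℝ, β₀ < 1 → ∃ a b : ℝ, 0 ≤ b ∧ ∀ s ε β : ℝ, 0 < s → 0 < ε → ε ≤ ε₀ →
      0 < β → β ≤ β₀ → (k s ε β : ℝ) ≤ a + b * (1 / s)) :
    RunsInPolyTime.{u} ℓ san ev k := by
  intro β₀ ε₀ q hβ₀
  obtain ⟨a, b, hb, hk⟩ := hk β₀ ε₀ hβ₀
  refine ⟨MvPolynomial.C A * (MvPolynomial.C (a + 2) + MvPolynomial.C b *
    Polynomial.aeval (MvPolynomial.X 0) q) ^ d, fun n X F _ hs hq ε β hε hεε₀ hβ hββ₀ => ?_⟩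
  have heval : MvPolynomial.eval ![(n : ℝ), 1 / ε] (MvPolynomial.C A *
      (MvPolynomial.C (a + 2) + MvPolynomial.C b *
        Polynomial.aeval (MvPolynomial.X 0) q) ^ d) = A * (a + 2 + b * q.eval (n : ℝ)) ^ d := by
    have : MvPolynomial.eval ![(n : ℝ), 1 / ε] (Polynomial.aeval (MvPolynomial.X 0) q) =
        q.eval (n : ℝ) := by
      rw [Polynomial.aeval_def, Polynomial.hom_eval₂, Polynomial.eval]
      congr 1
      · ext x
        simp
      · simp
    simp only [map_mul, map_pow, map_add, MvPolynomial.eval_C, this]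
  have hle : A * ((k (sensitivity F).toReal ε β : ℝ) + 2) ^ d ≤
      A * (a + 2 + b * q.eval (n : ℝ)) ^ d := by
    have h1 := hk _ ε β hs hε hεε₀ hβ hββ₀
    have h2 := mul_le_mul_of_nonneg_left hq hb
    exact mul_le_mul_of_nonneg_left (pow_le_pow_left₀ (by positivity) (by linarith) d) hA
  rw [heval]
  exact ⟨fun D ω => (hsan _ _ _ _ _).trans hle, fun w y _ => (hev _ _ _).trans hle⟩

/-- Since `p ≤ 1`, `x^(-p) ≤ 1 + 1/x`, and `1/x = ε / (s log (1/β))` is largest at `ε = ε₀`, `β =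
β₀`. -/
theorem exists_coverSize_le {p : ℝ} (hp0 : 0 ≤ p) (hp : p ≤ 1) (β₀ ε₀ : ℝ) (hβ₀ : β₀ < 1) :
    ∃ a b : ℝ, 0 ≤ b ∧ ∀ s ε β : ℝ, 0 < s → 0 < ε → ε ≤ ε₀ → 0 < β → β ≤ β₀ →
      (coverSize p s ε β : ℝ) ≤ a + b * (1 / s) := by
  rcases le_or_gt ε₀ 0 with hε₀ | hε₀
  · exact ⟨0, 0, le_rfl, fun s ε β _ hε hεε₀ => absurd (hε.trans_le (hεε₀.trans hε₀)) (lt_irrefl _)⟩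
  rcases le_or_gt β₀ 0 with hβ₀0 | hβ₀0
  · exact ⟨0, 0, le_rfl, fun s ε β _ _ _ hβ hββ₀ =>
      absurd (hβ.trans_le (hββ₀.trans hβ₀0)) (lt_irrefl _)⟩
  have hl₀ : 0 < Real.log (1 / β₀) := Real.log_pos (by rw [lt_div_iff₀ hβ₀0]; linarith)
  refine ⟨2, ε₀ / Real.log (1 / β₀), by positivity, fun s ε β hs hε hεε₀ hβ hββ₀ => ?_⟩
  have hx := errorScale_pos hs hε hβ (hββ₀.trans_lt hβ₀)
  have h1 := coverSize_le (p := p) hx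
  have h2 : errorScale s ε β ^ (-p) ≤ 1 + (errorScale s ε β)⁻¹ := by
    rw [Real.rpow_neg_eq_inv_rpow]
    have hx' : 0 < (errorScale s ε β)⁻¹ := inv_pos.2 hx
    rcases le_total (errorScale s ε β)⁻¹ 1 with h | h
    · exact (Real.rpow_le_one hx'.le h hp0).trans (by linarith)
    · have := Real.rpow_le_rpow_of_exponent_le h hp
      rw [Real.rpow_one] at this
      linarith
  have h3 : (errorScale s ε β)⁻¹ ≤ ε₀ / Real.log (1 / β₀) * (1 / s) := by
    have hll : Real.log (1 / β₀) ≤ Real.log (1 / β) :=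
      Real.log_le_log (by positivity) (one_div_le_one_div_of_le hβ hββ₀)
    have : (errorScale s ε β)⁻¹ = ε / Real.log (1 / β) * (1 / s) := by
      rw [errorScale]
      field_simp
    rw [this]
    gcongr
  linarith

/-! ### Running time of programs whose loops are controlled by two fixed registers -/

/-- All loops of the program are controlled by the registers `0` and `1`, which it never changes. -/
def Prog.LoopsFixed : Prog → Prop
  | .setNat r _ => 2 ≤ r
  | .addNat r _ _ => 2 ≤ r
  | .subNat r _ _ => 2 ≤ r
  | .seq p q => p.LoopsFixed ∧ q.LoopsFixed
  | .ifLe _ _ p q => p.LoopsFixed ∧ q.LoopsFixed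
  | .loop r p => r < 2 ∧ p.LoopsFixed
  | _ => True

/-- An upper bound for the running time if all loops have at most `N` iterations. -/
def Prog.cost (N : ℕ) : Prog → ℕ
  | .seq p q => p.cost N + q.cost N
  | .ifLe _ _ p q => 1 + (p.cost N + q.cost N)
  | .loop _ p => 1 + N * (1 + p.cost N)
  | _ => 1

theorem exec_loop_induction {e : Env} {r : ℕ} {p : Prog} {c : Config} (Inv : ℕ → Config → Prop)
    (h0 : Inv 0 c.tick) (hs : ∀ t < c.nat r, ∀ d, Inv t d → Inv (t + 1) (exec e p d.tick)) :
    Inv (c.nat r) (exec e (.loop r p) c) := by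
  have : ∀ t ≤ c.nat r, Inv t ((fun d : Config => exec e p d.tick)^[t] c.tick) := by
    intro t ht
    induction t with
    | zero => exact h0
    | succ t ih =>
      rw [Function.iterate_succ_apply']
      exact hs t ht _ (ih (Nat.le_of_succ_le ht))
  exact this _ le_rfl

/-- The invariance of the two controlling registers must be proved together with the time bound: it
is what keeps `N` valid for every later loop. -/
theorem Prog.LoopsFixed.exec_spec {p : Prog} (hp : p.LoopsFixed) (e : Env) {N : ℕ} {c : Config}
    (h0 : c.nat 0 ≤ N) (h1 : c.nat 1 ≤ N) :
    (exec e p c).nat 0 = c.nat 0 ∧ (exec e p c).nat 1 = c.nat 1 ∧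
      (exec e p c).time ≤ c.time + p.cost N := by
  induction p generalizing c with
  | setNat r v | addNat r s t | subNat r s t =>
    have hr : 2 ≤ r := hp
    simp [exec, Config.putNat, Prog.cost, Function.update_of_ne (show 0 ≠ r by omega),
      Function.update_of_ne (show 1 ≠ r by omega)]
  | seq p q ihp ihq =>
    obtain ⟨a, b, t⟩ := ihp hp.1 h0 h1
    obtain ⟨a', b', t'⟩ := ihq hp.2 (c := exec e p c) (by omega) (by omega)
    simp only [exec, Prog.cost]
    omega
  | ifLe r s p q ihp ihq =>
    obtain ⟨a, b, t⟩ := ihp hp.1 (c := c.tick) h0 h1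
    obtain ⟨a', b', t'⟩ := ihq hp.2 (c := c.tick) h0 h1
    simp only [exec, Prog.cost]
    have ht : c.tick.time = c.time + 1 := rfl
    have hn : c.tick.nat = c.nat := rfl
    rw [hn] at a b a' b'
    split_ifs <;> omega
  | loop r p ih =>
    have hr : c.nat r ≤ N := by
      have : r = 0 ∨ r = 1 := by have := hp.1; omega
      rcases this with rfl | rfl <;> assumption
    have := exec_loop_induction (e := e) (r := r) (p := p) (c := c)
      (fun t d => d.nat 0 = c.nat 0 ∧ d.nat 1 = c.nat 1 ∧
        d.time ≤ c.time + 1 + t * (1 + p.cost N)) ⟨rfl, rfl, by simp [Config.tick]⟩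
      (fun t _ d hd => by
        obtain ⟨a, b, hd⟩ := hd
        obtain ⟨a', b', t'⟩ := ih hp.2 (c := d.tick) (by show d.nat 0 ≤ N; omega)
          (by show d.nat 1 ≤ N; omega)
        refine ⟨a'.trans a, b'.trans b, t'.trans ?_⟩
        have : d.tick.time = d.time + 1 := rfl
        rw [this, add_mul]
        omega)
    refine ⟨this.1, this.2.1, this.2.2.trans ?_⟩
    rw [Prog.cost, add_assoc]
    gcongr
  | _ => simp [exec, Config.put, Prog.cost]

theorem Prog.exists_cost_le (p : Prog) : ∃ A d : ℕ, ∀ N, p.cost N ≤ A * (N + 1) ^ d := by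
  have mono : ∀ (N : ℕ) {d d' : ℕ}, d ≤ d' → (N + 1) ^ d ≤ (N + 1) ^ d' := fun N d d' h =>
    Nat.pow_le_pow_right (Nat.succ_pos N) h
  have one : ∀ N d : ℕ, 1 ≤ (N + 1) ^ d := fun N d => Nat.one_le_pow _ _ (Nat.succ_pos N)
  induction p with
  | seq p q ihp ihq =>
    obtain ⟨A, d, hA⟩ := ihp
    obtain ⟨B, f, hB⟩ := ihq
    refine ⟨A + B, d + f, fun N => ?_⟩
    rw [Prog.cost, add_mul]
    exact add_le_add ((hA N).trans (Nat.mul_le_mul_left _ (mono N (by omega))))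
      ((hB N).trans (Nat.mul_le_mul_left _ (mono N (by omega))))
  | ifLe r s p q ihp ihq =>
    obtain ⟨A, d, hA⟩ := ihp
    obtain ⟨B, f, hB⟩ := ihq
    refine ⟨1 + (A + B), d + f, fun N => ?_⟩
    rw [Prog.cost, add_mul, add_mul, one_mul]
    exact add_le_add (one N _) (add_le_add ((hA N).trans (Nat.mul_le_mul_left _ (mono N (by omega))))
      ((hB N).trans (Nat.mul_le_mul_left _ (mono N (by omega)))))
  | loop r p ih =>
    obtain ⟨A, d, hA⟩ := ih
    refine ⟨1 + (1 + A), d + 1, fun N => ?_⟩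
    rw [Prog.cost, add_mul, one_mul]
    refine add_le_add (one N _) ?_
    calc N * (1 + p.cost N) ≤ (N + 1) * ((1 + A) * (N + 1) ^ d) := by
          refine Nat.mul_le_mul (Nat.le_succ N) ?_
          rw [add_mul, one_mul]
          exact add_le_add (one N d) (hA N)
      _ = _ := by ring
  | _ => exact ⟨1, 0, fun N => by simp [Prog.cost]⟩

/-- Initialization: store `1` in register `2` and `k + 1` in register `1`. -/
def initProg : Prog := .seq (.setNat 2 1) (.addNat 1 0 2)

theorem exec_initProg (e : Env) (c : Config) : exec e initProg c =
    { c with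
      nat := Function.update (Function.update c.nat 2 1) 1 (c.nat 0 + 1)
      time := c.time + 1 + 1 } := by
  simp [initProg, exec, Config.putNat]

/-- The initialization writes to register `1` and so lies outside `LoopsFixed`; its two steps are
counted separately, after which `N = k + 1` bounds both registers. -/
theorem exists_time_le {p : Prog} (hp : p.LoopsFixed) : ∃ A d : ℕ, ∀ (e : Env) (c : Config),
    c.time = 0 → (exec e (.seq initProg p) c).time ≤ A * (c.nat 0 + 2) ^ d := by
  obtain ⟨A, d, h⟩ := p.exists_cost_le
  refine ⟨A + 2, d, fun e c hc => ?_⟩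
  simp only [exec, exec_initProg]
  refine (hp.exec_spec e (N := c.nat 0 + 1) (by simp) (by simp)).2.2.trans ?_
  have h1 := h (c.nat 0 + 1)
  have h2 : 1 ≤ (c.nat 0 + 1 + 1) ^ d := Nat.one_le_pow _ _ (Nat.succ_pos _)
  rw [show c.nat 0 + 2 = c.nat 0 + 1 + 1 by ring, add_mul]
  simp only [hc]
  omega

/-! ### Programs that compute a real number

A program of level `d` leaves all registers and arrays below `d` unchanged and stores its result at
the beginning of the array `d`. -/

/-- The registers and arrays below `d` agree. -/
def Config.Agree (d : ℕ) (c c' : Config) : Prop :=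
  (∀ r < d, c'.nat r = c.nat r) ∧ ∀ a < d, c'.arr a = c.arr a

theorem Config.Agree.trans {d : ℕ} {a b c : Config} (h : a.Agree d b) (h' : b.Agree d c) :
    a.Agree d c :=
  ⟨fun r hr => (h'.1 r hr).trans (h.1 r hr), fun r hr => (h'.2 r hr).trans (h.2 r hr)⟩

theorem Config.Agree.mono {d d' : ℕ} {a b : Config} (h : a.Agree d b) (hd : d' ≤ d) :
    a.Agree d' b :=
  ⟨fun r hr => h.1 r (hr.trans_le hd), fun r hr => h.2 r (hr.trans_le hd)⟩

theorem Config.agree_tick (d : ℕ) (c : Config) : c.Agree d c.tick := ⟨fun _ _ => rfl, fun _ _ => rfl⟩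

theorem Config.agree_putNat {d r : ℕ} (hr : d ≤ r) (c : Config) (v : ℕ) :
    c.Agree d (c.putNat r v) :=
  ⟨fun s hs => Function.update_of_ne (by omega) _ _, fun _ _ => rfl⟩

theorem Config.agree_put {d : ℕ} {x : ℕ × ℕ} (hx : d ≤ x.1) (c : Config) (v : ℝ) :
    c.Agree d (c.put x v) :=
  ⟨fun _ _ => rfl, fun s hs => Function.update_of_ne (by omega) _ _⟩

/-- The program, of level `d`, computes `v` under the precondition `P`. -/
def Computes (e : Env) (d : ℕ) (P : Config → Prop) (p : Prog) (v : ℝ) : Prop :=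
  ∀ c, P c → c.Agree d (exec e p c) ∧ (exec e p c).arr d 0 = v

/-- The precondition `P` only concerns registers and arrays below `d` and says at least that the
registers contain the standard constants. -/
structure IsContext (k d : ℕ) (P : Config → Prop) : Prop where
  lt : 4 < d
  stable : ∀ c c', Config.Agree d c c' → P c → P c'
  k_eq : ∀ c, P c → c.nat 0 = k
  succ_eq : ∀ c, P c → c.nat 1 = k + 1
  one_eq : ∀ c, P c → c.nat 2 = 1
  zero_eq : ∀ c, P c → c.nat 4 = 0

theorem IsContext.mono {k d d' : ℕ} {P : Config → Prop} (h : IsContext k d P) (hd : d ≤ d') :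
    IsContext k d' P :=
  ⟨h.lt.trans_le hd, fun c c' hc => h.stable c c' (hc.mono hd), h.k_eq, h.succ_eq, h.one_eq,
    h.zero_eq⟩

theorem IsContext.and_nat {k d : ℕ} {P : Config → Prop} (h : IsContext k d P) (j : ℕ) :
    IsContext k (d + 1) fun c => P c ∧ c.nat d = j where
  lt := h.lt.trans (Nat.lt_succ_self d)
  stable c c' hc hP := ⟨h.stable c c' (hc.mono (Nat.le_succ d)) hP.1,
    (hc.1 d (Nat.lt_succ_self d)).trans hP.2⟩
  k_eq c hc := h.k_eq c hc.1
  succ_eq c hc := h.succ_eq c hc.1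
  one_eq c hc := h.one_eq c hc.1
  zero_eq c hc := h.zero_eq c hc.1

theorem Computes.of_imp {e : Env} {d : ℕ} {P Q : Config → Prop} {p : Prog} {v : ℝ}
    (h : Computes e d P p v) (hQ : ∀ c, Q c → P c) : Computes e d Q p v :=
  fun c hc => h c (hQ c hc)

/-- Write the result of an operation into the result cell. -/
theorem exec_put_computes {k d : ℕ} {P : Config → Prop} (hP : IsContext k d P) {c₀ c : Config}
    (hc₀ : P c₀) (hc : c₀.Agree d c) (v : ℝ) :
    c₀.Agree d (c.put (d, 4) v) ∧ (c.put (d, 4) v).arr d 0 = v := by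
  refine ⟨hc.trans (Config.agree_put (x := (d, 4)) le_rfl c v), ?_⟩
  have : c.nat 4 = 0 := hP.zero_eq c (hP.stable _ _ hc hc₀)
  simp [Config.put, this]

/-- A family of programs, one for each level. -/
abbrev ProgFam : Type := ℕ → Prog

/-- Register `4` holds `0` throughout, so the cell `(d, 4)` is the first entry of the array `d`. -/
def ProgFam.const (v : ℤ) : ProgFam := fun d => .setReal (d, 4) v

def ProgFam.cast (r : ℕ) : ProgFam := fun d => .castNat (d, 4) r

def ProgFam.bin (op : ℕ × ℕ → ℕ × ℕ → ℕ × ℕ → Prog) (p q : ProgFam) : ProgFam := fun d =>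
  .seq (p d) (.seq (q (d + 1)) (op (d, 4) (d, 4) (d + 1, 4)))

def ProgFam.ite (r s : ℕ) (p q : ProgFam) : ProgFam := fun d => .ifLe r s (p d) (q d)

/-- Iterate an operation, the number of iterations being the content of the register `r`; the index
is kept in the register `d`. -/
def ProgFam.fold (op : ℕ × ℕ → ℕ × ℕ → ℕ × ℕ → Prog) (v : ℤ) (r : ℕ) (p : ℕ → ProgFam) :
    ProgFam := fun d =>
  .seq (.setNat d 0) (.seq (.setReal (d, 4) v) (.loop r
    (.seq (p d (d + 1)) (.seq (op (d, 4) (d, 4) (d + 1, 4)) (.addNat d d 2)))))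

/-- Read the entry of index `i` of the array `a`. -/
def ProgFam.read (a i : ℕ) : ProgFam := fun d =>
  .seq (.setNat d i) (.seq (.setReal (d, 4) 0) (.addReal (d, 4) (d, 4) (a, d)))

section

variable {e : Env} {k d : ℕ} {P : Config → Prop}

theorem computes_const (hP : IsContext k d P) (v : ℤ) : Computes e d P (ProgFam.const v d) v :=
  fun _ hc => exec_put_computes hP hc ⟨fun _ _ => rfl, fun _ _ => rfl⟩ _

theorem computes_cast (hP : IsContext k d P) {r j : ℕ} (hr : ∀ c, P c → c.nat r = j) :
    Computes e d P (ProgFam.cast r d) j := fun c hc => by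
  rw [← hr c hc]
  exact exec_put_computes hP hc ⟨fun _ _ => rfl, fun _ _ => rfl⟩ _

/-- The second operand is computed one level higher, so the first result, in array `d`, survives. -/
theorem computes_bin (hP : IsContext k d P) {op : ℕ × ℕ → ℕ × ℕ → ℕ × ℕ → Prog}
    {f : ℝ → ℝ → ℝ} (hop : ∀ x y z c, exec e (op x y z) c = c.put x (f (c.get y) (c.get z)))
    {p q : ProgFam} {v w : ℝ} (hp : Computes e d P (p d) v)
    (hq : Computes e (d + 1) P (q (d + 1)) w) : Computes e d P (ProgFam.bin op p q d) (f v w) := by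
  intro c hc
  obtain ⟨h1, h2⟩ := hp c hc
  obtain ⟨h3, h4⟩ := hq _ (hP.stable _ _ h1 hc)
  simp only [ProgFam.bin, exec, hop]
  set c' := exec e (q (d + 1)) (exec e (p d) c) with hc'
  have hag : c.Agree d c' := h1.trans (h3.mono (Nat.le_succ d))
  have hz : c'.nat 4 = 0 := hP.zero_eq _ (hP.stable _ _ hag hc)
  have e1 : c'.get (d, 4) = v := by
    simp only [Config.get, hz, h3.2 d (Nat.lt_succ_self d), h2]
  have e2 : c'.get (d + 1, 4) = w := by simp only [Config.get, hz, h4]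
  rw [e1, e2]
  exact exec_put_computes hP hc hag _

theorem computes_add (hP : IsContext k d P) {p q : ProgFam} {v w : ℝ}
    (hp : Computes e d P (p d) v) (hq : Computes e (d + 1) P (q (d + 1)) w) :
    Computes e d P (ProgFam.bin .addReal p q d) (v + w) :=
  computes_bin hP (f := (· + ·)) (fun _ _ _ _ => rfl) hp hq

theorem computes_sub (hP : IsContext k d P) {p q : ProgFam} {v w : ℝ}
    (hp : Computes e d P (p d) v) (hq : Computes e (d + 1) P (q (d + 1)) w) :
    Computes e d P (ProgFam.bin .subReal p q d) (v - w) :=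
  computes_bin hP (f := (· - ·)) (fun _ _ _ _ => rfl) hp hq

theorem computes_mul (hP : IsContext k d P) {p q : ProgFam} {v w : ℝ}
    (hp : Computes e d P (p d) v) (hq : Computes e (d + 1) P (q (d + 1)) w) :
    Computes e d P (ProgFam.bin .mulReal p q d) (v * w) :=
  computes_bin hP (f := (· * ·)) (fun _ _ _ _ => rfl) hp hq

theorem computes_div (hP : IsContext k d P) {p q : ProgFam} {v w : ℝ}
    (hp : Computes e d P (p d) v) (hq : Computes e (d + 1) P (q (d + 1)) w) :
    Computes e d P (ProgFam.bin .divReal p q d) (v / w) :=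
  computes_bin hP (f := (· / ·)) (fun _ _ _ _ => rfl) hp hq

theorem computes_ite (hP : IsContext k d P) {r s i j : ℕ} (hr : ∀ c, P c → c.nat r = i)
    (hs : ∀ c, P c → c.nat s = j) {p q : ProgFam} {v w : ℝ} (hp : Computes e d P (p d) v)
    (hq : Computes e d P (q d) w) :
    Computes e d P (ProgFam.ite r s p q d) (if i ≤ j then v else w) := by
  intro c hc
  have ht : P c.tick := hP.stable _ _ (c.agree_tick d) hc
  simp only [ProgFam.ite, exec, hr c hc, hs c hc]
  split_ifs
  · exact ⟨(c.agree_tick d).trans (hp _ ht).1, (hp _ ht).2⟩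
  · exact ⟨(c.agree_tick d).trans (hq _ ht).1, (hq _ ht).2⟩

/-- Copying is done by adding to zero; register `d`, free at level `d`, holds the index. -/
theorem computes_read (hP : IsContext k d P) {a i : ℕ} (ha : a < d) {v : ℝ}
    (hv : ∀ c, P c → c.arr a i = v) : Computes e d P (ProgFam.read a i d) v := by
  intro c hc
  have h1 : c.Agree d ((c.putNat d i).put (d, 4) ((0 : ℤ) : ℝ)) :=
    (Config.agree_putNat le_rfl c i).trans (Config.agree_put (x := (d, 4)) le_rfl _ _)
  have h := exec_put_computes hP hc h1 v
  have hz := hP.zero_eq c hc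
  have h4 : 4 ≠ d := hP.lt.ne
  have := hv c hc
  simp only [ProgFam.read, exec]
  convert h using 3 <;>
    simp [Config.get, Config.put, Config.putNat, ha.ne, Function.update_of_ne h4, hz, this]

/-- The body runs at level `d + 1`: it may read the loop index in register `d`, and can change
neither this index nor the accumulator in array `d`. -/
theorem computes_fold (hP : IsContext k d P) {op : ℕ × ℕ → ℕ × ℕ → ℕ × ℕ → Prog}
    {f : ℝ → ℝ → ℝ} (hop : ∀ x y z c, exec e (op x y z) c = c.put x (f (c.get y) (c.get z)))
    {v : ℤ} {r n : ℕ} (hr : ∀ c, P c → c.nat r = n) {p : ℕ → ProgFam} {w : ℕ → ℝ}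
    (hp : ∀ j < n, Computes e (d + 1) (fun c => P c ∧ c.nat d = j) (p d (d + 1)) (w j))
    {acc : ℕ → ℝ} (h0 : acc 0 = v) (hs : ∀ j < n, acc (j + 1) = f (acc j) (w j)) :
    Computes e d P (ProgFam.fold op v r p d) (acc n) := by
  intro c hc
  simp only [ProgFam.fold]
  rw [exec, exec]
  set c₁ := exec e (.setReal (d, 4) v) (exec e (.setNat d 0) c) with hc₁
  have hag₁ : c.Agree d c₁ :=
    (Config.agree_putNat le_rfl c 0).trans (Config.agree_put (x := (d, 4)) le_rfl _ _)
  have hn : c₁.nat r = n := hr _ (hP.stable _ _ hag₁ hc)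
  have hz : ∀ c', c.Agree d c' → c'.nat 4 = 0 := fun c' h => hP.zero_eq _ (hP.stable _ _ h hc)
  have := exec_loop_induction (e := e) (r := r)
    (p := .seq (p d (d + 1)) (.seq (op (d, 4) (d, 4) (d + 1, 4)) (.addNat d d 2))) (c := c₁)
    (fun t c' => c.Agree d c' ∧ c'.nat d = t ∧ c'.arr d 0 = acc t)
    ⟨hag₁.trans (c₁.agree_tick d), by
      simp [hc₁, exec, Config.tick, Config.put, Config.putNat], by
      have h4 : c.nat 4 = 0 := hP.zero_eq c hc
      simp [hc₁, exec, Config.tick, Config.put, Config.putNat, h0,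
        Function.update_of_ne hP.lt.ne, h4]⟩
    (fun t ht c' hc' => by
      obtain ⟨h1, h2, h3⟩ := hc'
      rw [hn] at ht
      have h1' : c.Agree d c'.tick := h1.trans (c'.agree_tick d)
      obtain ⟨h5, h6⟩ := hp t ht c'.tick ⟨hP.stable _ _ h1' hc, h2⟩
      simp only [exec, hop]
      set c₂ := exec e (p d (d + 1)) c'.tick
      have h7 : c.Agree d c₂ := h1'.trans (h5.mono (Nat.le_succ d))
      have e1 : c₂.get (d, 4) = acc t := by
        simp only [Config.get, hz c₂ h7, h5.2 d (Nat.lt_succ_self d)]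
        exact h3
      have e2 : c₂.get (d + 1, 4) = w t := by simp only [Config.get, hz c₂ h7, h6]
      rw [e1, e2]
      obtain ⟨h8, h9⟩ := exec_put_computes hP hc h7 (f (acc t) (w t))
      refine ⟨h8.trans (Config.agree_putNat le_rfl _ _), ?_, ?_⟩
      · have e3 : c₂.nat d = t := (h5.1 d (Nat.lt_succ_self d)).trans h2
        have e4 : c₂.nat 2 = 1 := hP.one_eq _ (hP.stable _ _ h7 hc)
        simp [Config.putNat, Config.put, e3, e4]
      · rw [hs t ht]
        exact h9)
  rw [hn] at this
  exact ⟨this.1, this.2.2⟩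

theorem computes_sum (hP : IsContext k d P) {p : ℕ → ProgFam} {w : ℕ → ℝ}
    (hp : ∀ j ≤ k, Computes e (d + 1) (fun c => P c ∧ c.nat d = j) (p d (d + 1)) (w j)) :
    Computes e d P (ProgFam.fold .addReal 0 1 p d) (∑ j ∈ Finset.range (k + 1), w j) :=
  computes_fold hP (f := (· + ·)) (acc := fun n => ∑ j ∈ Finset.range n, w j)
    (fun _ _ _ _ => rfl) hP.succ_eq
    (fun j hj => hp j (Nat.lt_succ_iff.1 hj)) (by simp) fun j _ => Finset.sum_range_succ w j

theorem computes_prod (hP : IsContext k d P) {p : ℕ → ProgFam} {w : ℕ → ℝ}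
    (hp : ∀ j < k, Computes e (d + 1) (fun c => P c ∧ c.nat d = j) (p d (d + 1)) (w j)) :
    Computes e d P (ProgFam.fold .mulReal 1 0 p d) (∏ j ∈ Finset.range k, w j) :=
  computes_fold hP (f := (· * ·)) (acc := fun n => ∏ j ∈ Finset.range n, w j)
    (fun _ _ _ _ => rfl) hP.k_eq hp (by simp)
    fun j _ => Finset.prod_range_succ w j

end

/-! ### Programs for the iterated Bernstein basis -/

/-- The value of the Bernstein basis polynomial of index the content of `r`, at the point computed
by `x`. -/
def ProgFam.basis (x : ProgFam) (r : ℕ) : ProgFam :=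
  ProgFam.fold .mulReal 1 0 fun i => ProgFam.ite r i
    (ProgFam.bin .subReal (ProgFam.const 1) x)
    (ProgFam.bin .mulReal (ProgFam.bin .divReal
      (ProgFam.bin .subReal (ProgFam.cast 0) (ProgFam.cast i))
      (ProgFam.bin .addReal (ProgFam.cast i) (ProgFam.const 1))) x)

/-- The `n`-th iterate of the Bernstein operator, applied to the basis polynomial of index the
content of `r`, at the point computed by `x`. -/
def ProgFam.iterate : ℕ → ProgFam → ℕ → ProgFam
  | 0, x, r => ProgFam.basis x r
  | n + 1, x, r => ProgFam.fold .addReal 0 1 fun i => ProgFam.bin .mulReal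
      (ProgFam.iterate n (ProgFam.bin .divReal (ProgFam.cast i) (ProgFam.cast 0)) r)
      (ProgFam.basis x i)

/-- The first `m` terms of the iterated Bernstein basis of order `h`. -/
def ProgFam.iterBasis (h : ℕ) (x : ProgFam) (r : ℕ) : ℕ → ProgFam
  | 0 => ProgFam.const 0
  | m + 1 => ProgFam.bin .addReal (ProgFam.iterBasis h x r m)
      (ProgFam.bin .mulReal (ProgFam.const (h.choose (m + 1) * (-1) ^ m)) (ProgFam.iterate m x r))

/-- The product of the iterated basis polynomials over the first `m` coordinates; the indices are
the contents of the registers `10, …, 9 + m`. -/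
def ProgFam.tensorBasis (h : ℕ) : ℕ → ProgFam
  | 0 => ProgFam.const 1
  | m + 1 => ProgFam.bin .mulReal (ProgFam.tensorBasis h m)
      (ProgFam.iterBasis h (ProgFam.read 0 m) (10 + m) h)

/-- The binomial coefficient is a product of `ν` ratios; the other `k - ν` factors are `1 - x`. A
single loop of length `k` thus computes the basis function. -/
theorem prod_range_eq_bernsteinBasis {k ν : ℕ} (hν : ν ≤ k) (x : ℝ) :
    ∏ i ∈ Finset.range k, (if ν ≤ i then 1 - x else ((k : ℝ) - i) / (i + 1) * x) =
      bernsteinBasis k ν x := by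
  have h1 : ∏ i ∈ Finset.range ν, (((k : ℝ) - i) / (i + 1) * x) = k.choose ν * x ^ ν := by
    clear hν
    induction ν with
    | zero => simp
    | succ ν ih =>
      rw [Finset.prod_range_succ, ih]
      have h2 : ((k.choose (ν + 1) * (ν + 1) : ℕ) : ℝ) = (k.choose ν * (k - ν) : ℕ) :=
        congrArg _ (Nat.choose_succ_right_eq k ν)
      have h3 : (k.choose ν : ℝ) * ((k - ν : ℕ) : ℝ) = k.choose ν * ((k : ℝ) - ν) := by
        rcases le_or_gt ν k with h | h
        · rw [Nat.cast_sub h]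
        · rw [Nat.choose_eq_zero_of_lt h]; simp
      push_cast at h2
      rw [h3] at h2
      have h4 : ((ν : ℝ) + 1) ≠ 0 := by positivity
      field_simp
      linear_combination (-x ^ (ν + 1)) * h2
  obtain ⟨m, rfl⟩ := Nat.exists_eq_add_of_le hν
  rw [Finset.prod_range_add, bernsteinBasis_eq, Nat.add_sub_cancel_left]
  congr 1
  · rw [← h1]
    refine Finset.prod_congr rfl fun i hi => ?_
    rw [if_neg (not_le.2 (Finset.mem_range.1 hi))]
  · rw [Finset.prod_congr rfl fun i _ => if_pos (Nat.le_add_right ν i)]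
    simp

section

variable {e : Env} {k D : ℕ} {P : Config → Prop}

theorem computes_basis (hP : IsContext k D P) {x : ProgFam} {v : ℝ}
    (hx : ∀ d, D ≤ d → Computes e d P (x d) v) {r ν : ℕ} (hr : ∀ c, P c → c.nat r = ν)
    (hν : ν ≤ k) (d : ℕ) (hd : D ≤ d) :
    Computes e d P (ProgFam.basis x r d) (bernsteinBasis k ν v) := by
  rw [← prod_range_eq_bernsteinBasis hν]
  refine computes_prod (hP.mono hd) fun j hj => ?_
  have hQ := (hP.mono hd).and_nat j
  have hj' : ∀ c : Config, P c ∧ c.nat d = j → c.nat d = j := fun c hc => hc.2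
  have hx' : ∀ d', D ≤ d' → Computes e d' (fun c => P c ∧ c.nat d = j) (x d') v := fun d' h' =>
    (hx d' h').of_imp fun c hc => hc.1
  refine computes_ite hQ (fun c hc => hr c hc.1) hj' ?_ ?_
  · have := computes_const (e := e) hQ 1
    rw [Int.cast_one] at this
    exact computes_sub hQ this (hx' _ (by omega))
  · have h1 := computes_const (e := e) (hQ.mono (d' := d + 3) (by omega)) 1
    rw [Int.cast_one] at h1
    exact computes_mul hQ (computes_div hQ (computes_sub hQ (computes_cast hQ hQ.k_eq)
      (computes_cast (hQ.mono (Nat.le_succ _)) hj'))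
      (computes_add (hQ.mono (Nat.le_succ _)) (computes_cast (hQ.mono (Nat.le_succ _)) hj') h1))
      (hx' _ (by omega))

/-- The induction is over all contexts and all points, because the inner iterate is evaluated at the
node `j / k`, in a context enlarged by the loop index. -/
theorem computes_iterate (n : ℕ) : ∀ {D : ℕ} {P : Config → Prop}, IsContext k D P →
    ∀ {x : ProgFam} {v : ℝ}, (∀ d, D ≤ d → Computes e d P (x d) v) →
    ∀ {r ν : ℕ}, (∀ c, P c → c.nat r = ν) → ν ≤ k → ∀ d, D ≤ d →
    Computes e d P (ProgFam.iterate n x r d) ((bernsteinOp k)^[n] (bernsteinBasis k ν) v) := by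
  induction n with
  | zero => exact fun hP _ _ hx _ _ hr hν d hd => computes_basis hP hx hr hν d hd
  | succ n ih =>
    intro D P hP x v hx r ν hr hν d hd
    rw [Function.iterate_succ_apply']
    refine computes_sum (hP.mono hd) fun j hj => ?_
    have hQ := (hP.mono hd).and_nat j
    have hj' : ∀ c : Config, P c ∧ c.nat d = j → c.nat d = j := fun c hc => hc.2
    refine computes_mul hQ (ih hQ (fun d' hd' => ?_) (fun c hc => hr c hc.1) hν _ le_rfl)
      (computes_basis (hP := hQ) (fun d' hd' => (hx d' (by omega)).of_imp fun c hc => hc.1) hj' hj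
        _ (Nat.le_succ _))
    have hQ' := hQ.mono hd'
    exact computes_div hQ' (computes_cast hQ' hj')
      (computes_cast (hQ'.mono (Nat.le_succ _)) hQ'.k_eq)

theorem computes_iterBasis (h : ℕ) (hP : IsContext k D P) {x : ProgFam} {v : ℝ}
    (hx : ∀ d, D ≤ d → Computes e d P (x d) v) {r ν : ℕ} (hr : ∀ c, P c → c.nat r = ν)
    (hν : ν ≤ k) (d : ℕ) (hd : D ≤ d) :
    Computes e d P (ProgFam.iterBasis h x r h d) (iterBasis h k ν v) := by
  have key : ∀ m d, D ≤ d → Computes e d P (ProgFam.iterBasis h x r m d)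
      (∑ i ∈ Finset.range m, (h.choose (i + 1) : ℝ) * (-1) ^ i *
        (bernsteinOp k)^[i] (bernsteinBasis k ν) v) := by
    intro m
    induction m with
    | zero =>
      intro d hd
      have := computes_const (e := e) (hP.mono hd) 0
      rw [Int.cast_zero] at this
      rw [Finset.sum_range_zero]
      exact this
    | succ m ih =>
      intro d hd
      rw [Finset.sum_range_succ]
      refine computes_add (hP.mono hd) (ih d hd) (computes_mul (hP.mono (by omega)) ?_
        (computes_iterate m hP hx hr hν _ (by omega)))
      have := computes_const (e := e) (hP.mono (d' := d + 1) (by omega))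
        (h.choose (m + 1) * (-1) ^ m)
      push_cast at this
      exact this
  have hIcc : Finset.Icc 1 h = Finset.Ico (0 + 1) (h + 1) := by ext; simp
  have heq : iterBasis h k ν v = ∑ i ∈ Finset.range h, (h.choose (i + 1) : ℝ) * (-1) ^ i *
      (bernsteinOp k)^[i] (bernsteinBasis k ν) v := by
    rw [iterBasis, hIcc, ← Finset.sum_Ico_add' _ 0 h 1, ← Finset.range_eq_Ico]
    rfl
  rw [heq]
  exact key h d hd

theorem computes_tensorBasis (h m : ℕ) (hP : IsContext k D P) {ν : ℕ → ℕ} {y : ℕ → ℝ}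
    (hν : ∀ i < m, ∀ c, P c → c.nat (10 + i) = ν i) (hνk : ∀ i < m, ν i ≤ k)
    (hy : ∀ i < m, ∀ c, P c → c.arr 0 i = y i) (d : ℕ) (hd : D ≤ d) :
    Computes e d P (ProgFam.tensorBasis h m d)
      (∏ i ∈ Finset.range m, iterBasis h k (ν i) (y i)) := by
  induction m generalizing d with
  | zero =>
    have := computes_const (e := e) (hP.mono hd) 1
    rw [Int.cast_one] at this
    rw [Finset.prod_range_zero]
    exact this
  | succ m ih =>
    rw [Finset.prod_range_succ]
    refine computes_mul (hP.mono hd) (ih (fun i hi => hν i (by omega))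
      (fun i hi => hνk i (by omega)) (fun i hi => hy i (by omega)) d hd)
      (computes_iterBasis h hP (fun d' hd' => ?_) (hν m (by omega)) (hνk m (by omega)) _ (by omega))
    exact computes_read (hP.mono hd') (by have := hP.lt; omega) (hy m (by omega))

end

/-! ### Loops over the lattice -/

/-- Nested loops: the program is executed for all contents in `{0, …, k}` of the registers
`10, …, 9 + m`, in the order of the addresses. -/
def nest (p : Prog) : ℕ → Prog
  | 0 => p
  | i + 1 => .seq (.setNat (10 + i) 0)
      (.loop 1 (.seq (nest p i) (.addNat (10 + i) (10 + i) 2)))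

/-- The registers `10 + i` with `m ≤ i < ℓ` contain the digits of `J` in base `K`. -/
def HasDigits (ℓ K m J : ℕ) (c : Config) : Prop :=
  ∀ i, m ≤ i → i < ℓ → c.nat (10 + i) = J / K ^ i % K

/-- Adding `t K^m` to a multiple of `K^(m+1)` sets the digit `m` to `t` without a carry. -/
theorem digit_add {K m i a t : ℕ} (hK : 0 < K) (ht : t < K) (hi : m ≤ i) :
    (K ^ (m + 1) * a + t * K ^ m) / K ^ i % K =
      if i = m then t else K ^ (m + 1) * a / K ^ i % K := by
  split_ifs with h
  · subst h
    rw [show K ^ (i + 1) * a + t * K ^ i = K ^ i * (K * a + t) by ring,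
      Nat.mul_div_cancel_left _ (pow_pos hK i), Nat.mul_add_mod, Nat.mod_eq_of_lt ht]
  · obtain ⟨j, rfl⟩ := Nat.exists_eq_add_of_le (show m + 1 ≤ i by omega)
    have hlt : t * K ^ m < K ^ (m + 1) := by
      rw [pow_succ, mul_comm]
      exact Nat.mul_lt_mul_of_pos_left ht (pow_pos hK m)
    rw [pow_add K (m + 1) j, ← Nat.div_div_eq_div_mul, ← Nat.div_div_eq_div_mul,
      Nat.mul_add_div (pow_pos hK _), Nat.div_eq_of_lt hlt, add_zero,
      Nat.mul_div_cancel_left _ (pow_pos hK _)]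

/-- The invariant does not concern the counters of the nested loops, nor the time. -/
structure IsNestInvariant (ℓ k : ℕ) (I : ℕ → Config → Prop) : Prop where
  congr : ∀ J c c', (∀ r, r < 10 → c'.nat r = c.nat r) → c'.arr = c.arr → c'.drawn = c.drawn →
    I J c → I J c'
  succ_eq : ∀ J c, I J c → c.nat 1 = k + 1
  one_eq : ∀ J c, I J c → c.nat 2 = 1

/-- By induction on the depth: `m` nested loops started at an address divisible by `(k+1)^m` process
the block of the next `(k+1)^m` addresses. Only the digits from `m` upwards are prescribed at the
start, the lower counters being set by the loops themselves. -/
theorem exec_nest {ℓ k : ℕ} {I : ℕ → Config → Prop} (hI : IsNestInvariant ℓ k I) {e : Env}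
    {p : Prog} (hp : ∀ J < (k + 1) ^ ℓ, ∀ c, I J c → HasDigits ℓ (k + 1) 0 J c →
      I (J + 1) (exec e p c) ∧ ∀ i < ℓ, (exec e p c).nat (10 + i) = c.nat (10 + i))
    (m : ℕ) (hm : m ≤ ℓ) (J : ℕ) (hJm : (k + 1) ^ m ∣ J) (hJ : J < (k + 1) ^ ℓ) (c : Config)
    (hc : I J c) (hd : HasDigits ℓ (k + 1) m J c) :
    I (J + (k + 1) ^ m) (exec e (nest p m) c) ∧
      ∀ i, m ≤ i → i < ℓ → (exec e (nest p m) c).nat (10 + i) = c.nat (10 + i) := by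
  induction m generalizing J c with
  | zero =>
    obtain ⟨h1, h2⟩ := hp J hJ c hc hd
    exact ⟨by simpa [nest] using h1, fun i _ => h2 i⟩
  | succ m ih =>
    obtain ⟨a, rfl⟩ := hJm
    set K := k + 1 with hK
    have hK0 : 0 < K := Nat.succ_pos k
    -- `K^ℓ` is itself a multiple of the block length, so a block that starts below it ends at or
    -- below it.
    have hend : K ^ (m + 1) * a + K ^ (m + 1) ≤ K ^ ℓ := by
      obtain ⟨b, hb⟩ := pow_dvd_pow K hm
      rw [hb] at hJ ⊢
      have : a < b := lt_of_mul_lt_mul_left hJ (Nat.zero_le _)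
      calc _ = K ^ (m + 1) * (a + 1) := by ring
        _ ≤ _ := Nat.mul_le_mul_left _ this
    simp only [nest]
    rw [exec]
    set c₁ := exec e (.setNat (10 + m) 0) c with hc₁
    have hup : ∀ (c : Config) (v : ℕ) (r : ℕ), r ≠ 10 + m → (c.putNat (10 + m) v).nat r = c.nat r :=
      fun c v r hr => Function.update_of_ne hr _ _
    have hIc₁ : I (K ^ (m + 1) * a) c₁ :=
      hI.congr _ c _ (fun r hr => hup c 0 r (by omega)) rfl rfl hc
    have hn : c₁.nat 1 = K := hI.succ_eq _ _ hIc₁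
    have := exec_loop_induction (e := e) (r := 1)
      (p := .seq (nest p m) (.addNat (10 + m) (10 + m) 2)) (c := c₁)
      (fun t c' => I (K ^ (m + 1) * a + t * K ^ m) c' ∧ c'.nat (10 + m) = t ∧
        ∀ i, m + 1 ≤ i → i < ℓ → c'.nat (10 + i) = c.nat (10 + i))
      ⟨by
        rw [zero_mul, add_zero]
        exact hI.congr _ c₁ _ (fun _ _ => rfl) rfl rfl hIc₁, by
        simp [hc₁, exec, Config.putNat, Config.tick], fun i hi _ => hup c 0 _ (by omega)⟩
      (fun t ht c' hc' => by
        obtain ⟨h1, h2, h3⟩ := hc'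
        rw [hn] at ht
        have hlt : t * K ^ m + K ^ m ≤ K ^ (m + 1) := by
          rw [pow_succ, mul_comm (K ^ m) K, ← Nat.succ_mul]
          exact Nat.mul_le_mul_right _ ht
        have hKm : 0 < K ^ m := pow_pos hK0 m
        obtain ⟨h4, h5⟩ := ih (by omega) (K ^ (m + 1) * a + t * K ^ m)
          (Dvd.dvd.add (Dvd.dvd.mul_right (pow_dvd_pow K (Nat.le_succ m)) a)
            (Dvd.intro_left t rfl)) (by omega) c'.tick
          (hI.congr _ c' _ (fun _ _ => rfl) rfl rfl h1) (fun i hi hiℓ => by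
            rw [digit_add hK0 ht hi]
            split_ifs with him
            · rw [him]; exact h2
            · exact (h3 i (by omega) hiℓ).trans (hd i (by omega) hiℓ))
        rw [exec]
        set c₂ := exec e (nest p m) c'.tick
        have h6 : c₂.nat 2 = 1 := hI.one_eq _ _ h4
        refine ⟨?_, ?_, fun i hi hiℓ => ?_⟩
        · rw [add_mul, one_mul, ← add_assoc]
          exact hI.congr _ c₂ _ (fun r hr => hup c₂ _ r (by omega)) rfl rfl h4
        · have h7 : c₂.nat (10 + m) = t := (h5 m le_rfl (by omega)).trans h2
          simp [exec, Config.putNat, h6, h7]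
        · exact (hup c₂ _ _ (by omega)).trans ((h5 i (by omega) hiℓ).trans (h3 i hi hiℓ)))
    rw [hn] at this
    refine ⟨?_, this.2.2⟩
    have h := this.1
    rwa [← pow_succ'] at h

/-! ### Loop control in the constructed programs -/

theorem ProgFam.loopsFixed_basis {x : ProgFam} (hx : ∀ d, 2 ≤ d → (x d).LoopsFixed) (r d : ℕ)
    (hd : 2 ≤ d) : (ProgFam.basis x r d).LoopsFixed :=
  ⟨hd, trivial, Nat.zero_lt_two,
    ⟨⟨trivial, hx _ (by omega), trivial⟩,
      ⟨⟨trivial, trivial, trivial⟩, ⟨trivial, trivial, trivial⟩, trivial⟩, hx _ (by omega), trivial⟩,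
    trivial, hd⟩

theorem ProgFam.loopsFixed_iterate (n : ℕ) : ∀ {x : ProgFam},
    (∀ d, 2 ≤ d → (x d).LoopsFixed) → ∀ r d, 2 ≤ d → (ProgFam.iterate n x r d).LoopsFixed := by
  induction n with
  | zero => exact fun hx r d hd => ProgFam.loopsFixed_basis hx r d hd
  | succ n ih =>
    exact fun hx r d hd => ⟨hd, trivial, Nat.one_lt_two,
      ⟨ih (x := ProgFam.bin .divReal (ProgFam.cast _) (ProgFam.cast 0))
        (fun _ _ => ⟨trivial, trivial, trivial⟩) _ _ (by omega),
        ProgFam.loopsFixed_basis hx _ _ (by omega), trivial⟩, trivial, hd⟩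

theorem ProgFam.loopsFixed_iterBasis (h : ℕ) {x : ProgFam} (hx : ∀ d, 2 ≤ d → (x d).LoopsFixed)
    (r m d : ℕ) (hd : 2 ≤ d) : (ProgFam.iterBasis h x r m d).LoopsFixed := by
  induction m with
  | zero => exact trivial
  | succ m ih =>
    exact ⟨ih, ⟨trivial, ProgFam.loopsFixed_iterate m hx r _ (by omega), trivial⟩, trivial⟩

theorem ProgFam.loopsFixed_tensorBasis (h m d : ℕ) (hd : 2 ≤ d) :
    (ProgFam.tensorBasis h m d).LoopsFixed := by
  induction m with
  | zero => exact trivial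
  | succ m ih =>
    exact ⟨ih, ProgFam.loopsFixed_iterBasis h (x := ProgFam.read 0 m)
      (fun d hd => ⟨hd, trivial, trivial⟩) _ _ _ (by omega), trivial⟩

theorem loopsFixed_nest {p : Prog} (hp : p.LoopsFixed) (m : ℕ) : (nest p m).LoopsFixed := by
  induction m with
  | zero => exact hp
  | succ m ih =>
    exact ⟨show 2 ≤ 10 + m by omega, show 1 < 2 by norm_num, ih, show 2 ≤ 10 + m by omega⟩

/-! ### The program for evaluation -/

/-- Read the entry of the array `1` whose index is the content of the register `3`. -/
def ProgFam.coeff : ProgFam := fun d => .seq (.setReal (d, 4) 0) (.addReal (d, 4) (d, 4) (1, 3))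

theorem computes_coeff {e : Env} {k d : ℕ} {P : Config → Prop} (hP : IsContext k d P) {j : ℕ}
    {v : ℝ} (hj : ∀ c, P c → c.nat 3 = j) (hv : ∀ c, P c → c.arr 1 j = v) :
    Computes e d P (ProgFam.coeff d) v := by
  intro c hc
  have h := exec_put_computes hP hc
    (Config.agree_put (x := (d, 4)) le_rfl c ((0 : ℤ) : ℝ)) v
  have hz := hP.zero_eq c hc
  have h1 : 1 ≠ d := by have := hP.lt; omega
  have := hv c hc
  simp only [ProgFam.coeff, exec]
  convert h using 3 <;>
    simp [Config.get, Config.put, h1, hj c hc, this]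

/-- Add the contribution of the current lattice point. -/
def evalStep (ℓ h : ℕ) : Prog :=
  .seq (ProgFam.bin .mulReal ProgFam.coeff (ProgFam.tensorBasis h ℓ) (10 + ℓ))
    (.seq (.addReal (2, 4) (2, 4) (10 + ℓ, 4)) (.addNat 3 3 2))

/-- The evaluation program. -/
def evalProg (ℓ h : ℕ) : Prog := .seq initProg (nest (evalStep ℓ h) ℓ)

theorem loopsFixed_evalStep (ℓ h : ℕ) : (evalStep ℓ h).LoopsFixed :=
  ⟨⟨⟨trivial, trivial⟩, ProgFam.loopsFixed_tensorBasis h ℓ _ (by omega), trivial⟩, trivial, show 2 ≤ 3 by norm_num⟩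

/-- The state of an evaluation after `J` lattice points have been processed. -/
structure EvalInv (ℓ h k : ℕ) (y w : ℕ → ℝ) (J : ℕ) (c : Config) : Prop where
  k_eq : c.nat 0 = k
  succ_eq : c.nat 1 = k + 1
  one_eq : c.nat 2 = 1
  index_eq : c.nat 3 = J
  zero_eq : c.nat 4 = 0
  point_eq : c.arr 0 = y
  coeff_eq : c.arr 1 = w
  sum_eq : c.arr 2 0 = ∑ j ∈ Finset.range J,
    w j * ∏ i ∈ Finset.range ℓ, iterBasis h k (j / (k + 1) ^ i % (k + 1)) (y i)

theorem isNestInvariant_evalInv (ℓ h k : ℕ) (y w : ℕ → ℝ) :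
    IsNestInvariant ℓ k (EvalInv ℓ h k y w) where
  congr J c c' hn ha _ hc := by
    refine ⟨?_, ?_, ?_, ?_, ?_, ?_, ?_, ?_⟩
    · rw [hn 0 (by norm_num), hc.k_eq]
    · rw [hn 1 (by norm_num), hc.succ_eq]
    · rw [hn 2 (by norm_num), hc.one_eq]
    · rw [hn 3 (by norm_num), hc.index_eq]
    · rw [hn 4 (by norm_num), hc.zero_eq]
    · rw [ha, hc.point_eq]
    · rw [ha, hc.coeff_eq]
    · rw [ha, hc.sum_eq]
  succ_eq _ _ hc := hc.succ_eq
  one_eq _ _ hc := hc.one_eq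

theorem EvalInv.of_agree {ℓ h k : ℕ} {y w : ℕ → ℝ} {J : ℕ} {c c' : Config}
    (hc : EvalInv ℓ h k y w J c) {d : ℕ} (hd : 10 ≤ d) (ha : c.Agree d c') :
    EvalInv ℓ h k y w J c' := by
  refine ⟨?_, ?_, ?_, ?_, ?_, ?_, ?_, ?_⟩
  · rw [ha.1 0 (by omega), hc.k_eq]
  · rw [ha.1 1 (by omega), hc.succ_eq]
  · rw [ha.1 2 (by omega), hc.one_eq]
  · rw [ha.1 3 (by omega), hc.index_eq]
  · rw [ha.1 4 (by omega), hc.zero_eq]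
  · rw [ha.2 0 (by omega), hc.point_eq]
  · rw [ha.2 1 (by omega), hc.coeff_eq]
  · rw [ha.2 2 (by omega), hc.sum_eq]

theorem exec_evalStep {e : Env} {ℓ h k : ℕ} {y w : ℕ → ℝ} {J : ℕ} {c : Config}
    (hc : EvalInv ℓ h k y w J c) (hd : HasDigits ℓ (k + 1) 0 J c) :
    EvalInv ℓ h k y w (J + 1) (exec e (evalStep ℓ h) c) ∧
      ∀ i < ℓ, (exec e (evalStep ℓ h) c).nat (10 + i) = c.nat (10 + i) := by
  -- Level `10 + ℓ` lies just above the lattice counters, so computing the summand disturbs neither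
  -- them nor the running sum in array `2`.
  have hP : IsContext k (10 + ℓ) fun c => EvalInv ℓ h k y w J c ∧ HasDigits ℓ (k + 1) 0 J c :=
    { lt := by omega
      stable := fun c c' ha hc => ⟨hc.1.of_agree (by omega) ha, fun i hi hiℓ =>
        (ha.1 _ (by omega)).trans (hc.2 i hi hiℓ)⟩
      k_eq := fun c hc => hc.1.k_eq
      succ_eq := fun c hc => hc.1.succ_eq
      one_eq := fun c hc => hc.1.one_eq
      zero_eq := fun c hc => hc.1.zero_eq }
  have key := computes_mul (e := e) hP
    (computes_coeff (j := J) (v := w J) hP (fun c hc => hc.1.index_eq)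
      (fun c hc => by rw [hc.1.coeff_eq]))
    (computes_tensorBasis h ℓ hP (fun i hi c hc => hc.2 i (Nat.zero_le i) hi)
      (fun i _ => Nat.lt_succ_iff.1 (Nat.mod_lt _ (Nat.succ_pos k)))
      (fun i _ c hc => by rw [hc.1.point_eq]) (10 + ℓ + 1) (Nat.le_succ _))
  obtain ⟨ha, hv⟩ := key c ⟨hc, hd⟩
  simp only [evalStep]
  rw [exec, exec]
  set c₁ := exec e (ProgFam.bin .mulReal ProgFam.coeff (ProgFam.tensorBasis h ℓ) (10 + ℓ)) c
  have h1 : EvalInv ℓ h k y w J c₁ := hc.of_agree (by omega) ha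
  refine ⟨⟨?_, ?_, ?_, ?_, ?_, ?_, ?_, ?_⟩, fun i hi => ?_⟩
  · simpa [exec, Config.putNat, Config.put] using h1.k_eq
  · simpa [exec, Config.putNat, Config.put] using h1.succ_eq
  · simpa [exec, Config.putNat, Config.put] using h1.one_eq
  · simp [exec, Config.putNat, Config.put, h1.index_eq, h1.one_eq]
  · simpa [exec, Config.putNat, Config.put] using h1.zero_eq
  · simpa [exec, Config.putNat, Config.put] using h1.point_eq
  · simpa [exec, Config.putNat, Config.put] using h1.coeff_eq
  · rw [Finset.sum_range_succ, ← hv, ← h1.sum_eq]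
    simp [exec, Config.putNat, Config.put, Config.get, h1.zero_eq]
  · rw [← ha.1 (10 + i) (by omega)]
    simp [exec, Config.putNat, Config.put, show 10 + i ≠ 3 by omega]

theorem exec_evalProg {ℓ k : ℕ} (h : ℕ) (w : LatticeIdx ℓ k → ℝ) (y : Fin ℓ → ℝ) :
    (evaluateRun (evalProg ℓ h) w y).arr 2 0 = bernsteinEval h w y := by
  set c₀ := evaluateStart w y with hc₀
  set e : Env := { oracle := fun _ => 0, tape := fun _ => 0 } with he
  have h0 : EvalInv ℓ h k (c₀.arr 0) (c₀.arr 1) 0 (exec e initProg c₀) := by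
    rw [exec_initProg]
    refine ⟨?_, ?_, ?_, ?_, ?_, rfl, rfl, ?_⟩ <;> simp [hc₀, evaluateStart]
  have hd : HasDigits ℓ (k + 1) ℓ 0 (exec e initProg c₀) := fun i h1 h2 => by omega
  have key := (exec_nest (isNestInvariant_evalInv ℓ h k (c₀.arr 0) (c₀.arr 1)) (e := e)
    (p := evalStep ℓ h) (fun J _ c hc hd => exec_evalStep hc hd) ℓ le_rfl 0 (dvd_zero _)
    (pow_pos (Nat.succ_pos k) ℓ) _ h0 hd).1.sum_eq
  rw [zero_add] at key
  have hrun : evaluateRun (evalProg ℓ h) w y =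
      exec e (nest (evalStep ℓ h) ℓ) (exec e initProg c₀) := rfl
  rw [hrun, key, bernsteinEval, ← Fin.sum_univ_eq_sum_range, ← finFunctionFinEquiv.symm.sum_comp]
  refine Finset.sum_congr rfl fun j _ => ?_
  rw [← Fin.prod_univ_eq_prod_range]
  congr 1
  · simp [hc₀, evaluateStart]
  · refine Finset.prod_congr rfl fun i _ => ?_
    congr 1
    simp [hc₀, evaluateStart]

/-! ### The program for sanitization -/

/-- Multiply the cell `(5, 4)` by the cell `(6, 4)`, `m` times. -/
def powProg : ℕ → Prog
  | 0 => .setNat 4 0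
  | m + 1 => .seq (powProg m) (.mulReal (5, 4) (5, 4) (6, 4))

/-- Compute the scale of the noise. -/
def scaleProg (ℓ : ℕ) : Prog :=
  .seq (.castNat (6, 4) 1) (.seq (.addReal (5, 4) (5, 4) (0, 4))
    (.seq (powProg ℓ) (.divReal (5, 4) (5, 4) (0, 2))))

/-- Store the first `m` coordinates of the current lattice point in the array `7`. -/
def pointProg : ℕ → Prog
  | 0 => .castNat (8, 4) 0
  | m + 1 => .seq (pointProg m) (.seq (.setNat 5 m) (.seq (.castNat (7, 5) (10 + m))
      (.divReal (7, 5) (7, 5) (8, 4))))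

/-- Release the value at the current lattice point. -/
def sanitizeStep (ℓ : ℕ) : Prog :=
  .seq (pointProg ℓ) (.seq (.query (1, 3) 7) (.seq (.draw (9, 4) (5, 4))
    (.seq (.addReal (1, 3) (1, 3) (9, 4)) (.addNat 3 3 2))))

/-- The sanitization program. -/
def sanitizeProg (ℓ : ℕ) : Prog :=
  .seq initProg (.seq (scaleProg ℓ) (nest (sanitizeStep ℓ) ℓ))

theorem loopsFixed_powProg (m : ℕ) : (powProg m).LoopsFixed := by
  induction m with
  | zero => exact show 2 ≤ 4 by norm_num
  | succ m ih => exact ⟨ih, trivial⟩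

theorem loopsFixed_pointProg (m : ℕ) : (pointProg m).LoopsFixed := by
  induction m with
  | zero => trivial
  | succ m ih => exact ⟨ih, show 2 ≤ 5 by norm_num, trivial, trivial⟩

theorem loopsFixed_sanitizeStep (ℓ : ℕ) : (sanitizeStep ℓ).LoopsFixed :=
  ⟨loopsFixed_pointProg ℓ, trivial, trivial, trivial, show 2 ≤ 3 by norm_num⟩

theorem loopsFixed_scaleProg (ℓ : ℕ) : (scaleProg ℓ).LoopsFixed :=
  ⟨trivial, trivial, loopsFixed_powProg ℓ, trivial⟩

/-- In the base case, writing `0` to register `4` changes only the time, because that register is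
already zero. -/
theorem exec_powProg (e : Env) (m : ℕ) (c : Config) (hc : c.nat 4 = 0) :
    (exec e (powProg m) c).nat = c.nat ∧
      (exec e (powProg m) c).arr = Function.update c.arr 5
        (Function.update (c.arr 5) 0 (c.arr 5 0 * c.arr 6 0 ^ m)) ∧
      (exec e (powProg m) c).drawn = c.drawn := by
  induction m with
  | zero =>
    refine ⟨?_, ?_, rfl⟩
    · rw [powProg, exec, Config.putNat, ← hc, Function.update_eq_self]
    · simp [powProg, exec, Config.putNat]
  | succ m ih =>
    obtain ⟨h1, h2, h3⟩ := ih
    refine ⟨?_, ?_, ?_⟩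
    · simpa [powProg, exec, Config.put] using h1
    · simp [powProg, exec, Config.put, Config.get, h1, h2, hc, pow_succ, mul_assoc]
    · simpa [powProg, exec, Config.put] using h3

/-- Register `4` holds `0` and register `2` holds `1`, so the cells `(0, 4)` and `(0, 2)` contain
`s` and `ε`. Array `5` starts at zero, so the addition copies `s` into it. -/
theorem exec_scaleProg (e : Env) (ℓ : ℕ) (c : Config) (h4 : c.nat 4 = 0) (h2 : c.nat 2 = 1)
    (h5 : c.arr 5 0 = 0) :
    (exec e (scaleProg ℓ) c).nat = c.nat ∧
      (exec e (scaleProg ℓ) c).arr 5 0 = c.arr 0 0 * (c.nat 1 : ℝ) ^ ℓ / c.arr 0 1 ∧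
      (exec e (scaleProg ℓ) c).drawn = c.drawn := by
  simp only [scaleProg, exec]
  set c₁ := (c.put (6, 4) (c.nat 1)).put (5, 4)
    ((c.put (6, 4) (c.nat 1)).get (5, 4) + (c.put (6, 4) (c.nat 1)).get (0, 4)) with hc₁
  have n4 : c₁.nat 4 = 0 := h4
  have a0 : c₁.arr 0 = c.arr 0 := by simp [hc₁, Config.put]
  have a5 : c₁.arr 5 0 = c.arr 0 0 := by simp [hc₁, Config.put, Config.get, h4, h5]
  have a6 : c₁.arr 6 0 = c.nat 1 := by simp [hc₁, Config.put, h4]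
  obtain ⟨h6, h7, h8⟩ := exec_powProg e ℓ c₁ n4
  have n2 : c₁.nat 2 = 1 := h2
  refine ⟨h6, ?_, h8⟩
  simp [Config.put, Config.get, h6, h7, n4, n2, a0, a5, a6]

theorem exec_pointProg (e : Env) (m : ℕ) (c : Config) (h4 : c.nat 4 = 0) :
    (∀ r, r ≠ 5 → (exec e (pointProg m) c).nat r = c.nat r) ∧
      (∀ a, a ≠ 7 → a ≠ 8 → (exec e (pointProg m) c).arr a = c.arr a) ∧
      (exec e (pointProg m) c).drawn = c.drawn ∧
      (exec e (pointProg m) c).arr 8 0 = c.nat 0 ∧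
      ∀ i < m, (exec e (pointProg m) c).arr 7 i = (c.nat (10 + i) : ℝ) / c.nat 0 := by
  induction m with
  | zero =>
    refine ⟨fun r _ => rfl, fun a _ h8 => ?_, rfl, ?_, fun i hi => by omega⟩
    · simp [pointProg, exec, Config.put, h8]
    · simp [pointProg, exec, Config.put, h4]
  | succ m ih =>
    obtain ⟨i1, i2, i3, i4, i5⟩ := ih
    simp only [pointProg, exec]
    set c₁ := exec e (pointProg m) c
    have h4' : c₁.nat 4 = 0 := (i1 4 (by norm_num)).trans h4
    refine ⟨fun r hr => ?_, fun a ha ha' => ?_, i3, ?_, fun i hi => ?_⟩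
    · simpa [Config.put, Config.putNat, hr] using i1 r hr
    · simpa [Config.put, Config.putNat, ha] using i2 a ha ha'
    · simpa [Config.put, Config.putNat] using i4
    · rcases Nat.lt_succ_iff_lt_or_eq.1 hi with hlt | rfl
      · simpa [Config.put, Config.putNat, Config.get, hlt.ne] using i5 i hlt
      · simp [Config.put, Config.putNat, Config.get, h4', i4,
          Function.update_of_ne (show 10 + i ≠ 5 by omega), i1 (10 + i) (by omega)]

/-- The state of a sanitization after `J` lattice points have been processed. -/
structure SanitizeInv (ℓ k : ℕ) (lam : ℝ) (g ω : ℕ → ℝ) (J : ℕ) (c : Config) : Prop where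
  k_eq : c.nat 0 = k
  succ_eq : c.nat 1 = k + 1
  one_eq : c.nat 2 = 1
  index_eq : c.nat 3 = J
  zero_eq : c.nat 4 = 0
  scale_eq : c.arr 5 0 = lam
  drawn_eq : c.drawn = J
  value_eq : ∀ j < J, c.arr 1 j = g j + lam * ω j

theorem isNestInvariant_sanitizeInv (ℓ k : ℕ) (lam : ℝ) (g ω : ℕ → ℝ) :
    IsNestInvariant ℓ k (SanitizeInv ℓ k lam g ω) where
  congr J c c' hn ha hd hc := by
    refine ⟨?_, ?_, ?_, ?_, ?_, ?_, ?_, ?_⟩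
    · rw [hn 0 (by norm_num), hc.k_eq]
    · rw [hn 1 (by norm_num), hc.succ_eq]
    · rw [hn 2 (by norm_num), hc.one_eq]
    · rw [hn 3 (by norm_num), hc.index_eq]
    · rw [hn 4 (by norm_num), hc.zero_eq]
    · rw [ha, hc.scale_eq]
    · rw [hd, hc.drawn_eq]
    · rw [ha]; exact hc.value_eq
  succ_eq _ _ hc := hc.succ_eq
  one_eq _ _ hc := hc.one_eq

/-- The value of `f` at the lattice point of address `j`. -/
def addressValue {ℓ : ℕ} (k : ℕ) (f : (Fin ℓ → ℝ) → ℝ) (j : ℕ) : ℝ :=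
  f fun i => ((j / (k + 1) ^ (i : ℕ) % (k + 1) : ℕ) : ℝ) / k

theorem exec_sanitizeStep {ℓ k : ℕ} {lam : ℝ} {f : (Fin ℓ → ℝ) → ℝ} {ω : ℕ → ℝ} {J : ℕ}
    {c : Config} (hc : SanitizeInv ℓ k lam (addressValue k f) ω J c)
    (hd : HasDigits ℓ (k + 1) 0 J c) :
    SanitizeInv ℓ k lam (addressValue k f) ω (J + 1)
        (exec { oracle := fun a => f fun i => a i, tape := ω } (sanitizeStep ℓ) c) ∧
      ∀ i < ℓ, (exec { oracle := fun a => f fun i => a i, tape := ω } (sanitizeStep ℓ) c).nat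
        (10 + i) = c.nat (10 + i) := by
  obtain ⟨i1, i2, i3, -, i5⟩ :=
    exec_pointProg { oracle := fun a => f fun i => a i, tape := ω } ℓ c hc.zero_eq
  simp only [sanitizeStep, exec]
  set c₁ := exec { oracle := fun a => f fun i => a i, tape := ω } (pointProg ℓ) c
  have n0 := (i1 0 (by norm_num)).trans hc.k_eq
  have n1 := (i1 1 (by norm_num)).trans hc.succ_eq
  have n2 := (i1 2 (by norm_num)).trans hc.one_eq
  have n3 := (i1 3 (by norm_num)).trans hc.index_eq
  have n4 := (i1 4 (by norm_num)).trans hc.zero_eq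
  have a5 := (congrFun (i2 5 (by norm_num) (by norm_num)) 0).trans hc.scale_eq
  have hval : (f fun i : Fin ℓ => c₁.arr 7 i) = addressValue k f J := by
    rw [addressValue]
    congr 1
    funext i
    rw [i5 i i.2, hd i (Nat.zero_le _) i.2, hc.k_eq]
  refine ⟨⟨?_, ?_, ?_, ?_, ?_, ?_, ?_, fun j hj => ?_⟩, fun i hi => ?_⟩
  · simpa [Config.putNat, Config.put] using n0
  · simpa [Config.putNat, Config.put] using n1
  · simpa [Config.putNat, Config.put] using n2
  · simp [Config.putNat, Config.put, n3, n2]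
  · simpa [Config.putNat, Config.put] using n4
  · simpa [Config.putNat, Config.put] using a5
  · simp [Config.putNat, Config.put, i3, hc.drawn_eq]
  · rcases Nat.lt_succ_iff_lt_or_eq.1 hj with hlt | rfl
    · have := (congrFun (i2 1 (by norm_num) (by norm_num)) j).trans (hc.value_eq j hlt)
      simpa [Config.putNat, Config.put, Config.get, n3, n4, hlt.ne] using this
    · simp [Config.putNat, Config.put, Config.get, n3, n4, a5, hval, i3, hc.drawn_eq]
  · simpa [Config.putNat, Config.put, Function.update_of_ne (show 10 + i ≠ 3 by omega)] using
      i1 (10 + i) (by omega)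

/-- There is exactly one draw per lattice point, so the sample used at an address has that address
as its number on the tape; distinct points therefore receive independent noise. -/
theorem readOutput_sanitizeRun {ℓ k : ℕ} (s ε : ℝ) (f : (Fin ℓ → ℝ) → ℝ) (ω : ℕ → ℝ)
    (ν : LatticeIdx ℓ k) :
    readOutput k (sanitizeRun (sanitizeProg ℓ) k s ε f ω) ν =
      f (latticePoint ν) + noiseScale ℓ k s ε * ω (finFunctionFinEquiv ν : ℕ) := by
  set c₀ := sanitizeStart k s ε with hc₀
  set e : Env := { oracle := fun a => f fun i => a i, tape := ω } with he
  set c₁ := exec e initProg c₀ with hc₁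
  rw [exec_initProg] at hc₁
  obtain ⟨h1, h2, h3⟩ := exec_scaleProg e ℓ c₁ (by simp [hc₁, hc₀, sanitizeStart])
    (by simp [hc₁, hc₀, sanitizeStart]) (by simp [hc₁, hc₀, sanitizeStart])
  have h0 : SanitizeInv ℓ k (noiseScale ℓ k s ε) (addressValue k f) ω 0
      (exec e (scaleProg ℓ) c₁) := by
    refine ⟨?_, ?_, ?_, ?_, ?_, ?_, ?_, fun j hj => by omega⟩
    iterate 5 · rw [h1]; simp [hc₁, hc₀, sanitizeStart]
    · rw [h2]; simp [hc₁, hc₀, sanitizeStart, noiseScale]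
    · rw [h3]; simp [hc₁, hc₀, sanitizeStart]
  have key := (exec_nest (isNestInvariant_sanitizeInv ℓ k (noiseScale ℓ k s ε)
    (addressValue k f) ω) (e := e) (p := sanitizeStep ℓ)
    (fun J _ c hc hd => exec_sanitizeStep hc hd) ℓ le_rfl 0 (dvd_zero _)
    (pow_pos (Nat.succ_pos k) ℓ) _ h0 (fun i h1 h2 => by omega)).1.value_eq
    (finFunctionFinEquiv ν : ℕ) (by rw [zero_add]; exact (finFunctionFinEquiv ν).2)
  refine key.trans ?_
  congr 1
  rw [addressValue]
  congr 1
  funext i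
  have : ((finFunctionFinEquiv ν : ℕ) / (k + 1) ^ (i : ℕ) % (k + 1) : ℕ) = (ν i : ℕ) := by
    conv_rhs => rw [← finFunctionFinEquiv.symm_apply_apply ν]
    rfl
  rw [this, latticePoint]

theorem implementsBernstein (ℓ h : ℕ) : ImplementsBernstein ℓ h (sanitizeProg ℓ) (evalProg ℓ h) := by
  refine fun k _ => ⟨fun f s ε hs hε => ?_, fun w y _ => exec_evalProg h w y⟩
  rw [← noisyValues_eq_map_infinitePi k (noiseScale_nonneg ℓ k hs hε) f
    (fun ν => (finFunctionFinEquiv ν : ℕ)) (Fin.val_injective.comp finFunctionFinEquiv.injective)]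
  congr 1
  funext ω ν
  exact readOutput_sanitizeRun s ε f ω ν

theorem runsInPolyTime (ℓ h : ℕ) {k : ℝ → ℝ → ℝ → ℕ}
    (hk : ∀ β₀ ε₀ : ℝ, β₀ < 1 → ∃ a b : ℝ, 0 ≤ b ∧ ∀ s ε β : ℝ, 0 < s → 0 < ε → ε ≤ ε₀ → 0 < β →
      β ≤ β₀ → (k s ε β : ℝ) ≤ a + b * (1 / s)) :
    RunsInPolyTime.{u} ℓ (sanitizeProg ℓ) (evalProg ℓ h) k := by
  obtain ⟨A, d, hA⟩ := exists_time_le (p := .seq (scaleProg ℓ) (nest (sanitizeStep ℓ) ℓ))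
    ⟨loopsFixed_scaleProg ℓ, loopsFixed_nest (loopsFixed_sanitizeStep ℓ) ℓ⟩
  obtain ⟨B, f, hB⟩ := exists_time_le (loopsFixed_nest (loopsFixed_evalStep ℓ h) ℓ)
  have hmono : ∀ (C m k : ℕ), C ≤ A + B → m ≤ d + f →
      ((C * (k + 2) ^ m : ℕ) : ℝ) ≤ ((A + B : ℕ) : ℝ) * ((k : ℝ) + 2) ^ (d + f) := by
    intro C m k hC hm
    exact_mod_cast Nat.mul_le_mul hC (Nat.pow_le_pow_right (by omega) hm)
  refine runsInPolyTime_of_le (A := ((A + B : ℕ) : ℝ)) (d := d + f) (Nat.cast_nonneg _) ?_ ?_ hk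
  · intro k s ε g ω
    refine le_trans ?_ (hmono A d k (by omega) (by omega))
    exact_mod_cast hA _ (sanitizeStart k s ε) rfl
  · intro k w y
    refine le_trans ?_ (hmono B f k (by omega) (by omega))
    exact_mod_cast hB _ (evaluateStart w y) rfl

end

theorem theorem1 :
    -- Privacy, for every cover size.
    (∀ (ℓ k n : ℕ) (X : Type u) (F : (Fin n → X) → (Fin ℓ → ℝ) → ℝ) (ε : ℝ),
      0 < ℓ → 0 < k → 0 < ε → sensitivity F ≠ ⊤ →
      DifferentiallyPrivate ε (bernsteinMechanism F k ε)) ∧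
    -- Programs for sanitization (depending on `ℓ`) and evaluation (depending on `ℓ`, `h`).
    ∃ (san : ℕ → Prog) (ev : ℕ → ℕ → Prog),
      (∀ ℓ h : ℕ, 0 < ℓ → 0 < h → ImplementsBernstein ℓ h (san ℓ) (ev ℓ h)) ∧
      -- Smooth functions.
      (∀ (ℓ h : ℕ) (T : ℝ), 0 < ℓ → 0 < h → 0 < T →
        ∃ k : ℝ → ℝ → ℝ → ℕ, (∀ s ε β, 0 < k s ε β) ∧
          HasErrorRate.{u} (ℓ := ℓ) (IsSmooth (2 * h) T) h k ((h : ℝ) / ((ℓ : ℝ) + h)) ∧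
          RunsInPolyTime.{u} ℓ (san ℓ) (ev ℓ h) k) ∧
      -- Hölder continuous functions.
      (∀ (ℓ : ℕ) (γ L : ℝ), 0 < ℓ → 0 < γ → γ ≤ 1 → 0 < L →
        ∃ k : ℝ → ℝ → ℝ → ℕ, (∀ s ε β, 0 < k s ε β) ∧
          ∀ h : ℕ, 0 < h →
            HasErrorRate.{u} (ℓ := ℓ) (IsHolder γ L) h k (γ / (2 * (ℓ : ℝ) + γ)) ∧
            RunsInPolyTime.{u} ℓ (san ℓ) (ev ℓ h) k) ∧
      -- Linear functions: a constant cover size, and no bound on the error scale.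
      (∀ ℓ h : ℕ, 0 < ℓ → 0 < h →
        ∃ k : ℕ, 0 < k ∧
          (∀ β₀ : ℝ, β₀ < 1 → ∃ C : ℝ, 0 < C ∧
            ∀ (n : ℕ) (X : Type u) (F : (Fin n → X) → (Fin ℓ → ℝ) → ℝ),
              (∀ D, IsLinearOnCube (F D)) → sensitivity F ≠ ⊤ →
              ∀ ε β : ℝ, 0 < ε → 0 < β → β ≤ β₀ →
                IsAccurate F h k ε (C * errorScale (sensitivity F).toReal ε β) β) ∧
          RunsInPolyTime.{u} ℓ (san ℓ) (ev ℓ h) fun _ _ _ => k) := by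
  refine ⟨fun ℓ k n X F ε _ _ hε hF => differentiallyPrivate_bernsteinMechanism k F hε hF,
    sanitizeProg, evalProg, fun ℓ h _ _ => implementsBernstein ℓ h, fun ℓ h T hℓ hh hT => ?_,
    fun ℓ γ L hℓ hγ hγ1 hL => ?_, fun ℓ h _ hh => ?_⟩
  · have hℓ' : (0 : ℝ) < ℓ := Nat.cast_pos.2 hℓ
    have hh' : (1 : ℝ) ≤ h := Nat.one_le_cast.2 hh
    exact ⟨coverSize (1 / ((ℓ : ℝ) + h)), coverSize_pos _, hasErrorRate_isSmooth hh hT,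
      runsInPolyTime ℓ h fun β₀ ε₀ hβ₀ => exists_coverSize_le (by positivity)
        (by rw [div_le_one (by positivity)]; linarith) β₀ ε₀ hβ₀⟩
  · have hℓ' : (1 : ℝ) ≤ ℓ := Nat.one_le_cast.2 hℓ
    exact ⟨coverSize (2 / (2 * (ℓ : ℝ) + γ)), coverSize_pos _, fun h hh =>
      ⟨hasErrorRate_isHolder hh hγ hγ1 hL, runsInPolyTime ℓ h fun β₀ ε₀ hβ₀ =>
        exists_coverSize_le (by positivity)
          (by rw [div_le_one (by positivity)]; linarith) β₀ ε₀ hβ₀⟩⟩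
  · refine ⟨1, one_pos, fun β₀ hβ₀ => ?_,
      runsInPolyTime ℓ h fun _ _ _ => ⟨1, 0, le_rfl, fun _ _ _ _ _ _ _ _ => by simp⟩⟩
    obtain ⟨C, hC, H⟩ := exists_isAccurate_of_isLinearOnCube hh hβ₀
    exact ⟨C, hC, fun n X F hF _ => H n X F hF⟩
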